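/- For $\tau\in\mathbb{H}=\{\tau\in\mathbb{C}:\operatorname{Im}\tau>0\}$ write $y=\operatorname{Im}\tau$ and $\Lambda_\tau=\mathbb{Z}\tau+\mathbb{Z}$. For $z\in\mathbb{C}$ and $u,v\in\mathbb{C}\setminus\Lambda_\tau$ put $$\theta(z)=\theta(z;\tau)=\sum_{\nu\in\frac12+\mathbb{Z}}e^{\pi i\nu^2\tau+2\pi i\nu(z+\frac12)},\qquad \mu(u,v;\tau)=\frac{e^{\pi iu}}{\theta(v;\tau)}\sum_{n\in\mathbb{Z}}\frac{(-1)^n e^{\pi i(n^2+n)\tau+2\pi inv}}{1-e^{2\pi in\tau+2\pi iu}},$$ and for $u\in\mathbb{C}$ put $$R(u;\tau)=\sum_{\nu\in\frac12+\mathbb{Z}}\Bigl\{\operatorname{sgn}(\nu)-E\bigl((\nu+\alpha)\sqrt{2y}\bigr)\Bigr\}(-1)^{\nu-\frac12}e^{-\pi i\nu^2\tau-2\pi i\nu u},\qquad \alpha=\frac{\operatorname{Im}u}{\operatorname{Im}\tau},\quad E(x)=2\int_0^x e^{-\pi t^2}\,dt .$$ Set $$\tilde\mu(u,v)=\tilde\mu(u,v;\tau)=\mu(u,v;\tau)+\frac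 i2R(u-v;\tau).$$ Let $\eta(\tau)=e^{\pi i\tau/12}\prod_{n\ge1}(1-e^{2\pi in\tau})$, and let $w^{1/2}$ denote the principal square root. Then, for all $\tau\in\mathbb{H}$ and $u,v\in\mathbb{C}\setminus\Lambda_\tau$: 1. For all $k,l,m,n\in\mathbb{Z}$, $$\tilde\mu(u+k\tau+l,v+m\tau+n)=(-1)^{k+l+m+n}e^{\pi i(k-m)^2\tau+2\pi i(k-m)(u-v)}\,\tilde\mu(u,v).$$ 2. For every $\gamma=\begin{pmatrix}a&b\\c&d\end{pmatrix}\in\operatorname{SL}_2(\mathbb{Z})$, the quantity $v(\gamma)=\eta\bigl(\tfrac{a\tau+b}{c\tau+d}\bigr)\big/\bigl((c\tau+d)^{1/2}\eta(\tau)\bigr)$ does not depend on $\tau\in\mathbb{H}$, and $$\tilde\mu\Bigl(\frac u{c\tau+d},\frac v{c\tau+d};\frac{a\tau+b}{c\tau+d}\Bigr)=v(\gamma)^{-3}(c\tau+d)^{1/2}e^{-\pi ic(u-v)^2/(c\tau+d)}\,\tilde\mu(u,v;\tau).$$ 3. $\tilde\mu(-u,-v)=\tilde\mu(v,u)=\tilde\mu(u,v)$.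 4. For every $z\in\mathbb{C}$ with $u+z,v+z\notin\Lambda_\tau$, $$\tilde\mu(u+z,v+z)-\tilde\mu(u,v)=\frac1{2\pi i}\,\frac{\theta'(0)\,\theta(u+v+z)\,\theta(z)}{\theta(u)\,\theta(v)\,\theta(u+z)\,\theta(v+z)},$$ where $\theta'$ is the derivative of $\theta(z;\tau)$ with respect to $z$. 5. For fixed $v$, the function $u\mapsto\tilde\mu(u,v)$ is real-analytic on $\mathbb{C}\setminus\Lambda_\tau$ and has a singularity of simple-pole type at each $p\in\Lambda_\tau$: there are a complex number $r\neq0$ and a function $g$, real-analytic near $p$, with $\tilde\mu(u,v)=\frac{r}{u-p}+g(u)$ for all $u\ne p$ close to $p$. Furthermore, $$\lim_{u\to0}u\,\tilde\mu(u,v)=\frac{-1}{2\pi i}\,\frac1{\theta(v)}.$$ -/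

import Mathlib

open Complex Filter Topology
open scoped Real

noncomputable section

namespace MockTheta

/-- The lattice `ℤτ + ℤ` in the complex plane. -/
def lattice (τ : ℂ) : Set ℂ := {z | ∃ n m : ℤ, z = n * τ + m}

/-- The Jacobi theta function
`θ(z;τ) = ∑_{ν ∈ 1/2 + ℤ} exp(πi ν² τ + 2πi ν (z + 1/2))`, with `ν = n + 1/2`, `n ∈ ℤ`. -/
def theta (z τ : ℂ) : ℂ :=
  ∑' n : ℤ, exp (π * I * ((n : ℂ) + 1 / 2) ^ 2 * τ + 2 * π * I * ((n : ℂ) + 1 / 2) * (z + 1 / 2))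

/-- The normalized Lerch sum
`μ(u,v;τ) = e^{πiu} / θ(v;τ) · ∑_{n ∈ ℤ} (-1)ⁿ e^{πi(n²+n)τ + 2πinv} / (1 - e^{2πinτ + 2πiu})`
(meaningful for `Im τ > 0` and `u, v ∉ ℤτ + ℤ`). -/
def mu (u v τ : ℂ) : ℂ :=
  exp (π * I * u) / theta v τ *
    ∑' n : ℤ, (-1 : ℂ) ^ n * exp (π * I * ((n : ℂ) ^ 2 + n) * τ + 2 * π * I * n * v) /
      (1 - exp (2 * π * I * n * τ + 2 * π * I * u))

/-- The odd error function `E(x) = 2 ∫₀ˣ e^{-πt²} dt`, at real arguments (the only ones that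
occur in `R`). -/
def E (x : ℝ) : ℝ := 2 * ∫ t in (0 : ℝ)..x, Real.exp (-π * t ^ 2)

/-- The series
`R(u;τ) = ∑_{ν ∈ 1/2 + ℤ} {sgn ν - E((ν + a)√(2y))} (-1)^{ν - 1/2} e^{-πiν²τ - 2πiνu}`,
where `y = Im τ`, `a = Im u / Im τ`; here `ν = n + 1/2`, `n ∈ ℤ`. -/
def R (u τ : ℂ) : ℂ :=
  ∑' n : ℤ,
    ((Real.sign ((n : ℝ) + 1 / 2)
        - E (((n : ℝ) + 1 / 2 + u.im / τ.im) * Real.sqrt (2 * τ.im)) : ℝ) : ℂ) *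
      (-1 : ℂ) ^ n *
      exp (-π * I * ((n : ℂ) + 1 / 2) ^ 2 * τ - 2 * π * I * ((n : ℂ) + 1 / 2) * u)

/-- The completed function `μ̃(u,v;τ) = μ(u,v;τ) + (i/2) R(u - v;τ)`. -/
def muTilde (u v τ : ℂ) : ℂ := mu u v τ + I / 2 * R (u - v) τ

/-- The multiplier of the Dedekind eta function,
`v(γ) = η((aτ+b)/(cτ+d)) / ((cτ+d)^{1/2} η(τ))`, for `γ = (a b; c d)`, with the principal branch
of the square root. The right-hand side is written with its argument `τ`; that it does not
depend on `τ` is not built in. -/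
def etaMultiplier (a b c d : ℤ) (τ : ℂ) : ℂ :=
  ModularForm.eta ((a * τ + b) / (c * τ + d)) /
    ((c * τ + d) ^ (1 / 2 : ℂ) * ModularForm.eta τ)

end MockTheta

end

noncomputable section

namespace MockTheta

open scoped ComplexConjugate

/-! ### Exponentials and the lattice -/

/-! The Lerch sum `mu` is meromorphic, but under `u ↦ u + τ` it satisfies only an inhomogeneous
relation (`mu_add_exp_mul_mu_add_tau`). The series `R` has a proportional defect
(`R_add_exp_mul_R_add_tau`), and in `mu + (I/2) R` the two defects cancel. This gives (1).

The main tool is Liouville's theorem: a function with removable singularities and constant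
multipliers under `z ↦ z + 1` and `z ↦ z + τ` is `C e^{βz}`, and it is constant if it is doubly
periodic. Comparison with a product (`exists_theta_eq_mul_thetaProd`) first shows that θ vanishes
only on the lattice, and simply. Statement (4) concerns `mu` alone, since `R` depends only on `u -
v`. There the difference of the two sides, cleared of denominators and divided by a product of two
thetas, has multipliers `1` and `e^{-2πiv}`, which no nonzero exponential can have when `v` is off
the lattice (`theta_mul_mu_add_sub_mu`). Taking `z = -(u + v)` in (4) gives the symmetry of `mu`,
hence (3).

For (2), `∂R/∂ū` is a Gaussian times the conjugate of θ (`hasDbarAt_R`). The inversion formula of θ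
makes the antiholomorphic derivatives of `R` and of its transform under `τ ↦ -1/τ` cancel
(`differentiable_R_add_R`). So `muTilde` plus its transform is meromorphic in `u`. Its poles cancel,
and multiplication by `θ(u - v)` makes it doubly periodic, hence constant; the constant is its value
at `u = v`, namely zero (`muTilde_neg_one_div`). The law for `τ ↦ τ + 1` holds term by term. To
reach all of `SL(2, ℤ)` without choosing branches of roots, the laws are composed for `η³ muTilde`,
of weight two (`isModularFor`). Modularity of `Δ = η²⁴` makes the eta multiplier a 24th root of
unity, so by continuity it is constant on the half-plane.

For (5), the term `n = 0` of the Lerch sum carries the pole at the origin, and (1) transports it to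
the whole lattice. Real-analyticity of `R` follows by treating `α` as an independent complex
variable: the series is jointly analytic in `(u, α)` (`analyticAt_rSeries`), and `R` is its pullback
along the real-linear map `u ↦ (u, Im u / Im τ)`. -/

lemma neg_one_zpow_eq_exp (n : ℤ) : (-1 : ℂ) ^ n = exp (π * I * n) := by
  rw [mul_comm, exp_int_mul, exp_pi_mul_I]

lemma exp_add_two_pi_I_mul_int (x : ℂ) (n : ℤ) : exp (x + 2 * π * I * n) = exp x := by
  rw [mul_comm _ (n : ℂ), exp_add, exp_int_mul_two_pi_mul_I, mul_one]

lemma exp_eq_exp_of_sub {x y : ℂ} (n : ℤ) (h : x = y + 2 * π * I * n) : exp x = exp y := by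
  rw [h, exp_add_two_pi_I_mul_int]

lemma exp_eq_neg_exp_of_sub {x y : ℂ} (n : ℤ) (h : x = y + π * I + 2 * π * I * n) :
    exp x = -exp y := by
  rw [h, exp_add_two_pi_I_mul_int, exp_add, exp_pi_mul_I, mul_neg_one]

lemma exp_pi_I_div_two : exp (π * I * (1 / 2)) = I := by
  rw [show (π : ℂ) * I * (1 / 2) = π / 2 * I by ring, exp_pi_div_two_mul_I]

lemma neg_one_zpow_mul_self (n : ℤ) : (-1 : ℂ) ^ n * (-1 : ℂ) ^ n = 1 := by
  rw [← mul_zpow]; simp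

lemma ne_zero_of_im_pos {τ : ℂ} (hτ : 0 < τ.im) : τ ≠ 0 := by
  rintro rfl; simp at hτ

lemma im_neg_one_div_pos {τ : ℂ} (hτ : 0 < τ.im) : 0 < (-1 / τ).im := by
  have := ne_zero_of_im_pos hτ
  rw [neg_div, neg_im, one_div, inv_im, neg_div, neg_neg]
  exact div_pos hτ (normSq_pos.mpr this)

lemma neg_mem_lattice {τ z : ℂ} : -z ∈ lattice τ ↔ z ∈ lattice τ := by
  constructor <;> rintro ⟨n, m, h⟩ <;> refine ⟨-n, -m, ?_⟩ <;> push_cast <;> linear_combination -h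

lemma add_int_mem_lattice {τ z : ℂ} (k l : ℤ) : z + k * τ + l ∈ lattice τ ↔ z ∈ lattice τ := by
  constructor
  · rintro ⟨n, m, h⟩
    exact ⟨n - k, m - l, by push_cast; linear_combination h⟩
  · rintro ⟨n, m, h⟩
    exact ⟨n + k, m + l, by push_cast; linear_combination h⟩

lemma add_one_mem_lattice {τ z : ℂ} : z + 1 ∈ lattice τ ↔ z ∈ lattice τ := by
  simpa using add_int_mem_lattice (τ := τ) (z := z) 0 1

lemma add_tau_mem_lattice {τ z : ℂ} : z + τ ∈ lattice τ ↔ z ∈ lattice τ := by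
  simpa using add_int_mem_lattice (τ := τ) (z := z) 1 0

lemma mem_lattice_of_exp_eq_one {τ z : ℂ} (n : ℤ)
    (h : exp (2 * π * I * n * τ + 2 * π * I * z) = 1) : z ∈ lattice τ := by
  obtain ⟨k, hk⟩ := exp_eq_one_iff.mp h
  refine ⟨-n, k, ?_⟩
  have h2 : (2 * π * I : ℂ) ≠ 0 := two_pi_I_ne_zero
  push_cast
  apply mul_left_cancel₀ h2
  linear_combination hk

/-- A property invariant under the translations by `1` and `τ` is invariant under the lattice. -/
lemma lattice_translation_invariant {τ : ℂ} {Q : ℂ → Prop} (h1 : ∀ p, Q p ↔ Q (p + 1))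
    (ht : ∀ p, Q p ↔ Q (p + τ)) (k l : ℤ) (p : ℂ) : Q p ↔ Q (p + k * τ + l) := by
  have key : ∀ (w : ℂ), (∀ p, Q p ↔ Q (p + w)) → ∀ (k : ℤ) (p : ℂ), Q p ↔ Q (p + k * w) := by
    intro w hw k p
    induction k using Int.induction_on with
    | zero => simp
    | succ i ih => rw [ih, hw]; push_cast; ring_nf
    | pred i ih => rw [ih, hw (p + ((-i - 1 : ℤ) : ℂ) * w)]; push_cast; ring_nf
  rw [key τ ht k p, key 1 h1 l]
  simp

lemma exists_strip_representative {τ : ℂ} (hτ : 0 < τ.im) (z : ℂ) :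
    ∃ (k l : ℤ) (w : ℂ), z = w + k * τ + l ∧ 0 ≤ w.im ∧ w.im < τ.im ∧ 0 ≤ w.re ∧ w.re < 1 := by
  obtain ⟨k, hk1, hk2⟩ : ∃ k : ℤ, (k : ℝ) * τ.im ≤ z.im ∧ z.im < (k + 1) * τ.im :=
    ⟨⌊z.im / τ.im⌋, (le_div_iff₀ hτ).mp (Int.floor_le _),
      (div_lt_iff₀ hτ).mp (Int.lt_floor_add_one _)⟩
  obtain ⟨l, hl1, hl2⟩ : ∃ l : ℤ, (l : ℝ) ≤ (z - k * τ).re ∧ (z - k * τ).re < l + 1 :=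
    ⟨_, Int.floor_le _, Int.lt_floor_add_one _⟩
  refine ⟨k, l, z - k * τ - l, by ring, ?_, ?_, ?_, ?_⟩
  · simp; linarith
  · simp; linarith
  · rw [sub_re, intCast_re]; linarith
  · rw [sub_re, intCast_re]; linarith

/-- Points close to but different from a given one are not lattice points. -/
lemma eventually_not_mem_lattice {τ : ℂ} (hτ : 0 < τ.im) (p : ℂ) :
    ∀ᶠ z in 𝓝[≠] p, z ∉ lattice τ := by
  have hQ := lattice_translation_invariant (τ := τ) (Q := fun p => ∀ᶠ z in 𝓝[≠] p, z ∉ lattice τ)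
  have aux : ∀ w : ℂ, (∀ z, z + w ∈ lattice τ ↔ z ∈ lattice τ) → ∀ p : ℂ,
      (∀ᶠ z in 𝓝[≠] p, z ∉ lattice τ) ↔ (∀ᶠ z in 𝓝[≠] (p + w), z ∉ lattice τ) := by
    intro w hw p
    have : 𝓝[≠] (p + w) = map (· + w) (𝓝[≠] p) := by
      have := (Homeomorph.addRight w).isOpenEmbedding.map_nhdsWithin_eq {p}ᶜ p
      simp only [Homeomorph.coe_addRight] at this
      rw [this]
      congr 1
      ext x
      simp
    rw [this, eventually_map]
    simp [hw]
  obtain ⟨k, l, w, rfl, h0, h1, h2, h3⟩ := exists_strip_representative hτ p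
  rw [← hQ (aux 1 fun z => add_one_mem_lattice) (aux τ fun z => add_tau_mem_lattice)]
  -- near `w`, a lattice point `nτ + m` has `n ∈ {0, 1}` and `m` bounded
  have hfin : (lattice τ ∩ Metric.ball w 1).Finite := by
    obtain ⟨N, hN⟩ := exists_nat_gt ((|w.im| + 1) / τ.im)
    obtain ⟨M, hM⟩ := exists_nat_gt (|w.re| + 1 + N * |τ.re|)
    refine Set.Finite.subset (((Set.finite_Icc (-N : ℤ) N).prod (Set.finite_Icc (-M : ℤ) M)).image
      fun x : ℤ × ℤ => (x.1 : ℂ) * τ + x.2) ?_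
    rintro z ⟨⟨n, m, rfl⟩, hz⟩
    rw [Metric.mem_ball, dist_eq] at hz
    have him := (abs_im_le_norm _).trans hz.le
    have hre := (abs_re_le_norm _).trans hz.le
    simp only [sub_im, add_im, mul_im, intCast_re, intCast_im, zero_mul, add_zero, sub_re, add_re,
      mul_re, sub_zero] at him hre
    have hn : |(n : ℝ)| ≤ N := by
      have : |(n : ℝ)| * τ.im ≤ |w.im| + 1 := by
        have := abs_sub_abs_le_abs_sub ((n : ℝ) * τ.im) w.im
        rw [abs_mul, abs_of_pos hτ] at this
        linarith
      rw [← le_div_iff₀ hτ] at this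
      linarith
    have hm : |(m : ℝ)| ≤ M := by
      have h5 := abs_add_le ((n : ℝ) * τ.re + m - w.re) (w.re - n * τ.re)
      have h6 := abs_sub w.re (n * τ.re)
      rw [abs_mul] at h6
      have h7 : |(n : ℝ)| * |τ.re| ≤ N * |τ.re| := by gcongr
      rw [show (n : ℝ) * τ.re + m - w.re + (w.re - n * τ.re) = m by ring] at h5
      linarith
    refine ⟨(n, m), ⟨?_, ?_⟩, rfl⟩
    · rw [abs_le] at hn
      exact ⟨by exact_mod_cast hn.1, by exact_mod_cast hn.2⟩
    · rw [abs_le] at hm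
      exact ⟨by exact_mod_cast hm.1, by exact_mod_cast hm.2⟩
  have h4 := (hfin.subset (Set.sdiff_subset (t := {w}))).isClosed.compl_mem_nhds
    (x := w) (by simp)
  filter_upwards [mem_nhdsWithin_of_mem_nhds h4, self_mem_nhdsWithin,
    mem_nhdsWithin_of_mem_nhds (Metric.ball_mem_nhds w one_pos)] with z hz1 hz2 hz3 hz4
  exact hz1 ⟨⟨hz4, hz3⟩, hz2⟩

lemma eventually_nhds_not_mem_lattice {τ : ℂ} (hτ : 0 < τ.im) {p : ℂ} (hp : p ∉ lattice τ) :
    ∀ᶠ z in 𝓝 p, z ∉ lattice τ := by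
  have := eventually_not_mem_lattice hτ p
  rw [eventually_nhdsWithin_iff] at this
  filter_upwards [this] with z hz
  by_cases h : z = p
  · rwa [h]
  · exact hz h

/-! ### The theta function -/

/-- Expanding `(n + 1/2)²` moves the half-integer shift into the argument and a prefactor.
Quasi-periodicity, differentiability and inversion are then inherited from `jacobiTheta₂`. -/
lemma theta_eq_jacobiTheta₂ (z τ : ℂ) :
    theta z τ = exp (π * I * τ / 4 + π * I * (z + 1 / 2)) * jacobiTheta₂ (z + 1 / 2 + τ / 2) τ := by
  rw [theta, jacobiTheta₂, ← tsum_mul_left]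
  refine tsum_congr fun n => ?_
  rw [jacobiTheta₂_term, ← exp_add]
  ring_nf

lemma theta_eq_I_mul_tsum (z τ : ℂ) :
    theta z τ = I * ∑' n : ℤ, (-1 : ℂ) ^ n *
      exp (π * I * ((n : ℂ) + 1 / 2) ^ 2 * τ + 2 * π * I * ((n : ℂ) + 1 / 2) * z) := by
  rw [theta, ← tsum_mul_left]
  refine tsum_congr fun n => ?_
  rw [neg_one_zpow_eq_exp]
  conv_rhs => arg 1; rw [← exp_pi_I_div_two]
  rw [← exp_add, ← exp_add]
  ring_nf

lemma theta_add_one (z τ : ℂ) : theta (z + 1) τ = -theta z τ := by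
  rw [theta_eq_jacobiTheta₂, theta_eq_jacobiTheta₂,
    show z + 1 + 1 / 2 + τ / 2 = z + 1 / 2 + τ / 2 + 1 by ring, jacobiTheta₂_add_left, ← neg_mul]
  congr 1
  exact exp_eq_neg_exp_of_sub 0 (by push_cast; ring)

lemma theta_add_tau (z τ : ℂ) :
    theta (z + τ) τ = -exp (-π * I * τ - 2 * π * I * z) * theta z τ := by
  rw [theta_eq_jacobiTheta₂, theta_eq_jacobiTheta₂,
    show z + τ + 1 / 2 + τ / 2 = z + 1 / 2 + τ / 2 + τ by ring, jacobiTheta₂_add_left',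
    ← mul_assoc, ← mul_assoc, ← exp_add, neg_mul (exp _), ← exp_add]
  congr 1
  exact exp_eq_neg_exp_of_sub (-1) (by push_cast; ring)

lemma theta_neg (z τ : ℂ) : theta (-z) τ = -theta z τ := by
  rw [theta, theta, ← (Equiv.subLeft (-1 : ℤ)).tsum_eq, ← tsum_neg]
  refine tsum_congr fun n => ?_
  -- The substitution `n ↦ -1 - n` is `ν ↦ -ν`; the sign is `e^{2πiν} = -1` for half-integral `ν`.
  rw [Equiv.subLeft_apply]
  refine exp_eq_neg_exp_of_sub (-n - 1) ?_
  push_cast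
  ring

lemma theta_zero (τ : ℂ) : theta 0 τ = 0 := by
  have := theta_neg 0 τ
  rw [neg_zero] at this
  linear_combination this / 2

lemma differentiable_theta {τ : ℂ} (hτ : 0 < τ.im) : Differentiable ℂ fun z => theta z τ := by
  simp_rw [theta_eq_jacobiTheta₂]
  intro z
  refine DifferentiableAt.mul (by fun_prop) ?_
  exact (differentiableAt_jacobiTheta₂_fst (z + 1 / 2 + τ / 2) hτ).comp z
    (f := fun z => z + 1 / 2 + τ / 2) (by fun_prop)

lemma theta_tau_add_one (z τ : ℂ) : theta z (τ + 1) = exp (π * I / 4) * theta z τ := by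
  rw [theta, theta, ← tsum_mul_left]
  refine tsum_congr fun n => ?_
  rw [← exp_add]
  obtain ⟨k, hk⟩ := Int.even_mul_succ_self n
  have hk' : (n : ℂ) * (n + 1) = k + k := by exact_mod_cast hk
  refine exp_eq_exp_of_sub k ?_
  linear_combination π * I * hk'

lemma theta_neg_one_div (z : ℂ) {τ : ℂ} (hτ : 0 < τ.im) :
    theta (z / τ) (-1 / τ) =
      -I * (-I * τ) ^ (1 / 2 : ℂ) * exp (π * I * z ^ 2 / τ) * theta z τ := by
  have h0 := ne_zero_of_im_pos hτ
  have hs : (-I * τ) ^ (1 / 2 : ℂ) ≠ 0 := by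
    rw [Ne, cpow_eq_zero_iff]; simp [h0]
  -- Divided by `τ`, this argument becomes the shifted argument of `θ(z/τ; -1/τ)`; before division
  -- it differs from that of `θ(z; τ)` by the period `1`.
  have hf := jacobiTheta₂_functional_equation (z + τ / 2 - 1 / 2) τ
  rw [show (z + τ / 2 - 1 / 2) / τ = z / τ + 1 / 2 + -1 / τ / 2 by field_simp; ring,
    ← jacobiTheta₂_add_left, show z + τ / 2 - 1 / 2 + 1 = z + 1 / 2 + τ / 2 by ring] at hf
  rw [theta_eq_jacobiTheta₂, theta_eq_jacobiTheta₂, hf]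
  have hI : (-I : ℂ) = exp (-(π * I * (1 / 2))) := by rw [exp_neg, exp_pi_I_div_two, inv_I]
  generalize jacobiTheta₂ (z / τ + 1 / 2 + -1 / τ / 2) (-1 / τ) = J
  generalize (-I * τ) ^ (1 / 2 : ℂ) = s at hs ⊢
  have he : exp (π * I * (-1 / τ) / 4 + π * I * (z / τ + 1 / 2)) =
      exp (-(π * I * (1 / 2))) * exp (π * I * z ^ 2 / τ) *
        exp (π * I * τ / 4 + π * I * (z + 1 / 2)) *
          exp (-π * I * (z + τ / 2 - 1 / 2) ^ 2 / τ) := by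
    rw [← exp_add, ← exp_add, ← exp_add]
    congr 1
    field_simp
    ring
  rw [he, ← hI]
  field_simp

/-- The theta function is not identically zero: its zeroth Fourier coefficient is `1`. -/
lemma exists_theta_ne_zero {τ : ℂ} (hτ : 0 < τ.im) : ∃ z, theta z τ ≠ 0 := by
  by_contra! h
  have hJ : ∀ z, jacobiTheta₂ z τ = 0 := fun z => by
    have := h (z - 1 / 2 - τ / 2)
    rw [theta_eq_jacobiTheta₂, show z - 1 / 2 - τ / 2 + 1 / 2 + τ / 2 = z by ring] at this
    exact (mul_eq_zero.mp this).resolve_left (exp_ne_zero _)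
  have hsum := summable_pow_mul_jacobiTheta₂_term_bound 0 hτ 0
  have hc : ∀ n : ℤ, Continuous fun x : ℝ => jacobiTheta₂_term n x τ := fun n => by
    unfold jacobiTheta₂_term; fun_prop
  have hint : ∀ n : ℤ, ∫ x in (0 : ℝ)..1, jacobiTheta₂_term n x τ = if n = 0 then 1 else 0 := by
    intro n
    split_ifs with hn
    · simp [hn, jacobiTheta₂_term]
    · have h1 : ∀ x : ℝ, jacobiTheta₂_term n x τ =
          exp (π * I * n ^ 2 * τ) * exp (2 * π * I * n * x) := fun x => by
        rw [jacobiTheta₂_term, ← exp_add]; ring_nf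
      simp_rw [h1]
      rw [intervalIntegral.integral_const_mul, integral_exp_mul_complex
        (by simp [hn, Real.pi_ne_zero])]
      have := exp_add_two_pi_I_mul_int 0 n
      simp only [zero_add, exp_zero] at this
      simp [this]
  have h2 := intervalIntegral.hasSum_integral_of_dominated_convergence
    (μ := MeasureTheory.volume) (a := 0) (b := 1)
    (F := fun (n : ℤ) (x : ℝ) => jacobiTheta₂_term n x τ) (f := fun x : ℝ => jacobiTheta₂ x τ)
    (fun (n : ℤ) (_ : ℝ) => Real.exp (-π * (τ.im * n ^ 2 - 2 * 0 * |n|)))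
    (fun n => (hc n).aestronglyMeasurable)
    (fun n => .of_forall fun x _ => norm_jacobiTheta₂_term_le hτ (by simp) le_rfl n)
    (.of_forall fun x _ => by simpa using hsum)
    (by simp)
    (.of_forall fun x _ => hasSum_jacobiTheta₂_term x hτ)
  simp_rw [hint, hJ] at h2
  simpa using h2.unique (hasSum_ite_eq 0 (1 : ℂ))

/-! ### Entire functions with multipliers for a lattice -/

lemma norm_bounded_of_periodic {τ : ℂ} (hτ : 0 < τ.im) {f : ℂ → ℂ} (hf : Continuous f)
    (h1 : ∀ z, ‖f (z + 1)‖ = ‖f z‖) (ht : ∀ z, ‖f (z + τ)‖ = ‖f z‖) : ∃ C, ∀ z, ‖f z‖ ≤ C := by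
  obtain ⟨C, hC⟩ := (isCompact_closedBall (0 : ℂ) (1 + τ.im)).exists_bound_of_continuousOn
    hf.continuousOn
  refine ⟨C, fun z => ?_⟩
  obtain ⟨k, l, w, rfl, h0, h1', h2, h3⟩ := exists_strip_representative hτ z
  have := lattice_translation_invariant (τ := τ) (Q := fun z => ‖f z‖ ≤ C)
    (fun p => by rw [h1]) (fun p => by rw [ht]) k l w
  refine this.mp (hC w ?_)
  rw [mem_closedBall_zero_iff]
  refine (norm_le_abs_re_add_abs_im w).trans ?_
  rw [abs_of_nonneg h0, abs_of_nonneg h2]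
  linarith

/-- An entire function with constant multipliers for a lattice is an exponential. -/
lemma eq_const_mul_exp_of_multipliers {τ : ℂ} (hτ : 0 < τ.im) {f : ℂ → ℂ}
    (hf : Differentiable ℂ f) {ε lam : ℂ} (hε : ε ≠ 0) (hl : lam ≠ 0)
    (h1 : ∀ z, f (z + 1) = ε * f z) (ht : ∀ z, f (z + τ) = lam * f z) :
    ∃ C β : ℂ, ∀ z, f z = C * exp (β * z) := by
  -- Both multipliers of `e^{-αz} f(z)` should have modulus one. The real part of `α` settles the
  -- translation by `1`, and the free imaginary part `t` settles the one by `τ`.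
  set t : ℝ := ((log ε * τ).re - Real.log ‖lam‖) / τ.im with ht_def
  set α : ℂ := log ε + t * I with hα
  have hn1 : ‖exp (-α)‖ * ‖ε‖ = 1 := by
    have : (-α).re = - Real.log ‖ε‖ := by simp [hα, log_re]
    rw [norm_exp, this, Real.exp_neg, Real.exp_log (norm_pos_iff.mpr hε),
      inv_mul_cancel₀ (norm_ne_zero_iff.mpr hε)]
  have hnt : ‖exp (-α * τ)‖ * ‖lam‖ = 1 := by
    have : (-α * τ).re = - Real.log ‖lam‖ := by
      have h3 : t * τ.im = (log ε * τ).re - Real.log ‖lam‖ := div_mul_cancel₀ _ hτ.ne'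
      have h4 : (-α * τ).re = -(log ε * τ).re + t * τ.im := by simp [hα]; ring
      rw [h4, h3]; ring
    rw [norm_exp, this, Real.exp_neg, Real.exp_log (norm_pos_iff.mpr hl),
      inv_mul_cancel₀ (norm_ne_zero_iff.mpr hl)]
  have hK : Differentiable ℂ fun z => exp (-α * z) * f z := by fun_prop
  obtain ⟨B, hB⟩ := norm_bounded_of_periodic hτ hK.continuous
    (fun z => by
      rw [h1, mul_add, exp_add, norm_mul, norm_mul, norm_mul, norm_mul, mul_one]
      linear_combination ‖exp (-α * z)‖ * ‖f z‖ * hn1)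
    (fun z => by
      rw [ht, mul_add, exp_add, norm_mul, norm_mul, norm_mul, norm_mul]
      linear_combination ‖exp (-α * z)‖ * ‖f z‖ * hnt)
  have hconst := fun z => hK.apply_eq_apply_of_bounded
    (isBounded_iff_forall_norm_le.mpr ⟨B, by rintro _ ⟨z, rfl⟩; exact hB z⟩) z 0
  refine ⟨f 0, α, fun z => ?_⟩
  have := hconst z
  simp only [mul_zero, exp_zero, one_mul] at this
  rw [← this, neg_mul, exp_neg]
  field_simp

/-- A function with at most removable singularities at `p`. -/
def RemovableAt (k : ℂ → ℂ) (p : ℂ) : Prop := ∃ g : ℂ → ℂ, AnalyticAt ℂ g p ∧ k =ᶠ[𝓝[≠] p] g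

lemma RemovableAt.of_analyticAt {k : ℂ → ℂ} {p : ℂ} (h : AnalyticAt ℂ k p) : RemovableAt k p :=
  ⟨k, h, EventuallyEq.rfl⟩

lemma RemovableAt.mul {k l : ℂ → ℂ} {p : ℂ} (hk : RemovableAt k p) (hl : RemovableAt l p) :
    RemovableAt (fun z => k z * l z) p := by
  obtain ⟨g, hg, hkg⟩ := hk
  obtain ⟨g', hg', hkg'⟩ := hl
  exact ⟨fun z => g z * g' z, hg.fun_mul hg', hkg.mul hkg'⟩

lemma nhdsNE_add_right (p w : ℂ) : 𝓝[≠] (p + w) = map (· + w) (𝓝[≠] p) := by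
  have := (Homeomorph.addRight w).isOpenEmbedding.map_nhdsWithin_eq {p}ᶜ p
  simp only [Homeomorph.coe_addRight] at this
  rw [this]
  congr 1
  ext x
  simp

lemma removableAt_add_iff {k : ℂ → ℂ} {p w c : ℂ} (hc : c ≠ 0)
    (h : ∀ᶠ z in 𝓝[≠] p, k (z + w) = c * k z) : RemovableAt k p ↔ RemovableAt k (p + w) := by
  constructor
  · rintro ⟨g, hg, hk⟩
    refine ⟨fun z => c * g (z - w), ?_, ?_⟩
    · refine analyticAt_const.mul (AnalyticAt.fun_comp (g := g) ?_ (by fun_prop))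
      simpa using hg
    · rw [EventuallyEq, nhdsNE_add_right, eventually_map]
      filter_upwards [h, hk] with z h1 h2
      rw [h1, h2]; simp
  · rintro ⟨g, hg, hk⟩
    refine ⟨fun z => c⁻¹ * g (z + w), ?_, ?_⟩
    · exact analyticAt_const.mul (AnalyticAt.fun_comp (g := g) hg (by fun_prop))
    · rw [EventuallyEq, nhdsNE_add_right, eventually_map] at hk
      filter_upwards [h, hk] with z h1 h2
      rw [← h2, h1, inv_mul_cancel_left₀ hc]

/-- With `g p` the local extension at `p`, the entire function is `z ↦ g z z`. Uniqueness of limits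
along punctured neighbourhoods identifies it with `g p` near `p`. -/
lemma exists_entire_of_removableAt {k : ℂ → ℂ} (h : ∀ p, RemovableAt k p) :
    ∃ K : ℂ → ℂ, Differentiable ℂ K ∧ ∀ p, k =ᶠ[𝓝[≠] p] K := by
  choose g hg hkg using h
  have hloc : ∀ p, ∀ᶠ z in 𝓝 p, g z z = g p z := by
    intro p
    have h1 := (hkg p)
    rw [EventuallyEq, eventually_nhdsWithin_iff] at h1
    filter_upwards [h1.eventually_nhds, (hg p).eventually_analyticAt] with z hz hz'
    have h3 : k =ᶠ[𝓝[≠] z] g p := by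
      by_cases hzp : z = p
      · rw [hzp]; exact hkg p
      · filter_upwards [mem_nhdsWithin_of_mem_nhds hz,
          mem_nhdsWithin_of_mem_nhds (isOpen_ne.mem_nhds hzp)] with w hw hw'
        exact hw hw'
    exact tendsto_nhds_unique_of_eventuallyEq
      ((hg z).continuousAt.tendsto.mono_left nhdsWithin_le_nhds)
      (hz'.continuousAt.tendsto.mono_left nhdsWithin_le_nhds) ((hkg z).symm.trans h3)
  refine ⟨fun z => g z z, fun p => ?_, fun p => ?_⟩
  · exact ((hg p).differentiableAt).congr_of_eventuallyEq (hloc p)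
  · filter_upwards [hkg p, mem_nhdsWithin_of_mem_nhds (hloc p)] with z h1 h2
    rw [h1, h2]

lemma eq_of_continuousAt_of_eventuallyEq {f g : ℂ → ℂ} {p : ℂ} (hf : ContinuousAt f p)
    (hg : ContinuousAt g p) (h : f =ᶠ[𝓝[≠] p] g) : f p = g p :=
  tendsto_nhds_unique_of_eventuallyEq (hf.tendsto.mono_left nhdsWithin_le_nhds)
    (hg.tendsto.mono_left nhdsWithin_le_nhds) h

/-- Quotients take arbitrary values where a denominator vanishes, so equations are required only on
punctured neighbourhoods; they pass to the entire extension by continuity. -/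
lemma eventuallyEq_const_mul_exp_of_multipliers {τ : ℂ} (hτ : 0 < τ.im) {k : ℂ → ℂ}
    (hk : ∀ p, RemovableAt k p) {ε lam : ℂ} (hε : ε ≠ 0) (hl : lam ≠ 0)
    (h1 : ∀ p, ∀ᶠ z in 𝓝[≠] p, k (z + 1) = ε * k z)
    (ht : ∀ p, ∀ᶠ z in 𝓝[≠] p, k (z + τ) = lam * k z) :
    ∃ C β : ℂ, ∀ p, ∀ᶠ z in 𝓝[≠] p, k z = C * exp (β * z) := by
  obtain ⟨K, hK, hkK⟩ := exists_entire_of_removableAt hk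
  have aux : ∀ w c : ℂ, (∀ p, ∀ᶠ z in 𝓝[≠] p, k (z + w) = c * k z) →
      ∀ z, K (z + w) = c * K z := by
    intro w c h z
    have hd : Continuous K := hK.continuous
    refine eq_of_continuousAt_of_eventuallyEq (f := fun z => K (z + w)) (g := fun z => c * K z)
      (by fun_prop) (by fun_prop) ?_
    have h2 := hkK (z + w)
    rw [EventuallyEq, nhdsNE_add_right, eventually_map] at h2
    filter_upwards [h z, h2, hkK z] with x hx hx2 hx3
    rw [← hx2, hx, hx3]
  obtain ⟨C, β, h⟩ := eq_const_mul_exp_of_multipliers hτ hK hε hl (aux 1 ε h1) (aux τ lam ht)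
  exact ⟨C, β, fun p => (hkK p).trans (.of_forall fun z => h z)⟩

/-- The multipliers of an exponential. -/
lemma const_eq_zero_or_multiplier {τ C β lam : ℂ} {k : ℂ → ℂ}
    (hk : ∀ p, ∀ᶠ z in 𝓝[≠] p, k z = C * exp (β * z))
    (h1 : ∀ p, ∀ᶠ z in 𝓝[≠] p, k (z + 1) = k z)
    (ht : ∀ p, ∀ᶠ z in 𝓝[≠] p, k (z + τ) = lam * k z) :
    C = 0 ∨ ∃ m : ℤ, β = 2 * π * I * m ∧ lam = exp (2 * π * I * m * τ) := by
  have aux : ∀ w c : ℂ, (∀ p, ∀ᶠ z in 𝓝[≠] p, k (z + w) = c * k z) →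
      C * exp (β * w) = C * c := by
    intro w c h
    have h2 := hk (0 + w)
    rw [nhdsNE_add_right, eventually_map] at h2
    obtain ⟨z, hz1, hz2, hz3⟩ := ((hk 0).and (h2.and (h 0))).exists
    rw [hz1, hz2, mul_add, exp_add] at hz3
    apply mul_right_cancel₀ (exp_ne_zero (β * z))
    linear_combination hz3
  by_cases hC : C = 0
  · exact Or.inl hC
  right
  have e1 := mul_left_cancel₀ hC (aux 1 1 (by simpa using h1))
  have et := mul_left_cancel₀ hC (aux τ lam ht)
  rw [mul_one] at e1
  obtain ⟨m, hm⟩ := exp_eq_one_iff.mp e1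
  refine ⟨m, by rw [hm]; ring, ?_⟩
  rw [← et, hm]
  ring_nf

/-- A doubly periodic function with at most removable singularities is constant. -/
lemma eventuallyEq_const_of_periodic {τ : ℂ} (hτ : 0 < τ.im) {k : ℂ → ℂ}
    (hk : ∀ p, RemovableAt k p) (h1 : ∀ p, ∀ᶠ z in 𝓝[≠] p, k (z + 1) = k z)
    (ht : ∀ p, ∀ᶠ z in 𝓝[≠] p, k (z + τ) = k z) :
    ∃ C : ℂ, ∀ p, ∀ᶠ z in 𝓝[≠] p, k z = C := by
  obtain ⟨C, β, hC⟩ := eventuallyEq_const_mul_exp_of_multipliers hτ hk one_ne_zero one_ne_zero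
    (by simpa using h1) (by simpa using ht)
  refine ⟨C, fun p => (hC p).mono fun z hz => ?_⟩
  rw [hz]
  rcases const_eq_zero_or_multiplier hC h1 (lam := 1) (by simpa using ht) with h | ⟨m, hm, hm'⟩
  · simp [h]
  -- Here `mτ` is an integer, so `Im τ > 0` forces `m = 0` and the exponential is trivial.
  · obtain ⟨j, hj⟩ := exp_eq_one_iff.mp hm'.symm
    have : (m : ℂ) * τ = j := by
      apply mul_left_cancel₀ two_pi_I_ne_zero
      linear_combination hj
    have him := congrArg im this
    simp [hτ.ne'] at him
    simp [hm, him]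

/-! ### The zeros of the theta function -/

/-- The product `∏_{n ≥ 0} (1 - e^{2πi(nτ + z)})`. -/
def thetaFactor (z τ : ℂ) : ℂ := ∏' n : ℕ, (1 - exp (2 * π * I * n * τ + 2 * π * I * z))

lemma norm_exp_two_pi_mul (n : ℕ) (z τ : ℂ) :
    ‖exp (2 * π * I * n * τ + 2 * π * I * z)‖ =
      Real.exp (-2 * π * z.im) * Real.exp (-2 * π * τ.im) ^ n := by
  rw [norm_exp, ← Real.exp_nat_mul, ← Real.exp_add]
  congr 1
  simp
  ring

lemma exp_neg_two_pi_im_lt_one {τ : ℂ} (hτ : 0 < τ.im) : Real.exp (-2 * π * τ.im) < 1 := by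
  rw [Real.exp_lt_one_iff]
  have := mul_pos Real.pi_pos hτ
  linarith

lemma summable_thetaFactor {τ : ℂ} (hτ : 0 < τ.im) (z : ℂ) :
    Summable fun n : ℕ => ‖-exp (2 * π * I * n * τ + 2 * π * I * z)‖ := by
  simp_rw [norm_neg, norm_exp_two_pi_mul]
  exact (summable_geometric_of_lt_one (Real.exp_pos _).le (exp_neg_two_pi_im_lt_one hτ)).mul_left _

lemma differentiable_thetaFactor {τ : ℂ} (hτ : 0 < τ.im) :
    Differentiable ℂ fun z => thetaFactor z τ := by
  intro z₀
  set U : Set ℂ := {z | z₀.im - 1 < z.im}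
  have hU : IsOpen U := isOpen_lt continuous_const continuous_im
  have hs := ((summable_geometric_of_lt_one (Real.exp_pos _).le
    (exp_neg_two_pi_im_lt_one hτ)).mul_left (Real.exp (-2 * π * (z₀.im - 1))))
  have hp := hs.hasProdLocallyUniformlyOn_nat_one_add (K := U)
    (f := fun (n : ℕ) z => -exp (2 * π * I * n * τ + 2 * π * I * z)) hU
    (.of_forall fun n z hz => by
      rw [norm_neg, norm_exp_two_pi_mul]
      gcongr ?_ * _
      rw [Real.exp_le_exp]
      have : z₀.im - 1 < z.im := hz
      nlinarith [Real.pi_pos])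
    (fun n => by fun_prop)
  have hd := hp.differentiableOn (.of_forall fun s => by
    simpa [Finset.prod_fn] using DifferentiableOn.finsetProd (fun _ _ => by fun_prop)) hU
  have := hd.differentiableAt (hU.mem_nhds (show z₀ ∈ U by simp [U]))
  simpa only [← sub_eq_add_neg] using! this

lemma thetaFactor_ne_zero {τ : ℂ} (hτ : 0 < τ.im) {z : ℂ}
    (hz : ∀ n : ℕ, exp (2 * π * I * n * τ + 2 * π * I * z) ≠ 1) : thetaFactor z τ ≠ 0 := by
  have := tprod_one_add_ne_zero_of_summable
    (f := fun n : ℕ => -exp (2 * π * I * n * τ + 2 * π * I * z))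
    (fun n => by rw [← sub_eq_add_neg, sub_ne_zero]; exact (hz n).symm)
    (by simpa using summable_thetaFactor hτ z)
  simpa only [← sub_eq_add_neg] using! this

lemma thetaFactor_eq_mul {τ : ℂ} (hτ : 0 < τ.im) (z : ℂ) :
    thetaFactor z τ = (1 - exp (2 * π * I * z)) * thetaFactor (z + τ) τ := by
  have hm := fun w => multipliable_one_add_of_summable (summable_thetaFactor hτ w)
  simp only [← sub_eq_add_neg] at hm
  rw [thetaFactor, tprod_eq_zero_mul' ?_]
  · congr 1
    · simp
    · refine tprod_congr fun n => ?_
      push_cast; ring_nf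
  · refine (hm (z + τ)).congr fun n => ?_
    push_cast; ring_nf

/-- The product with the zeros and the multipliers of the theta function. -/
def thetaProd (z τ : ℂ) : ℂ := thetaFactor z τ * thetaFactor (τ - z) τ * exp (-π * I * z)

lemma differentiable_thetaProd {τ : ℂ} (hτ : 0 < τ.im) :
    Differentiable ℂ fun z => thetaProd z τ := by
  have h := differentiable_thetaFactor hτ
  have h2 : Differentiable ℂ fun z => thetaFactor (τ - z) τ :=
    h.comp (f := fun z => τ - z) (by fun_prop)
  unfold thetaProd
  fun_prop

lemma thetaProd_ne_zero {τ : ℂ} (hτ : 0 < τ.im) {z : ℂ} (hz : z ∉ lattice τ) :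
    thetaProd z τ ≠ 0 := by
  refine mul_ne_zero (mul_ne_zero (thetaFactor_ne_zero hτ fun n h => hz ?_)
    (thetaFactor_ne_zero hτ fun n h => hz ?_)) (exp_ne_zero _)
  · exact mem_lattice_of_exp_eq_one n (by exact_mod_cast h)
  · have := mem_lattice_of_exp_eq_one n (by exact_mod_cast h)
    rwa [show τ - z = -z + τ by ring, add_tau_mem_lattice, neg_mem_lattice] at this

lemma thetaProd_add_one (z τ : ℂ) : thetaProd (z + 1) τ = -thetaProd z τ := by
  have h : ∀ w, thetaFactor (w + 1) τ = thetaFactor w τ := fun w => tprod_congr fun n => by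
    congr 1
    exact exp_eq_exp_of_sub 1 (by push_cast; ring)
  have h2 := h (τ - (z + 1))
  rw [show τ - (z + 1) + 1 = τ - z by ring] at h2
  have h3 : exp (-π * I * (z + 1)) = -exp (-π * I * z) :=
    exp_eq_neg_exp_of_sub (-1) (by push_cast; ring)
  rw [thetaProd, thetaProd, h, ← h2, h3]
  ring

/-- The translation removes the factor `1 - e^{2πiz}` from one product and adds `1 - e^{-2πiz}` to
the other; their quotient is `-e^{-2πiz}`. -/
lemma thetaProd_add_tau {τ : ℂ} (hτ : 0 < τ.im) (z : ℂ) :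
    thetaProd (z + τ) τ = -exp (-π * I * τ - 2 * π * I * z) * thetaProd z τ := by
  have hd := differentiable_thetaProd hτ
  refine eq_of_continuousAt_of_eventuallyEq (f := fun z => thetaProd (z + τ) τ)
    (g := fun z => -exp (-π * I * τ - 2 * π * I * z) * thetaProd z τ) ?_ ?_ ?_
  · exact (hd.continuous.comp (continuous_add_const τ)).continuousAt
  · have := hd.continuous
    fun_prop
  filter_upwards [eventually_not_mem_lattice hτ z] with z hz
  have hne : (1 - exp (2 * π * I * z)) ≠ 0 := by
    intro h
    exact hz (mem_lattice_of_exp_eq_one (τ := τ) 0 (by simpa using (sub_eq_zero.mp h).symm))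
  have h1 := thetaFactor_eq_mul hτ z
  have h2 := thetaFactor_eq_mul hτ (-z)
  rw [thetaProd, thetaProd, show τ - (z + τ) = -z by ring, h2, h1,
    show -z + τ = τ - z by ring, show -π * I * (z + τ) = -π * I * z + -π * I * τ by ring,
    show -π * I * τ - 2 * π * I * z = -π * I * τ + 2 * π * I * (-z) by ring, exp_add, exp_add]
  have h3 : exp (2 * π * I * z) * exp (2 * π * I * (-z)) = 1 := by
    rw [← exp_add]; simp
  linear_combination -thetaFactor (z + τ) τ * thetaFactor (τ - z) τ * exp (-π * I * z) *
    exp (-π * I * τ) * h3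

/-- The analytic function `(e^{2πiz} - 1) / z`. -/
lemma exists_one_sub_exp_eq : ∃ φ : ℂ → ℂ, Differentiable ℂ φ ∧ φ 0 = -(2 * π * I) ∧
    ∀ z, 1 - exp (2 * π * I * z) = z * φ z := by
  have hd : Differentiable ℂ fun z => 1 - exp (2 * π * I * z) := by fun_prop
  refine ⟨dslope (fun z => 1 - exp (2 * π * I * z)) 0, ?_, ?_, fun z => ?_⟩
  · have := (differentiableOn_dslope (c := 0) (s := Set.univ)
      (f := fun z : ℂ => 1 - exp (2 * π * I * z)) univ_mem).mpr hd.differentiableOn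
    rwa [differentiableOn_univ] at this
  · rw [dslope_same]
    have : HasDerivAt (fun z : ℂ => 1 - exp (2 * π * I * z))
        (-(exp (2 * π * I * 0) * (2 * π * I * 1))) 0 :=
      (((hasDerivAt_id (0 : ℂ)).const_mul (2 * π * I)).cexp).const_sub 1
    rw [this.deriv]; simp
  · have := sub_smul_dslope (fun z : ℂ => 1 - exp (2 * π * I * z)) 0 z
    simpa using this.symm

lemma exists_eq_mul_of_apply_zero {f : ℂ → ℂ} (hf : Differentiable ℂ f) (h0 : f 0 = 0) :
    ∃ φ : ℂ → ℂ, Differentiable ℂ φ ∧ φ 0 = deriv f 0 ∧ ∀ z, f z = z * φ z := by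
  refine ⟨dslope f 0, ?_, dslope_same _ _, fun z => ?_⟩
  · have := (differentiableOn_dslope (c := 0) (s := Set.univ) (f := f) univ_mem).mpr
      hf.differentiableOn
    rwa [differentiableOn_univ] at this
  · have := sub_smul_dslope f 0 z
    simpa [h0] using this.symm

/-- Both functions have the same multipliers, and at the origin the simple zero of the product is
cancelled by the zero of θ, so the quotient is constant by Liouville. The zeros of the product are
visible, which locates those of θ; the value of the constant is never needed. -/
lemma exists_theta_eq_mul_thetaProd {τ : ℂ} (hτ : 0 < τ.im) :
    ∃ C : ℂ, C ≠ 0 ∧ ∀ z, theta z τ = C * thetaProd z τ := by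
  have hth := differentiable_theta hτ
  have hP := differentiable_thetaProd hτ
  have hA := differentiable_thetaFactor hτ
  set k : ℂ → ℂ := fun z => theta z τ / thetaProd z τ with hk
  have h1 : ∀ z, k (z + 1) = 1 * k z := fun z => by
    simp only [hk, theta_add_one, thetaProd_add_one, neg_div_neg_eq, one_mul]
  have ht : ∀ z, k (z + τ) = 1 * k z := fun z => by
    simp only [hk, theta_add_tau, thetaProd_add_tau hτ, one_mul]
    rw [mul_div_mul_left _ _ (neg_ne_zero.mpr (exp_ne_zero _))]
  -- The factor `1 - e^{2πiz}` is split off from the product; what remains does not vanish at `0`.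
  have h0 : RemovableAt k 0 := by
    obtain ⟨φ, hφ, hφ0, hφe⟩ := exists_one_sub_exp_eq
    obtain ⟨ψ, hψ, -, hψe⟩ := exists_eq_mul_of_apply_zero hth (theta_zero τ)
    have hAτ : thetaFactor τ τ ≠ 0 := by
      refine thetaFactor_ne_zero hτ fun n h => ?_
      have := congrArg norm h
      rw [norm_exp_two_pi_mul, norm_one, ← pow_succ'] at this
      exact (pow_lt_one₀ (Real.exp_pos _).le (exp_neg_two_pi_im_lt_one hτ) n.succ_ne_zero).ne this
    refine ⟨fun z => ψ z / (φ z * thetaFactor (z + τ) τ * thetaFactor (τ - z) τ *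
      exp (-π * I * z)), ?_, ?_⟩
    · have h2 : Differentiable ℂ fun z => thetaFactor (τ - z) τ :=
        hA.comp (f := fun z => τ - z) (by fun_prop)
      have h3 : Differentiable ℂ fun z => thetaFactor (z + τ) τ :=
        hA.comp (f := fun z => z + τ) (by fun_prop)
      refine (hψ.analyticAt 0).fun_div (Differentiable.analyticAt (by fun_prop) 0) ?_
      simp [hφ0, hAτ, Real.pi_ne_zero]
    · filter_upwards [self_mem_nhdsWithin] with z hz
      have hz : z ≠ 0 := hz
      simp only [hk, thetaProd]
      rw [hψe, thetaFactor_eq_mul hτ z, hφe, ← mul_div_mul_left (ψ z) _ hz]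
      simp only [mul_assoc]
  have hrem : ∀ p, RemovableAt k p := by
    intro p
    by_cases hp : p ∈ lattice τ
    · obtain ⟨n, m, rfl⟩ := hp
      have := (lattice_translation_invariant (τ := τ) (Q := RemovableAt k)
        (fun p => removableAt_add_iff one_ne_zero (.of_forall h1))
        (fun p => removableAt_add_iff one_ne_zero (.of_forall ht)) n m 0).mp h0
      simpa using this
    · exact .of_analyticAt ((hth.analyticAt p).fun_div (hP.analyticAt p) (thetaProd_ne_zero hτ hp))
  obtain ⟨C, hC⟩ := eventuallyEq_const_of_periodic hτ hrem
    (fun p => .of_forall (by simpa using h1)) (fun p => .of_forall (by simpa using ht))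
  have hall : ∀ z, theta z τ = C * thetaProd z τ := by
    intro z
    refine eq_of_continuousAt_of_eventuallyEq (f := fun z => theta z τ)
      (g := fun z => C * thetaProd z τ) (hth z).continuousAt
      ((hP z).continuousAt.const_mul C) ?_
    filter_upwards [hC z, eventually_not_mem_lattice hτ z] with w hw hw'
    rw [hk, div_eq_iff (thetaProd_ne_zero hτ hw')] at hw
    exact hw
  refine ⟨C, ?_, hall⟩
  rintro rfl
  obtain ⟨z, hz⟩ := exists_theta_ne_zero hτ
  exact hz (by simp [hall z])

lemma theta_ne_zero {τ z : ℂ} (hτ : 0 < τ.im) (hz : z ∉ lattice τ) : theta z τ ≠ 0 := by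
  obtain ⟨C, hC, h⟩ := exists_theta_eq_mul_thetaProd hτ
  rw [h]
  exact mul_ne_zero hC (thetaProd_ne_zero hτ hz)

lemma deriv_theta_zero_ne_zero {τ : ℂ} (hτ : 0 < τ.im) : deriv (fun z => theta z τ) 0 ≠ 0 := by
  obtain ⟨C, hC, h⟩ := exists_theta_eq_mul_thetaProd hτ
  have hA := differentiable_thetaFactor hτ
  have hAτ : thetaFactor τ τ ≠ 0 := by
    refine thetaFactor_ne_zero hτ fun n h => ?_
    have := congrArg norm h
    rw [norm_exp_two_pi_mul, norm_one, ← pow_succ'] at this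
    exact (pow_lt_one₀ (Real.exp_pos _).le (exp_neg_two_pi_im_lt_one hτ) n.succ_ne_zero).ne this
  obtain ⟨φ, hφ, hφ0, hφe⟩ := exists_one_sub_exp_eq
  have h2 : Differentiable ℂ fun z => thetaFactor (τ - z) τ :=
    hA.comp (f := fun z => τ - z) (by fun_prop)
  have h3 : Differentiable ℂ fun z => thetaFactor (z + τ) τ :=
    hA.comp (f := fun z => z + τ) (by fun_prop)
  set ψ : ℂ → ℂ := fun z =>
    C * (φ z * thetaFactor (z + τ) τ * thetaFactor (τ - z) τ * exp (-π * I * z)) with hψ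
  have hψd : Differentiable ℂ ψ := by fun_prop
  have heq : (fun z => theta z τ) = fun z => z * ψ z := by
    funext z
    rw [h, thetaProd, thetaFactor_eq_mul hτ z, hφe, hψ]
    ring
  rw [heq]
  have := ((hasDerivAt_id (0 : ℂ)).mul (hψd 0).hasDerivAt).deriv
  simp only [id, one_mul, zero_mul, add_zero] at this
  change deriv (fun z => z * ψ z) 0 = _ at this
  rw [this]
  simp [hψ, hφ0, hC, hAτ, Real.pi_ne_zero]

/-! ### The Lerch sum -/

/-- The summand of the Lerch sum. -/
def lerchTerm (u v τ : ℂ) (n : ℤ) : ℂ :=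
  (-1 : ℂ) ^ n * exp (π * I * ((n : ℂ) ^ 2 + n) * τ + 2 * π * I * n * v) /
      (1 - exp (2 * π * I * n * τ + 2 * π * I * u))

/-- The Lerch sum `∑ (-1)ⁿ e^{πi(n²+n)τ + 2πinv} / (1 - e^{2πinτ + 2πiu})`. -/
def lerch (u v τ : ℂ) : ℂ := ∑' n : ℤ, lerchTerm u v τ n

lemma mu_eq_lerch (u v τ : ℂ) : mu u v τ = exp (π * I * u) / theta v τ * lerch u v τ := rfl

/-- The Lerch sum without the term of index `0`. -/
def lerchTail (u v τ : ℂ) : ℂ := ∑' n : ℤ, if n = 0 then 0 else lerchTerm u v τ n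

lemma norm_lerch_numerator (v τ : ℂ) (n : ℤ) :
    ‖(-1 : ℂ) ^ n * exp (π * I * ((n : ℂ) ^ 2 + n) * τ + 2 * π * I * n * v)‖ =
      ‖jacobiTheta₂_term n (v + τ / 2) τ‖ := by
  rw [norm_mul, norm_zpow, norm_neg, norm_one, one_zpow, one_mul, jacobiTheta₂_term]
  ring_nf

/-- In this strip `e^{2πi(nτ + u)}` has modulus at most `e^{-2πδ}` for `n ≥ 1` and at least
`e^{2πδ}` for `n ≤ -1`. In the second case `e^x - 1 ≥ 1 - e^{-x}` gives the same bound. -/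
lemma lerch_denominator_bound {u τ : ℂ} {δ : ℝ} (hτ : 0 < τ.im)
    (hu : |u.im| ≤ τ.im - δ) {n : ℤ} (hn : n ≠ 0) :
    1 - Real.exp (-(2 * π * δ)) ≤ ‖1 - exp (2 * π * I * n * τ + 2 * π * I * u)‖ := by
  have hnorm : ‖exp (2 * π * I * n * τ + 2 * π * I * u)‖ =
      Real.exp (-(2 * π * (n * τ.im + u.im))) := by
    rw [norm_exp]
    congr 1
    simp
    ring
  rw [abs_le] at hu
  have hpi := Real.pi_pos
  rcases lt_or_gt_of_ne hn with hn | hn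
  · have h1 : (n : ℝ) ≤ -1 := by exact_mod_cast (by omega : n ≤ -1)
    have h2 : Real.exp (2 * π * δ) ≤ ‖exp (2 * π * I * n * τ + 2 * π * I * u)‖ := by
      rw [hnorm, Real.exp_le_exp]
      have : δ ≤ -(n * τ.im + u.im) := by nlinarith
      nlinarith
    have h3 := norm_sub_norm_le (exp (2 * π * I * n * τ + 2 * π * I * u)) 1
    rw [norm_one, norm_sub_rev] at h3
    linarith [Real.add_one_le_exp (2 * π * δ), Real.add_one_le_exp (-(2 * π * δ))]
  · have h1 : (1 : ℝ) ≤ n := by exact_mod_cast (by omega : 1 ≤ n)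
    have h2 : ‖exp (2 * π * I * n * τ + 2 * π * I * u)‖ ≤ Real.exp (-(2 * π * δ)) := by
      rw [hnorm, Real.exp_le_exp]
      have : δ ≤ n * τ.im + u.im := by nlinarith
      nlinarith
    have h3 := norm_sub_norm_le 1 (exp (2 * π * I * n * τ + 2 * π * I * u))
    rw [norm_one] at h3
    linarith

lemma norm_lerchTail_term_le {u v τ : ℂ} {δ S : ℝ} (hτ : 0 < τ.im) (hδ : 0 < δ)
    (hu : |u.im| ≤ τ.im - δ) (hv : |(v + τ / 2).im| ≤ S) (n : ℤ) :
    ‖if n = 0 then 0 else lerchTerm u v τ n‖ ≤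
      Real.exp (-π * (τ.im * n ^ 2 - 2 * S * |n|)) / (1 - Real.exp (-(2 * π * δ))) := by
  have hc : 0 < 1 - Real.exp (-(2 * π * δ)) := by
    rw [sub_pos, Real.exp_lt_one_iff]
    have := Real.pi_pos
    have := mul_pos this hδ
    linarith
  split_ifs with hn
  · rw [norm_zero]; positivity
  · rw [lerchTerm, norm_div, norm_lerch_numerator]
    exact div_le_div₀ (Real.exp_pos _).le (norm_jacobiTheta₂_term_le hτ hv le_rfl n) hc
      (lerch_denominator_bound hτ hu hn)

lemma summable_lerchTail_bound {τ : ℂ} (hτ : 0 < τ.im) (S c : ℝ) :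
    Summable fun n : ℤ => Real.exp (-π * (τ.im * n ^ 2 - 2 * S * |n|)) / c := by
  simpa using (summable_pow_mul_jacobiTheta₂_term_bound S hτ 0).div_const c

lemma summable_lerchTail {u τ : ℂ} (hτ : 0 < τ.im) (v : ℂ) (hu : |u.im| < τ.im) :
    Summable fun n : ℤ => if n = 0 then 0 else lerchTerm u v τ n := by
  obtain ⟨δ, hδ, hδ'⟩ : ∃ δ, 0 < δ ∧ |u.im| ≤ τ.im - δ :=
    ⟨τ.im - |u.im|, by linarith, by linarith⟩
  exact .of_norm_bounded (summable_lerchTail_bound hτ _ _)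
    (norm_lerchTail_term_le hτ hδ hδ' le_rfl)

lemma lerchTerm_add_tau (u v τ : ℂ) (n : ℤ) :
    lerchTerm (u + τ) (v + τ) τ n = -exp (-2 * π * I * (v + τ)) * lerchTerm u v τ (n + 1) := by
  rw [lerchTerm, lerchTerm, mul_div_assoc', zpow_add_one₀ (by norm_num)]
  congr 1
  · rw [show -exp (-2 * π * I * (v + τ)) * ((-1 : ℂ) ^ n * -1 *
        exp (π * I * (((n + 1 : ℤ) : ℂ) ^ 2 + ((n + 1 : ℤ) : ℂ)) * τ +
          2 * π * I * ((n + 1 : ℤ) : ℂ) * v)) =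
      (-1 : ℂ) ^ n * (exp (-2 * π * I * (v + τ)) *
        exp (π * I * (((n + 1 : ℤ) : ℂ) ^ 2 + ((n + 1 : ℤ) : ℂ)) * τ +
          2 * π * I * ((n + 1 : ℤ) : ℂ) * v)) by ring, ← exp_add]
    congr 2
    push_cast
    ring
  · congr 2
    push_cast
    ring

lemma lerch_add_tau_add_tau (u v τ : ℂ) :
    lerch (u + τ) (v + τ) τ = -exp (-2 * π * I * (v + τ)) * lerch u v τ := by
  rw [lerch, lerch, ← tsum_mul_left, ← (Equiv.addRight (1 : ℤ)).tsum_eq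
    (fun n => -exp (-2 * π * I * (v + τ)) * lerchTerm u v τ n)]
  exact tsum_congr fun n => lerchTerm_add_tau u v τ n

lemma lerch_add_one_left (u v τ : ℂ) : lerch (u + 1) v τ = lerch u v τ := by
  refine tsum_congr fun n => ?_
  rw [lerchTerm, lerchTerm]
  congr 2
  exact exp_eq_exp_of_sub 1 (by push_cast; ring)

lemma lerch_add_one_right (u v τ : ℂ) : lerch u (v + 1) τ = lerch u v τ := by
  refine tsum_congr fun n => ?_
  rw [lerchTerm, lerchTerm]
  congr 2
  exact exp_eq_exp_of_sub n (by ring)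

/-- The terms of the Lerch sum are summable, also where one of the denominators vanishes. -/
lemma summable_lerchTerm {τ : ℂ} (hτ : 0 < τ.im) (u v : ℂ) : Summable (lerchTerm u v τ) := by
  -- Translation by `τ` shifts both arguments, so the transported property must hold for all `v`.
  suffices h : ∀ v, Summable (lerchTerm u v τ) from h v
  obtain ⟨k, l, w, rfl, h0, h1, -, -⟩ := exists_strip_representative hτ u
  refine (lattice_translation_invariant (τ := τ) (Q := fun u => ∀ v, Summable (lerchTerm u v τ))
    (fun p => forall_congr' fun v => ?_) (fun p => ?_) k l w).mp fun v => ?_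
  · refine summable_congr fun n => ?_
    rw [lerchTerm, lerchTerm]
    congr 2
    exact exp_eq_exp_of_sub (-1) (by push_cast; ring)
  · have key : ∀ v, Summable (lerchTerm (p + τ) (v + τ) τ) ↔ Summable (lerchTerm p v τ) := by
      intro v
      rw [funext (lerchTerm_add_tau p v τ), summable_mul_left_iff (neg_ne_zero.mpr (exp_ne_zero _))]
      exact (Equiv.addRight (1 : ℤ)).summable_iff (f := lerchTerm p v τ)
    constructor
    · intro h v
      have := (key (v - τ)).mpr (h _)
      rwa [sub_add_cancel] at this
    · exact fun h v => (key v).mp (h _)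
  · have := summable_lerchTail hτ v (u := w) (by rwa [abs_of_nonneg h0])
    refine (this.add (summable_of_hasFiniteSupport
      (f := fun n : ℤ => if n = 0 then lerchTerm w v τ 0 else 0) ?_)).congr fun n => ?_
    · refine (Set.finite_singleton (0 : ℤ)).subset fun n hn => ?_
      by_contra h
      simp_all
    · by_cases h : n = 0 <;> simp [h]

lemma lerch_eq_add_lerchTail {τ : ℂ} (hτ : 0 < τ.im) (u v : ℂ) :
    lerch u v τ = 1 / (1 - exp (2 * π * I * u)) + lerchTail u v τ := by
  rw [lerch, (summable_lerchTerm hτ u v).tsum_eq_add_tsum_ite 0, lerchTail]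
  simp [lerchTerm]

lemma one_sub_exp_ne_zero {u τ : ℂ} (hu : u ∉ lattice τ) (n : ℤ) :
    1 - exp (2 * π * I * n * τ + 2 * π * I * u) ≠ 0 := fun h =>
  hu (mem_lattice_of_exp_eq_one n (sub_eq_zero.mp h).symm)

/-- Here `u` and `v` are entire functions of a parameter, so that the same statement covers a change
of `u` alone and a simultaneous translation. -/
lemma differentiableAt_lerchTail {τ : ℂ} (hτ : 0 < τ.im) {u v : ℂ → ℂ} (hu : Differentiable ℂ u)
    (hv : Differentiable ℂ v) {z₀ : ℂ} (h : |(u z₀).im| < τ.im) :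
    DifferentiableAt ℂ (fun z => lerchTail (u z) (v z) τ) z₀ := by
  obtain ⟨δ, hδ, hδ'⟩ : ∃ δ, 0 < δ ∧ |(u z₀).im| < τ.im - δ :=
    ⟨(τ.im - |(u z₀).im|) / 2, by linarith, by linarith⟩
  set S := |(v z₀ + τ / 2).im| + 1
  set U : Set ℂ := {z | |(u z).im| < τ.im - δ} ∩ {z | |(v z + τ / 2).im| < S}
  have hU : IsOpen U := by
    have := hu.continuous
    have := hv.continuous
    exact (isOpen_lt (by fun_prop) continuous_const).inter
      (isOpen_lt (by fun_prop) continuous_const)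
  have hd := differentiableOn_tsum_of_summable_norm (U := U)
    (F := fun (n : ℤ) z => if n = 0 then 0 else lerchTerm (u z) (v z) τ n)
    (summable_lerchTail_bound hτ S (1 - Real.exp (-(2 * π * δ)))) (fun n => ?_) hU
    (fun n z hz => norm_lerchTail_term_le hτ hδ (le_of_lt hz.1) (le_of_lt hz.2) n)
  · exact hd.differentiableAt (hU.mem_nhds ⟨hδ', by simp [S]⟩)
  · split_ifs with hn
    · fun_prop
    · unfold lerchTerm
      have hden : ∀ z ∈ U, 1 - exp (2 * π * I * n * τ + 2 * π * I * u z) ≠ 0 := by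
        intro z hz
        have h1 := lerch_denominator_bound hτ (le_of_lt hz.1) hn
        have h2 : 0 < 1 - Real.exp (-(2 * π * δ)) := by
          rw [sub_pos, Real.exp_lt_one_iff]
          have := mul_pos Real.pi_pos hδ
          linarith
        exact norm_pos_iff.mp (h2.trans_le h1)
      exact DifferentiableOn.fun_div (Differentiable.differentiableOn (by fun_prop))
        (Differentiable.differentiableOn (by fun_prop)) hden

lemma differentiableAt_lerch {τ : ℂ} (hτ : 0 < τ.im) {u v : ℂ → ℂ} (hu : Differentiable ℂ u)
    (hv : Differentiable ℂ v) {z₀ : ℂ} (h : u z₀ ∉ lattice τ) :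
    DifferentiableAt ℂ (fun z => lerch (u z) (v z) τ) z₀ := by
  obtain ⟨k, l, w, hw, h0, h1, -, -⟩ := exists_strip_representative hτ (u z₀)
  -- Quantifying over all parametrizations with the given value at `z₀` allows `u` and `v` to be
  -- replaced by their translates.
  have key := lattice_translation_invariant (τ := τ)
    (Q := fun p => p ∉ lattice τ → ∀ u v : ℂ → ℂ, Differentiable ℂ u → Differentiable ℂ v →
      u z₀ = p → DifferentiableAt ℂ (fun z => lerch (u z) (v z) τ) z₀) (fun p => ?_) (fun p => ?_)
      k l w
  · rw [← hw] at key
    refine key.mp (fun hwl u v hu hv hp => ?_) h u v hu hv rfl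
    simp_rw [lerch_eq_add_lerchTail hτ]
    refine DifferentiableAt.fun_add (DifferentiableAt.fun_div (by fun_prop) (by fun_prop) ?_)
      (differentiableAt_lerchTail hτ hu hv (by rwa [hp, abs_of_nonneg h0]))
    simpa [hp] using one_sub_exp_ne_zero hwl 0
  · rw [add_one_mem_lattice]
    refine imp_congr_right fun _ => ⟨fun H u v hu hv hp => ?_, fun H u v hu hv hp => ?_⟩
    · have := H (fun z => u z - 1) v (by fun_prop) hv (by rw [hp]; ring)
      refine this.congr_of_eventuallyEq (.of_forall fun z => ?_)
      simp only [← lerch_add_one_left (u z - 1), sub_add_cancel]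
    · have := H (fun z => u z + 1) v (by fun_prop) hv (by rw [hp])
      simpa only [lerch_add_one_left] using this
  · rw [add_tau_mem_lattice]
    refine imp_congr_right fun _ => ⟨fun H u v hu hv hp => ?_, fun H u v hu hv hp => ?_⟩
    · have := H (fun z => u z - τ) (fun z => v z - τ) (by fun_prop) (by fun_prop)
        (by rw [hp]; ring)
      have h2 : DifferentiableAt ℂ (fun z => -exp (-2 * π * I * (v z - τ + τ)) *
        lerch (u z - τ) (v z - τ) τ) z₀ := by fun_prop
      refine h2.congr_of_eventuallyEq (.of_forall fun z => ?_)
      simpa using lerch_add_tau_add_tau (u z - τ) (v z - τ) τ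
    · have := H (fun z => u z + τ) (fun z => v z + τ) (by fun_prop) (by fun_prop) (by rw [hp])
      have h2 : DifferentiableAt ℂ (fun z => (-exp (-2 * π * I * (v z + τ)))⁻¹ *
        lerch (u z + τ) (v z + τ) τ) z₀ := by
        refine DifferentiableAt.fun_mul (DifferentiableAt.fun_inv (by fun_prop) ?_) this
        exact neg_ne_zero.mpr (exp_ne_zero _)
      refine h2.congr_of_eventuallyEq (.of_forall fun z => ?_)
      simp only [lerch_add_tau_add_tau]
      rw [inv_mul_cancel_left₀ (neg_ne_zero.mpr (exp_ne_zero _))]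

/-! ### The function `μ` -/

lemma analyticAt_dslope_self {f : ℂ → ℂ} {p : ℂ} (hf : AnalyticAt ℂ f p) :
    AnalyticAt ℂ (dslope f p) p := by
  obtain ⟨P, hP⟩ := hf
  exact ⟨_, hP.has_fpower_series_dslope_fslope⟩

/-- The simple zero of `D` is cancelled by the zero of `g`: after division of both by `z - p`, the
denominator has the value `deriv D p ≠ 0`. -/
lemma removableAt_div {f g D : ℂ → ℂ} {p : ℂ} (hg : AnalyticAt ℂ g p) (hfg : f =ᶠ[𝓝[≠] p] g)
    (hg0 : g p = 0) (hD : AnalyticAt ℂ D p) (hD0 : D p = 0) (hD' : deriv D p ≠ 0) :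
    RemovableAt (fun z => f z / D z) p := by
  refine ⟨fun z => dslope g p z / dslope D p z,
    (analyticAt_dslope_self hg).fun_div (analyticAt_dslope_self hD) (by rwa [dslope_same]), ?_⟩
  filter_upwards [hfg, self_mem_nhdsWithin] with z hz hzp
  have hzp : z - p ≠ 0 := sub_ne_zero.mpr hzp
  have h1 := sub_smul_dslope g p z
  have h2 := sub_smul_dslope D p z
  rw [hg0, sub_zero, smul_eq_mul] at h1
  rw [hD0, sub_zero, smul_eq_mul] at h2
  rw [hz, ← h1, ← h2, mul_div_mul_left _ _ hzp]

lemma mu_add_one_left (u v τ : ℂ) : mu (u + 1) v τ = -mu u v τ := by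
  rw [mu_eq_lerch, mu_eq_lerch, lerch_add_one_left,
    exp_eq_neg_exp_of_sub (x := π * I * (u + 1)) (y := π * I * u) 0 (by push_cast; ring)]
  ring

lemma mu_add_one_right (u v τ : ℂ) : mu u (v + 1) τ = -mu u v τ := by
  rw [mu_eq_lerch, mu_eq_lerch, lerch_add_one_right, theta_add_one, div_neg, neg_mul]

lemma mu_add_tau_add_tau (u v τ : ℂ) : mu (u + τ) (v + τ) τ = mu u v τ := by
  rw [mu_eq_lerch, mu_eq_lerch, lerch_add_tau_add_tau, theta_add_tau, ← mul_assoc]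
  congr 1
  have h : exp (π * I * (u + τ)) * exp (-2 * π * I * (v + τ)) =
      exp (-π * I * τ - 2 * π * I * v) * exp (π * I * u) := by
    rw [← exp_add, ← exp_add]; ring_nf
  rw [div_mul_eq_mul_div, mul_neg, h, neg_mul (exp _) (theta _ _), neg_div_neg_eq,
    mul_div_mul_left _ _ (exp_ne_zero _)]

/-- Under `n ↦ -n` the denominator becomes `1 - x⁻¹ = -x⁻¹(1 - x)`. The resulting sign is
compensated by the oddness of θ, the exponential by the prefactor `e^{πiu}`. -/
lemma mu_neg_neg {u τ : ℂ} (v : ℂ) (hu : u ∉ lattice τ) : mu (-u) (-v) τ = mu u v τ := by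
  have h : lerch (-u) (-v) τ = -exp (2 * π * I * u) * lerch u v τ := by
    rw [lerch, lerch, ← tsum_mul_left, ← (Equiv.neg ℤ).tsum_eq]
    refine tsum_congr fun n => ?_
    have h1 := one_sub_exp_ne_zero hu n
    have h2 : 1 - exp (2 * π * I * ((-n : ℤ) : ℂ) * τ + 2 * π * I * (-u)) ≠ 0 :=
      one_sub_exp_ne_zero (by rwa [neg_mem_lattice]) (-n)
    have e1 : exp (2 * π * I * ((-n : ℤ) : ℂ) * τ + 2 * π * I * (-u)) *
        exp (2 * π * I * n * τ + 2 * π * I * u) = 1 := by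
      rw [← exp_add, ← exp_zero]; congr 1; push_cast; ring
    have e2 : exp (2 * π * I * u) * exp (π * I * ((n : ℂ) ^ 2 + n) * τ + 2 * π * I * n * v) =
        exp (π * I * (((-n : ℤ) : ℂ) ^ 2 + ((-n : ℤ) : ℂ)) * τ +
          2 * π * I * ((-n : ℤ) : ℂ) * (-v)) * exp (2 * π * I * n * τ + 2 * π * I * u) := by
      rw [← exp_add, ← exp_add]; congr 1; push_cast; ring
    rw [Equiv.neg_apply, lerchTerm, lerchTerm, zpow_neg, ← inv_zpow, inv_neg_one, mul_div_assoc',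
      div_eq_div_iff h2 h1, neg_mul, mul_left_comm, e2]
    linear_combination -(-1 : ℂ) ^ n * exp (π * I * (((-n : ℤ) : ℂ) ^ 2 + ((-n : ℤ) : ℂ)) * τ +
          2 * π * I * ((-n : ℤ) : ℂ) * (-v)) * e1
  rw [mu_eq_lerch, mu_eq_lerch, h, theta_neg]
  have e : exp (π * I * (-u)) * exp (2 * π * I * u) = exp (π * I * u) := by
    rw [← exp_add]; ring_nf
  rw [← e]
  ring

lemma theta_eq_tsum_add (v τ : ℂ) : theta v τ = -I * exp (π * I * τ / 4 - π * I * v) *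
    ∑' n : ℤ, (-1 : ℂ) ^ n * exp (π * I * ((n : ℂ) ^ 2 - n) * τ + 2 * π * I * n * v) := by
  rw [theta_eq_I_mul_tsum, ← tsum_mul_left, ← tsum_mul_left, ← (Equiv.subRight (1 : ℤ)).tsum_eq]
  refine tsum_congr fun n => ?_
  rw [Equiv.subRight_apply, zpow_sub_one₀ (by norm_num)]
  have : exp (π * I * (((n - 1 : ℤ) : ℂ) + 1 / 2) ^ 2 * τ +
      2 * π * I * (((n - 1 : ℤ) : ℂ) + 1 / 2) * v) =
      exp (π * I * τ / 4 - π * I * v) *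
        exp (π * I * ((n : ℂ) ^ 2 - n) * τ + 2 * π * I * n * v) := by
    rw [← exp_add]; congr 1; push_cast; ring
  rw [this, inv_neg_one]
  ring

/-- The three-term relation of `μ` under the translation of the first variable by `τ`. -/
lemma mu_add_exp_mul_mu_add_tau {u v τ : ℂ} (hτ : 0 < τ.im) (hu : u ∉ lattice τ)
    (hv : v ∉ lattice τ) :
    mu u v τ + exp (-2 * π * I * (u - v) - π * I * τ) * mu (u + τ) v τ =
      -I * exp (-π * I * (u - v) - π * I * τ / 4) := by
  set s : ℤ → ℂ := fun n =>
    (-1 : ℂ) ^ n * exp (π * I * ((n : ℂ) ^ 2 - n) * τ + 2 * π * I * n * v) with hs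
  have hθ := theta_ne_zero hτ hv
  have h1 : lerch (u + τ) v τ = ∑' n : ℤ, lerchTerm (u + τ) v τ (n - 1) :=
    ((Equiv.subRight (1 : ℤ)).tsum_eq (lerchTerm (u + τ) v τ)).symm
  have hsum1 : Summable fun n : ℤ => lerchTerm (u + τ) v τ (n - 1) :=
    (Equiv.subRight (1 : ℤ)).summable_iff.mpr (summable_lerchTerm hτ (u + τ) v)
  have hsum2 := summable_lerchTerm hτ u v
  -- After an index shift both sums have the same denominators. The combined numerator contains the
  -- denominator as a factor, and its cancellation leaves the series of θ.
  have hcomb : lerch u v τ - exp (-2 * π * I * u + 2 * π * I * v) * (-lerch (u + τ) v τ) =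
      -exp (-2 * π * I * u) * ∑' n : ℤ, s n := by
    rw [h1, lerch, ← tsum_neg, ← tsum_mul_left, ← tsum_mul_left, ← hsum2.tsum_sub
      (hsum1.neg.mul_left _)]
    refine tsum_congr fun n => ?_
    have hd := one_sub_exp_ne_zero hu n
    have e1 : exp (2 * π * I * ((n - 1 : ℤ) : ℂ) * τ + 2 * π * I * (u + τ)) =
        exp (2 * π * I * n * τ + 2 * π * I * u) := by
      congr 1; push_cast; ring
    have e2 : exp (-2 * π * I * u + 2 * π * I * v) * exp (π * I * (((n - 1 : ℤ) : ℂ) ^ 2 +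
        ((n - 1 : ℤ) : ℂ)) * τ + 2 * π * I * ((n - 1 : ℤ) : ℂ) * v) =
        exp (-2 * π * I * u) * exp (π * I * ((n : ℂ) ^ 2 - n) * τ + 2 * π * I * n * v) := by
      rw [← exp_add, ← exp_add]; congr 1; push_cast; ring
    have e3 : exp (π * I * ((n : ℂ) ^ 2 + n) * τ + 2 * π * I * n * v) =
        exp (-2 * π * I * u) * exp (π * I * ((n : ℂ) ^ 2 - n) * τ + 2 * π * I * n * v) *
          exp (2 * π * I * n * τ + 2 * π * I * u) := by
      rw [← exp_add, ← exp_add]; congr 1; ring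
    rw [lerchTerm, lerchTerm, e1, zpow_sub_one₀ (by norm_num), inv_neg_one, hs]
    simp only
    rw [mul_neg, sub_neg_eq_add, mul_div_assoc', ← add_div, div_eq_iff hd]
    linear_combination (-1 : ℂ) ^ n * e3 - (-1 : ℂ) ^ n * e2
  have hth := theta_eq_tsum_add v τ
  change theta v τ = _ * ∑' n, s n at hth
  rw [mu_eq_lerch, mu_eq_lerch]
  have e4 : exp (-2 * π * I * (u - v) - π * I * τ) * exp (π * I * (u + τ)) =
      exp (π * I * u) * exp (-2 * π * I * u + 2 * π * I * v) := by
    rw [← exp_add, ← exp_add]; ring_nf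
  have e5 : exp (-π * I * (u - v) - π * I * τ / 4) * exp (π * I * τ / 4 - π * I * v) =
      exp (π * I * u) * exp (-2 * π * I * u) := by
    rw [← exp_add, ← exp_add]; ring_nf
  have hgoal : exp (π * I * u) * lerch u v τ + exp (-2 * π * I * (u - v) - π * I * τ) *
      (exp (π * I * (u + τ)) * lerch (u + τ) v τ) =
      -I * exp (-π * I * (u - v) - π * I * τ / 4) * theta v τ := by
    rw [hth]
    linear_combination exp (π * I * u) * hcomb + lerch (u + τ) v τ * e4 -
      (-(∑' n, s n)) * e5 - (∑' n, s n) * exp (-π * I * (u - v) - π * I * τ / 4) *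
        exp (π * I * τ / 4 - π * I * v) * I_mul_I
  rw [div_mul_eq_mul_div, div_mul_eq_mul_div, mul_div_assoc', ← add_div, hgoal,
    mul_div_cancel_right₀ _ hθ]

lemma mu_tau_add_one (u v τ : ℂ) : mu u v (τ + 1) = exp (-π * I / 4) * mu u v τ := by
  have h : lerch u v (τ + 1) = lerch u v τ := by
    refine tsum_congr fun n => ?_
    obtain ⟨k, hk⟩ := Int.even_mul_succ_self n
    have hk' : (n : ℂ) * (n + 1) = k + k := by exact_mod_cast hk
    rw [lerchTerm, lerchTerm]
    congr 2
    · exact exp_eq_exp_of_sub k (by linear_combination π * I * hk')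
    · exact exp_eq_exp_of_sub n (by ring)
  rw [mu_eq_lerch, mu_eq_lerch, h, theta_tau_add_one,
    show -π * I / 4 = -(π * I / 4) by ring, exp_neg]
  field_simp

lemma differentiableAt_mu {τ : ℂ} (hτ : 0 < τ.im) {u v : ℂ → ℂ} (hu : Differentiable ℂ u)
    (hv : Differentiable ℂ v) {z₀ : ℂ} (h : u z₀ ∉ lattice τ) (h' : v z₀ ∉ lattice τ) :
    DifferentiableAt ℂ (fun z => mu (u z) (v z) τ) z₀ := by
  have hθ : Differentiable ℂ fun z => theta (v z) τ := (differentiable_theta hτ).comp hv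
  have := differentiableAt_lerch hτ hu hv h
  simp_rw [mu_eq_lerch]
  exact DifferentiableAt.fun_mul (DifferentiableAt.fun_div (by fun_prop) (hθ z₀)
    (theta_ne_zero hτ h')) this

lemma analyticAt_of_eventually_differentiableAt {f : ℂ → ℂ} {p : ℂ}
    (h : ∀ᶠ z in 𝓝 p, DifferentiableAt ℂ f z) : AnalyticAt ℂ f p :=
  analyticAt_iff_eventually_differentiableAt.mpr h

lemma analyticAt_lerch {τ : ℂ} (hτ : 0 < τ.im) {u v : ℂ → ℂ} (hu : Differentiable ℂ u)
    (hv : Differentiable ℂ v) {p : ℂ} (h : u p ∉ lattice τ) :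
    AnalyticAt ℂ (fun z => lerch (u z) (v z) τ) p := by
  refine analyticAt_of_eventually_differentiableAt ?_
  filter_upwards [hu.continuous.continuousAt.eventually (eventually_nhds_not_mem_lattice hτ h)]
    with z hz
  exact differentiableAt_lerch hτ hu hv hz

lemma analyticAt_lerchTail {τ : ℂ} (hτ : 0 < τ.im) {v : ℂ → ℂ} (hv : Differentiable ℂ v) :
    AnalyticAt ℂ (fun z => lerchTail z (v z) τ) 0 := by
  refine analyticAt_of_eventually_differentiableAt ?_
  have : ∀ᶠ z : ℂ in 𝓝 0, |z.im| < τ.im :=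
    (continuous_im.abs.tendsto' 0 0 (by simp)).eventually (gt_mem_nhds hτ)
  filter_upwards [this] with z hz
  exact differentiableAt_lerchTail hτ differentiable_id hv hz

/-- The singularity of the Lerch sum at `u = 0` is cancelled by the theta function. -/
lemma exists_theta_mul_lerch_eq {τ : ℂ} (hτ : 0 < τ.im) {v : ℂ → ℂ} (hv : Differentiable ℂ v) :
    ∃ g : ℂ → ℂ, AnalyticAt ℂ g 0 ∧ g 0 = -deriv (fun w => theta w τ) 0 / (2 * π * I) ∧
      (fun w => theta w τ * lerch w (v w) τ) =ᶠ[𝓝[≠] 0] g := by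
  obtain ⟨φ, hφ, hφ0, hφe⟩ := exists_one_sub_exp_eq
  obtain ⟨ψ, hψ, hψ0, hψe⟩ := exists_eq_mul_of_apply_zero (differentiable_theta hτ) (theta_zero τ)
  have hφ0' : φ 0 ≠ 0 := by rw [hφ0]; exact neg_ne_zero.mpr two_pi_I_ne_zero
  refine ⟨fun w => ψ w / φ w + theta w τ * lerchTail w (v w) τ, ?_, ?_, ?_⟩
  · exact ((hψ.analyticAt 0).fun_div (hφ.analyticAt 0) hφ0').fun_add
      (((differentiable_theta hτ).analyticAt 0).fun_mul (analyticAt_lerchTail hτ hv))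
  · simp only [theta_zero, zero_mul, add_zero, hψ0, hφ0]
    rw [div_neg, neg_div]
  · filter_upwards [self_mem_nhdsWithin] with w hw
    have hw : w ≠ 0 := hw
    rw [lerch_eq_add_lerchTail hτ, mul_add, hφe, hψe, mul_one_div, mul_div_mul_left _ _ hw]

/-- The effect on `μ` of a simultaneous translation of both variables. -/
lemma theta_mul_mu_add_sub_mu {τ u v : ℂ} (hτ : 0 < τ.im) (hu : u ∉ lattice τ)
    (hv : v ∉ lattice τ) {z : ℂ} (hz : u + z ∉ lattice τ) :
    theta (u + z) τ * (exp (π * I * (u + z)) * lerch (u + z) (v + z) τ) -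
        mu u v τ * (theta (u + z) τ * theta (v + z) τ) =
      deriv (fun w => theta w τ) 0 / (2 * π * I * (theta u τ * theta v τ)) *
        (theta z τ * theta (u + v + z) τ) := by
  have hθd := differentiable_theta hτ
  have hθu := theta_ne_zero hτ hu
  have hθv := theta_ne_zero hτ hv
  have hθ' := deriv_theta_zero_ne_zero hτ
  set c : ℂ := deriv (fun w => theta w τ) 0 / (2 * π * I * (theta u τ * theta v τ)) with hc
  have ha : ∀ a : ℂ, Differentiable ℂ fun z => theta (a + z) τ := fun a =>
    hθd.comp (f := fun z => a + z) (by fun_prop)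
  have ha' : ∀ a : ℂ, Differentiable ℂ fun z => theta (z + a) τ := fun a =>
    hθd.comp (f := fun z => z + a) (by fun_prop)
  -- The factor `θ(v + z)` has cancelled the denominator of `mu (u + z) (v + z)`, so only the zeros
  -- of `θ(u + z)` need attention. `F` and `D` share all multipliers up to `e^{-2πiv}`.
  set F : ℂ → ℂ := fun z => theta (u + z) τ * (exp (π * I * (u + z)) *
    lerch (u + z) (v + z) τ) - mu u v τ * (theta (u + z) τ * theta (v + z) τ) -
      c * (theta z τ * theta (u + v + z) τ) with hF
  set D : ℂ → ℂ := fun z => theta z τ * theta (z + u) τ with hD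
  have hDd : Differentiable ℂ D := hθd.fun_mul (ha' u)
  have hFd : ∀ p, u + p ∉ lattice τ → AnalyticAt ℂ F p := by
    intro p hp
    have h1 := analyticAt_lerch hτ (u := fun z => u + z) (v := fun z => v + z) (by fun_prop)
      (by fun_prop) hp
    have h2 : AnalyticAt ℂ (fun z => exp (π * I * (u + z))) p :=
      Differentiable.analyticAt (by fun_prop) p
    exact ((((ha u).analyticAt p).fun_mul (h2.fun_mul h1)).fun_sub
      (analyticAt_const.fun_mul (((ha u).analyticAt p).fun_mul ((ha v).analyticAt p)))).fun_sub
      (analyticAt_const.fun_mul ((hθd.analyticAt p).fun_mul ((ha (u + v)).analyticAt p)))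
  have h1 : ∀ z, F (z + 1) / D (z + 1) = 1 * (F z / D z) := by
    intro z
    have e : exp (π * I * (u + z + 1)) = -exp (π * I * (u + z)) :=
      exp_eq_neg_exp_of_sub 0 (by push_cast; ring)
    simp only [hF, hD, ← add_assoc, add_right_comm z 1 u, theta_add_one, lerch_add_one_left,
      lerch_add_one_right, e, one_mul]
    congr 1 <;> ring
  have ht : ∀ z, F (z + τ) / D (z + τ) = exp (-2 * π * I * v) * (F z / D z) := by
    intro z
    have e1 : exp (-π * I * τ - 2 * π * I * (u + z)) * exp (π * I * (u + z + τ)) *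
        exp (-2 * π * I * (v + z + τ)) =
        exp (-2 * π * I * τ - 2 * π * I * (2 * z + u)) * exp (-2 * π * I * v) *
          exp (π * I * (u + z)) := by
      simp only [← exp_add]; ring_nf
    have e2 : exp (-π * I * τ - 2 * π * I * (u + z)) * exp (-π * I * τ - 2 * π * I * (v + z)) =
        exp (-2 * π * I * τ - 2 * π * I * (2 * z + u)) * exp (-2 * π * I * v) := by
      simp only [← exp_add]; ring_nf
    have e3 : exp (-π * I * τ - 2 * π * I * z) * exp (-π * I * τ - 2 * π * I * (u + v + z)) =
        exp (-2 * π * I * τ - 2 * π * I * (2 * z + u)) * exp (-2 * π * I * v) := by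
      simp only [← exp_add]; ring_nf
    have e4 : exp (-π * I * τ - 2 * π * I * z) * exp (-π * I * τ - 2 * π * I * (z + u)) =
        exp (-2 * π * I * τ - 2 * π * I * (2 * z + u)) := by
      simp only [← exp_add]; ring_nf
    have hFt : F (z + τ) = exp (-2 * π * I * τ - 2 * π * I * (2 * z + u)) *
        (exp (-2 * π * I * v) * F z) := by
      simp only [hF, ← add_assoc, theta_add_tau, lerch_add_tau_add_tau]
      linear_combination theta (u + z) τ * lerch (u + z) (v + z) τ * e1 -
        mu u v τ * theta (u + z) τ * theta (v + z) τ * e2 -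
          c * theta z τ * theta (u + v + z) τ * e3
    have hDt : D (z + τ) = exp (-2 * π * I * τ - 2 * π * I * (2 * z + u)) * D z := by
      simp only [hD, add_right_comm z τ u, theta_add_tau]
      linear_combination theta z τ * theta (z + u) τ * e4
    rw [hFt, hDt, mul_div_mul_left _ _ (exp_ne_zero _), mul_div_assoc]
  have hlat := fun n m p => lattice_translation_invariant (τ := τ)
    (Q := RemovableAt fun z => F z / D z)
    (fun p => removableAt_add_iff one_ne_zero (.of_forall h1))
    (fun p => removableAt_add_iff (exp_ne_zero _) (.of_forall ht)) n m p
  -- At `z = 0` the two `mu` terms coincide and `θ(z)` vanishes, so `F` vanishes.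
  have hrem0 : RemovableAt (fun z => F z / D z) 0 := by
    refine removableAt_div (hFd 0 (by simpa using hu)) EventuallyEq.rfl ?_ (hDd.analyticAt 0) ?_ ?_
    · simp only [hF, add_zero, theta_zero, zero_mul, mul_zero, sub_zero, mu_eq_lerch]
      field_simp
      ring
    · simp [hD, theta_zero]
    · have := ((hθd 0).hasDerivAt.mul ((ha' u) 0).hasDerivAt).deriv
      simp only [theta_zero, zero_mul, add_zero, zero_add] at this
      rw [hD]
      exact this ▸ mul_ne_zero hθ' hθu
  -- At `z = -u` the pole of the Lerch sum meets the zero of `θ(u + z)`. The constant `c` is the one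
  -- for which the resulting value of `F` is zero.
  have hremu : RemovableAt (fun z => F z / D z) (-u) := by
    obtain ⟨g, hg, hg0, hge⟩ := exists_theta_mul_lerch_eq hτ (v := fun w => v - u + w)
      (by fun_prop)
    refine removableAt_div (g := fun z => g (z + u) * exp (π * I * (u + z)) -
      mu u v τ * (theta (u + z) τ * theta (v + z) τ) - c * (theta z τ * theta (u + v + z) τ))
      ?_ ?_ ?_ (hDd.analyticAt (-u)) ?_ ?_
    · have h2 : AnalyticAt ℂ (fun z => g (z + u)) (-u) :=
        AnalyticAt.fun_comp (g := g) (by simpa using hg) (by fun_prop)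
      have h3 : AnalyticAt ℂ (fun z => exp (π * I * (u + z))) (-u) :=
        Differentiable.analyticAt (by fun_prop) _
      exact ((h2.fun_mul h3).fun_sub (analyticAt_const.fun_mul
        (((ha u).analyticAt _).fun_mul ((ha v).analyticAt _)))).fun_sub
        (analyticAt_const.fun_mul ((hθd.analyticAt _).fun_mul ((ha (u + v)).analyticAt _)))
    · rw [show (0 : ℂ) = -u + u by ring, nhdsNE_add_right, EventuallyEq, eventually_map] at hge
      filter_upwards [hge] with z hz
      rw [← hz, hF]
      simp only [add_comm z u]
      ring_nf
    · simp only [neg_add_cancel, hg0, add_neg_cancel, mul_zero, exp_zero, mul_one, theta_zero,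
        zero_mul, sub_zero, show u + v + -u = v by ring, theta_neg, hc]
      field_simp
      ring
    · simp [hD, theta_zero]
    · have hd := deriv_comp_add_const (fun z => theta z τ) u (-u)
      rw [neg_add_cancel] at hd
      have := ((hθd (-u)).hasDerivAt.mul ((ha' u) (-u)).hasDerivAt).deriv
      simp only [neg_add_cancel, theta_zero, mul_zero, zero_add, hd] at this
      rw [hD]
      exact this ▸ mul_ne_zero (by rw [theta_neg]; exact neg_ne_zero.mpr hθu) hθ'
  have hrem : ∀ p, RemovableAt (fun z => F z / D z) p := by
    intro p
    by_cases hp : p ∈ lattice τ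
    · obtain ⟨n, m, rfl⟩ := hp
      simpa using (hlat n m 0).mp hrem0
    by_cases hpu : u + p ∈ lattice τ
    · obtain ⟨n, m, h⟩ := hpu
      have := (hlat n m (-u)).mp hremu
      rwa [add_assoc, ← h, neg_add_cancel_left] at this
    refine .of_analyticAt ((hFd p hpu).fun_div (hDd.analyticAt p) ?_)
    exact mul_ne_zero (theta_ne_zero hτ hp) (theta_ne_zero hτ (by rwa [add_comm]))
  obtain ⟨C, β, hC⟩ := eventuallyEq_const_mul_exp_of_multipliers hτ hrem one_ne_zero
    (exp_ne_zero _) (fun p => .of_forall h1) (fun p => .of_forall ht)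
  have hC0 : C = 0 := by
    rcases const_eq_zero_or_multiplier hC (fun p => .of_forall (by simpa using h1))
      (fun p => .of_forall ht) with h | ⟨m, -, hm⟩
    · exact h
    -- A nonzero exponential would need `e^{-2πiv} = e^{2πimτ}`, putting `v` in the lattice.
    · refine absurd (mem_lattice_of_exp_eq_one m ?_) hv
      rw [exp_add, ← hm, ← exp_add]; simp
  have hF0 : F z = 0 := by
    refine eq_of_continuousAt_of_eventuallyEq (g := fun _ => 0) (hFd z hz).continuousAt
      continuousAt_const ?_
    have hev := (nhdsNE_add_right z u) ▸ eventually_not_mem_lattice hτ (z + u)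
    rw [eventually_map] at hev
    filter_upwards [hC z, eventually_not_mem_lattice hτ z, hev] with w hw h2 h3
    rw [hC0, zero_mul, div_eq_zero_iff] at hw
    exact hw.resolve_right (mul_ne_zero (theta_ne_zero hτ h2) (theta_ne_zero hτ h3))
  exact sub_eq_zero.mp hF0

lemma mu_add_sub_mu {τ u v z : ℂ} (hτ : 0 < τ.im) (hu : u ∉ lattice τ) (hv : v ∉ lattice τ)
    (huz : u + z ∉ lattice τ) (hvz : v + z ∉ lattice τ) :
    mu (u + z) (v + z) τ - mu u v τ = 1 / (2 * π * I) *
      (deriv (fun w => theta w τ) 0 * theta (u + v + z) τ * theta z τ) /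
        (theta u τ * theta v τ * theta (u + z) τ * theta (v + z) τ) := by
  have h := theta_mul_mu_add_sub_mu hτ hu hv huz
  have h1 := theta_ne_zero hτ hu
  have h2 := theta_ne_zero hτ hv
  have h3 := theta_ne_zero hτ huz
  have h4 := theta_ne_zero hτ hvz
  have h5 : exp (π * I * (u + z)) * lerch (u + z) (v + z) τ =
      mu (u + z) (v + z) τ * theta (v + z) τ := by
    rw [mu_eq_lerch]; field_simp
  rw [h5] at h
  have h6 : (2 * π * I : ℂ) ≠ 0 := two_pi_I_ne_zero
  generalize deriv (fun w => theta w τ) 0 = d at *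
  rw [div_mul_eq_mul_div, eq_div_iff (mul_ne_zero h6 (mul_ne_zero h1 h2))] at h
  rw [one_div_mul_eq_div, div_div, eq_div_iff (by simp [h1, h2, h3, h4, Real.pi_ne_zero])]
  linear_combination h

/-- The translation by `z = -(u + v)` takes `(u, v)` to `(-v, -u)` and makes the factor `θ(u + v +
z)` vanish. -/
lemma mu_symm {τ u v : ℂ} (hτ : 0 < τ.im) (hu : u ∉ lattice τ) (hv : v ∉ lattice τ) :
    mu v u τ = mu u v τ := by
  have h := mu_add_sub_mu (z := -(u + v)) hτ hu hv
    (by rwa [show u + -(u + v) = -v by ring, neg_mem_lattice])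
    (by rwa [show v + -(u + v) = -u by ring, neg_mem_lattice])
  rw [add_neg_cancel, theta_zero, show u + -(u + v) = -v by ring,
    show v + -(u + v) = -u by ring, mu_neg_neg u hv] at h
  simpa [sub_eq_zero] using h

/-- The simple pole of `μ(u, v)` at `u = 0`. -/
lemma exists_mu_eq_div_add {τ v : ℂ} (hτ : 0 < τ.im) (hv : v ∉ lattice τ) :
    ∃ g : ℂ → ℂ, AnalyticAt ℂ g 0 ∧ ∀ᶠ u in 𝓝[≠] 0,
      mu u v τ = -1 / (2 * π * I) * (1 / theta v τ) / u + g u := by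
  obtain ⟨φ, hφ, hφ0, hφe⟩ := exists_one_sub_exp_eq
  have hφ0' : φ 0 ≠ 0 := by rw [hφ0]; exact neg_ne_zero.mpr two_pi_I_ne_zero
  have hθ := theta_ne_zero hτ hv
  -- `h u / u` is the term `n = 0` of `mu`; its pole has residue `h 0`, and `dslope` is the
  -- remainder.
  set h : ℂ → ℂ := fun u => exp (π * I * u) / theta v τ / φ u with hh
  have hexp : AnalyticAt ℂ (fun u => exp (π * I * u) / theta v τ) 0 :=
    Differentiable.analyticAt (by fun_prop) 0
  have hha : AnalyticAt ℂ h 0 := hexp.fun_div (hφ.analyticAt 0) hφ0'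
  have hh0 : h 0 = -1 / (2 * π * I) * (1 / theta v τ) := by
    simp only [hh, mul_zero, exp_zero, hφ0]
    rw [div_neg]
    field_simp
  refine ⟨fun u => dslope h 0 u + exp (π * I * u) / theta v τ * lerchTail u v τ,
    (analyticAt_dslope_self hha).fun_add (hexp.fun_mul
      (analyticAt_lerchTail hτ (v := fun _ => v) (by fun_prop))), ?_⟩
  filter_upwards [self_mem_nhdsWithin] with u hu
  have hu : u ≠ 0 := hu
  have h1 := sub_smul_dslope h 0 u
  rw [sub_zero, smul_eq_mul] at h1
  have h2 : dslope h 0 u = (h u - h 0) / u := by rw [eq_div_iff hu, ← h1]; ring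
  rw [mu_eq_lerch, lerch_eq_add_lerchTail hτ, hφe, ← hh0, h2, hh, sub_div, mul_add, ← add_assoc,
    add_sub_cancel, mul_one_div, div_div _ (φ u) u, mul_comm u]

/-! ### The error function -/

lemma E_eq_sub (x y : ℝ) : E y - E x = 2 * ∫ t in x..y, Real.exp (-π * t ^ 2) := by
  have h : ∀ a b : ℝ, IntervalIntegrable (fun t => Real.exp (-π * t ^ 2))
      MeasureTheory.volume a b :=
    fun a b => Continuous.intervalIntegrable (by fun_prop) a b
  rw [E, E, ← mul_sub, intervalIntegral.integral_interval_sub_left (h 0 y) (h 0 x)]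

lemma E_neg (x : ℝ) : E (-x) = -E x := by
  have h := intervalIntegral.integral_comp_neg (a := 0) (b := x)
    (fun t : ℝ => Real.exp (-π * t ^ 2))
  simp only [neg_sq, neg_zero] at h
  rw [E, E, h, intervalIntegral.integral_symm]
  ring

lemma tendsto_E_atTop : Tendsto E atTop (𝓝 1) := by
  have h := MeasureTheory.intervalIntegral_tendsto_integral_Ioi (0 : ℝ)
    (integrable_exp_neg_mul_sq Real.pi_pos).integrableOn tendsto_id
  rw [integral_gaussian_Ioi, div_self Real.pi_ne_zero, Real.sqrt_one] at h
  have h2 : Tendsto (fun x : ℝ => 2 * ∫ t in (0 : ℝ)..x, Real.exp (-π * t ^ 2)) atTop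
      (𝓝 (2 * (1 / 2))) := h.const_mul 2
  rwa [mul_one_div, div_self two_ne_zero] at h2

/-- The tail integral from `x` is shifted to start at `0`, where `(x + t)² ≥ x² + t²` for `x, t ≥ 0`
extracts `e^{-πx²}`. -/
lemma abs_one_sub_E_le {x : ℝ} (hx : 0 ≤ x) : |1 - E x| ≤ Real.exp (-π * x ^ 2) := by
  have hc : Continuous fun t : ℝ => Real.exp (-π * t ^ 2) := by fun_prop
  have hlim : Tendsto (fun T => E (x + T) - E x) atTop (𝓝 (1 - E x)) :=
    (tendsto_E_atTop.comp (tendsto_atTop_add_const_left _ x tendsto_id)).sub_const _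
  rw [abs_of_nonneg]
  · have hlim2 : Tendsto (fun T => Real.exp (-π * x ^ 2) * E T) atTop
        (𝓝 (Real.exp (-π * x ^ 2) * 1)) := tendsto_E_atTop.const_mul _
    rw [mul_one] at hlim2
    refine le_of_tendsto_of_tendsto hlim hlim2 ?_
    filter_upwards [eventually_ge_atTop 0] with T hT
    have h := intervalIntegral.integral_comp_add_left (a := 0) (b := T)
      (fun t : ℝ => Real.exp (-π * t ^ 2)) x
    rw [add_zero] at h
    rw [E_eq_sub, ← h, E, mul_left_comm,
      ← intervalIntegral.integral_const_mul (Real.exp (-π * x ^ 2))]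
    have i1 : IntervalIntegrable (fun t => Real.exp (-π * (x + t) ^ 2))
        MeasureTheory.volume 0 T := Continuous.intervalIntegrable (by fun_prop) _ _
    have i2 : IntervalIntegrable (fun t => Real.exp (-π * x ^ 2) * Real.exp (-π * t ^ 2))
        MeasureTheory.volume 0 T := Continuous.intervalIntegrable (by fun_prop) _ _
    refine mul_le_mul_of_nonneg_left (intervalIntegral.integral_mono_on hT i1 i2
      fun t ht => ?_) zero_le_two
    rw [← Real.exp_add, Real.exp_le_exp]
    have h1 : 0 ≤ x * t := mul_nonneg hx ht.1
    have h2 : 0 ≤ π * (2 * (x * t)) := by positivity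
    nlinarith
  · refine ge_of_tendsto hlim ?_
    filter_upwards [eventually_ge_atTop 0] with T hT
    rw [E_eq_sub]
    exact mul_nonneg zero_le_two (intervalIntegral.integral_nonneg (by linarith)
      fun t _ => (Real.exp_pos _).le)

lemma sign_add_half (n : ℤ) : Real.sign ((n : ℝ) + 1 / 2) = if 0 ≤ n then 1 else -1 := by
  split_ifs with h
  · refine Real.sign_of_pos ?_
    have : (0 : ℝ) ≤ n := by exact_mod_cast h
    linarith
  · refine Real.sign_of_neg ?_
    have : (n : ℝ) ≤ -1 := by exact_mod_cast (by omega : n ≤ -1)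
    linarith

lemma abs_sign_sub_E_le (n : ℤ) {s : ℝ} (hs : 0 ≤ s) :
    |Real.sign ((n : ℝ) + 1 / 2) - E (((n : ℝ) + 1 / 2) * s)| ≤
      Real.exp (-π * (((n : ℝ) + 1 / 2) * s) ^ 2) := by
  rw [sign_add_half]
  split_ifs with h
  · have : (0 : ℝ) ≤ n := by exact_mod_cast h
    exact abs_one_sub_E_le (by positivity)
  · have h1 : (n : ℝ) ≤ -1 := by exact_mod_cast (by omega : n ≤ -1)
    have h2 := abs_one_sub_E_le (x := -(((n : ℝ) + 1 / 2) * s)) (by nlinarith)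
    rw [E_neg, neg_sq] at h2
    rwa [← abs_neg, show -(-1 - E (((n : ℝ) + 1 / 2) * s)) =
      1 - -E (((n : ℝ) + 1 / 2) * s) by ring]

/-- The error function extends to an entire function. -/
lemma exists_entire_E : ∃ Ec : ℂ → ℂ, (∀ z, HasDerivAt Ec (2 * exp (-π * z ^ 2)) z) ∧
    ∀ x : ℝ, Ec x = E x := by
  have hd : Differentiable ℂ fun z : ℂ => 2 * exp (-π * z ^ 2) := by fun_prop
  obtain ⟨g, hg0, hg⟩ := hd.isExactOn_univ.with_val_at 0 0
  refine ⟨g, fun z => hg z trivial, fun x => ?_⟩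
  have h := intervalIntegral.integral_eq_sub_of_hasDerivAt (a := 0) (b := x)
    (f := fun x : ℝ => g x) (f' := fun x : ℝ => 2 * exp (-π * (x : ℂ) ^ 2))
    (fun t _ => (hg t trivial).comp_ofReal) (Continuous.intervalIntegrable (by fun_prop) _ _)
  simp only [ofReal_zero, hg0, sub_zero] at h
  rw [← h, E, intervalIntegral.integral_const_mul, ofReal_mul, ← intervalIntegral.integral_ofReal]
  push_cast
  rfl

/-- The entire extension of the error function. -/
def Ec : ℂ → ℂ := exists_entire_E.choose

lemma hasDerivAt_Ec (z : ℂ) : HasDerivAt Ec (2 * exp (-π * z ^ 2)) z :=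
  exists_entire_E.choose_spec.1 z

lemma Ec_ofReal (x : ℝ) : Ec x = E x := exists_entire_E.choose_spec.2 x

/-! ### Joint analyticity of sums of products -/

lemma differentiable_tsum_of_bound {V : Type*} [NormedAddCommGroup V] [NormedSpace ℂ V]
    [CompleteSpace V] {F : ℤ → ℂ → V} (hF : ∀ n, Differentiable ℂ (F n))
    (hb : ∀ M : ℝ, ∃ b : ℤ → ℝ, Summable b ∧ ∀ n z, ‖z‖ < M → ‖F n z‖ ≤ b n) :
    Differentiable ℂ fun z => ∑' n, F n z := by
  intro z₀
  obtain ⟨b, hb, hFb⟩ := hb (‖z₀‖ + 1)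
  have := differentiableOn_tsum_of_summable_norm hb (U := Metric.ball 0 (‖z₀‖ + 1))
    (fun n => (hF n).differentiableOn) Metric.isOpen_ball
    (fun n z hz => hFb n z (by simpa using hz))
  exact this.differentiableAt (Metric.isOpen_ball.mem_nhds (by simp))

/-- A locally normally convergent sum of products of entire functions of two variables is
jointly analytic: it is the value of an analytic family of functionals on an analytic family of
vectors in a Hilbert space. -/
lemma analyticAt_tsum_mul {f g : ℤ → ℂ → ℂ} (hf : ∀ n, Differentiable ℂ (f n))
    (hg : ∀ n, Differentiable ℂ (g n))
    (hfb : ∀ M : ℝ, ∃ b : ℤ → ℝ, Summable b ∧ ∀ n z, ‖z‖ < M → ‖f n z‖ ≤ b n)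
    (hgb : ∀ M : ℝ, ∃ b : ℤ → ℝ, Summable b ∧ ∀ n z, ‖z‖ < M → ‖g n z‖ ≤ b n) (p : ℂ × ℂ) :
    AnalyticAt ℂ (fun p : ℂ × ℂ => ∑' n, f n p.1 * g n p.2) p := by
  classical
  let H := lp (fun _ : ℤ => ℂ) 2
  let e : ℤ → H := fun n => lp.single 2 n (1 : ℂ)
  have he : ∀ n, ‖e n‖ = 1 := fun n => by
    simp only [e, lp.norm_single (E := fun _ : ℤ => ℂ) (p := 2) (by norm_num), norm_one]
  have hinner : ∀ (n : ℤ) (x : H), inner ℂ (e n) x = x n := fun n x => by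
    rw [lp.inner_single_left]; simp
  have hee : ∀ n m : ℤ, inner ℂ (e n) (e m) = if m = n then (1 : ℂ) else 0 := fun n m => by
    rw [hinner, lp.single_apply]
    by_cases h : m = n
    · subst h; simp
    · rw [Pi.single_eq_of_ne (Ne.symm h), if_neg h]
  let Φ : ℂ → (H →L[ℂ] ℂ) := fun u => ∑' n, f n u • innerSL ℂ (e n)
  let Ψ : ℂ → H := fun a => ∑' n, g n a • e n
  have hfn : ∀ n u, ‖f n u • innerSL ℂ (e n)‖ = ‖f n u‖ := fun n u => by
    rw [norm_smul, innerSL_apply_norm, he, mul_one]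
  have hgn : ∀ n u, ‖g n u • e n‖ = ‖g n u‖ := fun n u => by rw [norm_smul, he, mul_one]
  have hΦ : Differentiable ℂ Φ := differentiable_tsum_of_bound
    (fun n => (hf n).smul_const _) (by simpa only [hfn] using hfb)
  have hΨ : Differentiable ℂ Ψ := differentiable_tsum_of_bound
    (fun n => (hg n).smul_const _) (by simpa only [hgn] using hgb)
  have hval : ∀ u a, Φ u (Ψ a) = ∑' n, f n u * g n a := by
    intro u a
    obtain ⟨b, hb, hfb'⟩ := hfb (‖u‖ + 1)
    obtain ⟨b', hb', hgb'⟩ := hgb (‖a‖ + 1)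
    have hs : Summable fun n => f n u • innerSL ℂ (e n) :=
      .of_norm_bounded hb fun n => (hfn n u).trans_le (hfb' n u (by simp))
    have hs' : Summable fun n => g n a • e n :=
      .of_norm_bounded hb' fun n => (hgn n a).trans_le (hgb' n a (by simp))
    have h1 := (ContinuousLinearMap.apply ℂ ℂ (Ψ a)).map_tsum hs
    simp only [ContinuousLinearMap.apply_apply] at h1
    change Φ u (Ψ a) = _ at h1
    rw [h1]
    refine tsum_congr fun n => ?_
    have h2 := (innerSL ℂ (e n)).map_tsum hs'
    change innerSL ℂ (e n) (Ψ a) = _ at h2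
    rw [smul_apply, h2, smul_eq_mul]
    congr 1
    simp only [map_smul, innerSL_apply_apply, hee, smul_eq_mul, mul_ite, mul_one, mul_zero]
    exact tsum_ite_eq n (g · a)
  simp_rw [← hval]
  exact AnalyticAt.comp₂ (h := fun q : (H →L[ℂ] ℂ) × H => q.1 q.2)
    ((ContinuousLinearMap.id ℂ (H →L[ℂ] ℂ)).analyticAt_bilinear (Φ p.1, Ψ p.2))
    ((hΦ.analyticAt p.1).fun_comp analyticAt_fst) ((hΨ.analyticAt p.2).fun_comp analyticAt_snd)

lemma summable_exp_half_integer {a : ℝ} (ha : 0 < a) {b : ℝ} (hb : 0 ≤ b) :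
    Summable fun n : ℤ => Real.exp (-a * ((n : ℝ) + 1 / 2) ^ 2 + b * |(n : ℝ) + 1 / 2|) := by
  -- The constants come from `-a(n + 1/2)² + b|n + 1/2| ≤ -an² + (a + b)|n| + b/2`.
  have h := summable_pow_mul_jacobiTheta₂_term_bound ((a + b) / (2 * π)) (div_pos ha Real.pi_pos) 0
  refine .of_nonneg_of_le (fun _ => (Real.exp_pos _).le) (fun n => ?_)
    (h.mul_left (Real.exp (b / 2)))
  rw [pow_zero, one_mul, ← Real.exp_add, Real.exp_le_exp]
  have e : -π * (a / π * (n : ℝ) ^ 2 - 2 * ((a + b) / (2 * π)) * ((|n| : ℤ) : ℝ)) =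
      -a * (n : ℝ) ^ 2 + (a + b) * |(n : ℝ)| := by
    rw [Int.cast_abs]
    field_simp [Real.pi_ne_zero]
    ring
  have h1 : |(n : ℝ) + 1 / 2| ≤ |(n : ℝ)| + 1 / 2 := by
    refine (abs_add_le _ _).trans ?_
    rw [abs_of_pos (by norm_num : (0 : ℝ) < 1 / 2)]
  rw [Int.cast_abs] at e ⊢
  rw [e]
  have h2 := mul_le_mul_of_nonneg_left h1 hb
  have h3 := mul_le_mul_of_nonneg_left (neg_abs_le (n : ℝ)) ha.le
  nlinarith

/-! ### The function `R` -/

/-- The exponentials in the series defining `R`. -/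
def rExp (τ : ℂ) (n : ℤ) (u : ℂ) : ℂ :=
  (-1 : ℂ) ^ n * exp (-π * I * ((n : ℂ) + 1 / 2) ^ 2 * τ - 2 * π * I * ((n : ℂ) + 1 / 2) * u)

/-- The coefficients of the series defining `R`, for a complex value of the parameter `α`. -/
def rCoeff (s : ℝ) (n : ℤ) (α : ℂ) : ℂ :=
  (Real.sign ((n : ℝ) + 1 / 2) : ℂ) - Ec (((n : ℂ) + 1 / 2 + α) * s)

/-- The series for `R` with `u` and `α` as independent complex variables. -/
def rSeries (τ u α : ℂ) : ℂ := ∑' n : ℤ, rExp τ n u * rCoeff (√(2 * τ.im)) n α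

lemma R_eq_rSeries (u τ : ℂ) : R u τ = rSeries τ u ((u.im / τ.im : ℝ) : ℂ) := by
  refine tsum_congr fun n => ?_
  rw [rExp, rCoeff, show ((n : ℂ) + 1 / 2 + ((u.im / τ.im : ℝ) : ℂ)) * (√(2 * τ.im) : ℂ) =
    ((((n : ℝ) + 1 / 2 + u.im / τ.im) * √(2 * τ.im) : ℝ) : ℂ) by push_cast; ring, Ec_ofReal]
  push_cast
  ring

lemma norm_rExp (τ : ℂ) (n : ℤ) (u : ℂ) :
    ‖rExp τ n u‖ =
      Real.exp (π * τ.im * ((n : ℝ) + 1 / 2) ^ 2 + 2 * π * ((n : ℝ) + 1 / 2) * u.im) := by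
  rw [rExp, norm_mul, norm_zpow, norm_neg, norm_one, one_zpow, one_mul, norm_exp]
  congr 1
  have : -π * I * ((n : ℂ) + 1 / 2) ^ 2 * τ - 2 * π * I * ((n : ℂ) + 1 / 2) * u =
      I * (((-π * ((n : ℝ) + 1 / 2) ^ 2 : ℝ) : ℂ) * τ -
        ((2 * π * ((n : ℝ) + 1 / 2) : ℝ) : ℂ) * u) := by
    push_cast; ring
  rw [this, I_mul_re, sub_im, im_ofReal_mul, im_ofReal_mul]
  ring

lemma hasDerivAt_rCoeff (s : ℝ) (n : ℤ) (α : ℂ) :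
    HasDerivAt (rCoeff s n) (-(2 * s * exp (-π * (((n : ℂ) + 1 / 2 + α) * s) ^ 2))) α := by
  have h1 : HasDerivAt (fun α : ℂ => ((n : ℂ) + 1 / 2 + α) * s) (1 * s) α :=
    ((hasDerivAt_id α).const_add _).mul_const _
  have h2 := ((hasDerivAt_Ec (((n : ℂ) + 1 / 2 + α) * s)).comp α h1).const_sub
    (Real.sign ((n : ℝ) + 1 / 2) : ℂ)
  convert! h2 using 1
  ring

/-- At `α = 0` this is the Gaussian tail bound with `s² = 2y`. The mean value inequality extends it
to the disc, since the derivative in `α` is itself a Gaussian. -/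
lemma norm_rCoeff_le {y s M : ℝ} (hy : 0 < y) (hs : 0 ≤ s) (hsy : s ^ 2 = 2 * y) (n : ℤ) {α : ℂ}
    (hα : ‖α‖ < M) : ‖rCoeff s n α‖ ≤ (1 + 2 * s * M * Real.exp (2 * π * y * M ^ 2)) *
      Real.exp (-2 * π * y * ((n : ℝ) + 1 / 2) ^ 2 + 4 * π * y * M * |(n : ℝ) + 1 / 2|) := by
  set ν : ℝ := (n : ℝ) + 1 / 2 with hν
  have hM : 0 < M := (norm_nonneg α).trans_lt hα
  have hpi := Real.pi_pos
  have h0 : ‖rCoeff s n 0‖ ≤ Real.exp (-2 * π * y * ν ^ 2) := by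
    have h := abs_sign_sub_E_le n hs
    rw [mul_pow, hsy] at h
    rw [rCoeff, add_zero, show ((n : ℂ) + 1 / 2) * (s : ℂ) = ((ν * s : ℝ) : ℂ) by
      rw [hν]; push_cast; ring, Ec_ofReal, ← ofReal_sub, norm_real, Real.norm_eq_abs]
    refine h.trans_eq ?_
    congr 1
    ring
  have hderiv : ∀ z ∈ Metric.ball (0 : ℂ) M, ‖deriv (rCoeff s n) z‖ ≤
      2 * s * (Real.exp (2 * π * y * M ^ 2) *
        Real.exp (-2 * π * y * ν ^ 2 + 4 * π * y * M * |ν|)) := by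
    intro z hz
    rw [mem_ball_zero_iff] at hz
    rw [(hasDerivAt_rCoeff s n z).deriv, norm_neg, norm_mul, norm_mul, norm_real,
      Real.norm_of_nonneg hs, Complex.norm_two, ← Real.exp_add, norm_exp]
    refine mul_le_mul_of_nonneg_left ?_ (by positivity)
    rw [Real.exp_le_exp]
    have e : -π * (((n : ℂ) + 1 / 2 + z) * s) ^ 2 =
        ((-2 * π * y : ℝ) : ℂ) * (((ν ^ 2 : ℝ) : ℂ) + ((2 * ν : ℝ) : ℂ) * z + z ^ 2) := by
      have : (s : ℂ) ^ 2 = 2 * y := by exact_mod_cast hsy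
      rw [mul_pow, this, hν]
      push_cast
      ring
    rw [e, re_ofReal_mul, add_re, add_re, ofReal_re, re_ofReal_mul]
    have h1 : -(|ν| * M) ≤ ν * z.re := by
      have h3 : |ν * z.re| ≤ |ν| * M := by
        rw [abs_mul]
        exact mul_le_mul_of_nonneg_left ((abs_re_le_norm z).trans hz.le) (abs_nonneg _)
      exact (abs_le.mp h3).1
    have h2 : -(M ^ 2) ≤ (z ^ 2).re := by
      have h3 : |(z ^ 2).re| ≤ M ^ 2 := by
        refine (abs_re_le_norm _).trans ?_
        rw [norm_pow]
        exact pow_le_pow_left₀ (norm_nonneg _) hz.le 2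
      exact (abs_le.mp h3).1
    have h3 : 0 ≤ 2 * π * y := by positivity
    have h4 := mul_le_mul_of_nonneg_left h1 h3
    have h5 := mul_le_mul_of_nonneg_left h2 h3
    nlinarith
  have hmv := (convex_ball (0 : ℂ) M).norm_image_sub_le_of_norm_deriv_le
    (fun z _ => (hasDerivAt_rCoeff s n z).differentiableAt) hderiv
    (Metric.mem_ball_self hM) (mem_ball_zero_iff.mpr hα)
  rw [sub_zero] at hmv
  have h6 : ‖rCoeff s n α‖ ≤ ‖rCoeff s n 0‖ + ‖rCoeff s n α - rCoeff s n 0‖ := by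
    have := norm_add_le (rCoeff s n 0) (rCoeff s n α - rCoeff s n 0)
    rwa [add_sub_cancel] at this
  have h7 : Real.exp (-2 * π * y * ν ^ 2) ≤
      Real.exp (-2 * π * y * ν ^ 2 + 4 * π * y * M * |ν|) := by
    rw [Real.exp_le_exp, le_add_iff_nonneg_right]
    positivity
  refine h6.trans ((add_le_add (h0.trans h7) (hmv.trans
    (mul_le_mul_of_nonneg_left hα.le (by positivity)))).trans_eq ?_)
  ring

lemma sq_sqrt_two_mul_im {τ : ℂ} (hτ : 0 < τ.im) : √(2 * τ.im) ^ 2 = 2 * τ.im :=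
  Real.sq_sqrt (by positivity)

/-- The series for `R` as a sum of products with normally convergent factors. -/
lemma exists_rSeries_factors {τ : ℂ} (hτ : 0 < τ.im) : ∃ f g : ℤ → ℂ → ℂ,
    (∀ n, Differentiable ℂ (f n)) ∧ (∀ n, Differentiable ℂ (g n)) ∧
    (∀ M : ℝ, ∃ b : ℤ → ℝ, Summable b ∧ ∀ n z, ‖z‖ < M → ‖f n z‖ ≤ b n) ∧
    (∀ M : ℝ, ∃ b : ℤ → ℝ, Summable b ∧ ∀ n z, ‖z‖ < M → ‖g n z‖ ≤ b n) ∧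
    ∀ n u α, f n u * g n α = rExp τ n u * rCoeff (√(2 * τ.im)) n α := by
  have hpi := Real.pi_pos
  -- With `ν = n + 1/2`, the exponentials grow like `e^{πyν²}` and the coefficients decay like
  -- `e^{-2πyν²}`. Moving `e^{-(3/2)πyν²}` from one to the other gives each the decay `e^{-πyν²/2}`,
  -- up to factors `e^{O(|ν|)}`.
  refine ⟨fun n u => rExp τ n u * Real.exp (-(3 / 2) * π * τ.im * ((n : ℝ) + 1 / 2) ^ 2),
    fun n α => rCoeff (√(2 * τ.im)) n α * Real.exp (3 / 2 * π * τ.im * ((n : ℝ) + 1 / 2) ^ 2),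
    fun n => ?_, fun n => ?_, fun M => ?_, fun M => ?_, fun n u α => ?_⟩
  · unfold rExp
    fun_prop
  · exact Differentiable.mul_const
      (fun α => (hasDerivAt_rCoeff (√(2 * τ.im)) n α).differentiableAt) _
  · refine ⟨_, summable_exp_half_integer (a := π * τ.im / 2) (by positivity)
      (b := 2 * π * |M|) (by positivity), fun n z hz => ?_⟩
    rw [norm_mul, norm_rExp, norm_real, Real.norm_of_nonneg (Real.exp_pos _).le, ← Real.exp_add,
      Real.exp_le_exp]
    have h1 : ((n : ℝ) + 1 / 2) * z.im ≤ |(n : ℝ) + 1 / 2| * |M| := by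
      refine (le_abs_self _).trans ?_
      rw [abs_mul]
      exact mul_le_mul_of_nonneg_left ((abs_im_le_norm z).trans (hz.le.trans (le_abs_self M)))
        (abs_nonneg _)
    have h2 := mul_le_mul_of_nonneg_left h1 (by positivity : 0 ≤ 2 * π)
    nlinarith
  · refine ⟨_, (summable_exp_half_integer (a := π * τ.im / 2) (by positivity)
      (b := 4 * π * τ.im * |M|) (by positivity)).mul_left
        (1 + 2 * √(2 * τ.im) * |M| * Real.exp (2 * π * τ.im * |M| ^ 2)), fun n z hz => ?_⟩
    rw [norm_mul, norm_real, Real.norm_of_nonneg (Real.exp_pos _).le]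
    have h1 := norm_rCoeff_le hτ (Real.sqrt_nonneg _) (sq_sqrt_two_mul_im hτ) n
      (hz.trans_le (le_abs_self M))
    refine (mul_le_mul_of_nonneg_right h1 (Real.exp_pos _).le).trans_eq ?_
    rw [mul_assoc, ← Real.exp_add]
    congr 2
    ring
  · have : (Real.exp (-(3 / 2) * π * τ.im * ((n : ℝ) + 1 / 2) ^ 2) : ℂ) *
        (Real.exp (3 / 2 * π * τ.im * ((n : ℝ) + 1 / 2) ^ 2) : ℂ) = 1 := by
      rw [← ofReal_mul, ← Real.exp_add, ← ofReal_one, ← Real.exp_zero]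
      ring_nf
    linear_combination rExp τ n u * rCoeff (√(2 * τ.im)) n α * this

lemma analyticAt_rSeries {τ : ℂ} (hτ : 0 < τ.im) (p : ℂ × ℂ) :
    AnalyticAt ℂ (fun p : ℂ × ℂ => rSeries τ p.1 p.2) p := by
  obtain ⟨f, g, hf, hg, hfb, hgb, h⟩ := exists_rSeries_factors hτ
  have := analyticAt_tsum_mul hf hg hfb hgb p
  simp only [h] at this
  exact this

lemma exists_rSeries_bound {τ : ℂ} (hτ : 0 < τ.im) (u : ℂ) (M : ℝ) :
    ∃ b : ℤ → ℝ, Summable b ∧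
      ∀ n α, ‖α‖ < M → ‖rExp τ n u * rCoeff (√(2 * τ.im)) n α‖ ≤ b n := by
  obtain ⟨f, g, -, -, hfb, hgb, h⟩ := exists_rSeries_factors hτ
  obtain ⟨b, hb, hb'⟩ := hfb (‖u‖ + 1)
  obtain ⟨c, hc, hc'⟩ := hgb M
  have hb0 : ∀ n, 0 ≤ b n := fun n => (norm_nonneg _).trans (hb' n u (by simp))
  refine ⟨fun n => (∑' k, b k) * |c n|, hc.abs.mul_left _, fun n α hα => ?_⟩
  rw [← h, norm_mul]
  exact mul_le_mul ((hb' n u (by simp)).trans (hb.le_tsum n fun k _ => hb0 k))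
    ((hc' n α hα).trans (le_abs_self _)) (norm_nonneg _) (tsum_nonneg hb0)

lemma summable_rSeries {τ : ℂ} (hτ : 0 < τ.im) (u α : ℂ) :
    Summable fun n : ℤ => rExp τ n u * rCoeff (√(2 * τ.im)) n α := by
  obtain ⟨b, hb, h⟩ := exists_rSeries_bound hτ u (‖α‖ + 1)
  exact .of_norm_bounded hb fun n => h n α (by simp)

/-- The map `u ↦ (u, Im u / Im τ)`. -/
def imDivMap (τ : ℂ) : ℂ →L[ℝ] ℂ × ℂ :=
  (ContinuousLinearMap.id ℝ ℂ).prod ((τ.im : ℝ)⁻¹ • (ofRealCLM.comp imCLM))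

lemma imDivMap_apply (τ u : ℂ) : imDivMap τ u = (u, ((u.im / τ.im : ℝ) : ℂ)) := by
  simp [imDivMap, div_eq_inv_mul]

lemma R_eq_comp (τ : ℂ) :
    (fun u => R u τ) = (fun p : ℂ × ℂ => rSeries τ p.1 p.2) ∘ imDivMap τ := by
  funext u
  rw [R_eq_rSeries, Function.comp_apply, imDivMap_apply]

lemma analyticAt_R {τ : ℂ} (hτ : 0 < τ.im) (u : ℂ) : AnalyticAt ℝ (fun u => R u τ) u := by
  rw [R_eq_comp]
  exact ((analyticAt_rSeries hτ _).restrictScalars (𝕜 := ℝ)).comp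
    ((imDivMap τ).analyticAt u)

lemma R_add_one (u τ : ℂ) : R (u + 1) τ = -R u τ := by
  rw [R, R, ← tsum_neg]
  refine tsum_congr fun n => ?_
  rw [add_im, one_im, add_zero, ← mul_neg]
  congr 1
  exact exp_eq_neg_exp_of_sub (-n - 1) (by push_cast; ring)

/-- Under `ν ↦ -ν` both `sgn ν - E` and `(-1)^{ν - 1/2}` change sign. -/
lemma R_neg (u τ : ℂ) : R (-u) τ = R u τ := by
  rw [R, R, ← (Equiv.subLeft (-1 : ℤ)).tsum_eq]
  refine tsum_congr fun n => ?_
  have h1 : ((-1 - n : ℤ) : ℝ) + 1 / 2 = -((n : ℝ) + 1 / 2) := by push_cast; ring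
  have h2 : (-1 : ℂ) ^ (-1 - n) = -(-1 : ℂ) ^ n := by
    rw [zpow_sub₀ (by norm_num), zpow_neg, zpow_one, inv_neg_one, neg_div, one_div,
      ← inv_zpow, inv_neg_one]
  have h3 : (-((n : ℝ) + 1 / 2) + (-u).im / τ.im) * √(2 * τ.im) =
      -(((n : ℝ) + 1 / 2 + u.im / τ.im) * √(2 * τ.im)) := by
    rw [neg_im]; ring
  rw [Equiv.subLeft_apply, h1, h2, h3, E_neg, Real.sign_neg]
  have h4 : -π * I * (((-1 - n : ℤ) : ℂ) + 1 / 2) ^ 2 * τ -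
      2 * π * I * (((-1 - n : ℤ) : ℂ) + 1 / 2) * -u =
      -π * I * ((n : ℂ) + 1 / 2) ^ 2 * τ - 2 * π * I * ((n : ℂ) + 1 / 2) * u := by
    push_cast; ring
  rw [h4]
  push_cast
  ring

lemma R_tau_add_one (u τ : ℂ) : R u (τ + 1) = exp (-π * I / 4) * R u τ := by
  rw [R, R, ← tsum_mul_left]
  refine tsum_congr fun n => ?_
  obtain ⟨k, hk⟩ := Int.even_mul_succ_self n
  have hk' : (n : ℂ) * (n + 1) = k + k := by exact_mod_cast hk
  rw [add_im, one_im, add_zero, mul_left_comm, ← exp_add]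
  congr 1
  refine exp_eq_exp_of_sub (-k) ?_
  push_cast
  linear_combination -π * I * hk'

lemma summable_R {τ : ℂ} (hτ : 0 < τ.im) (u : ℂ) : Summable fun n : ℤ =>
    ((Real.sign ((n : ℝ) + 1 / 2) - E (((n : ℝ) + 1 / 2 + u.im / τ.im) * √(2 * τ.im)) : ℝ) : ℂ) *
      rExp τ n u := by
  refine (summable_rSeries hτ u ((u.im / τ.im : ℝ) : ℂ)).congr fun n => ?_
  rw [rCoeff, show ((n : ℂ) + 1 / 2 + ((u.im / τ.im : ℝ) : ℂ)) * (√(2 * τ.im) : ℂ) =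
    ((((n : ℝ) + 1 / 2 + u.im / τ.im) * √(2 * τ.im) : ℝ) : ℂ) by push_cast; ring, Ec_ofReal]
  push_cast
  ring

lemma R_eq_tsum (u τ : ℂ) : R u τ = ∑' n : ℤ,
    ((Real.sign ((n : ℝ) + 1 / 2) - E (((n : ℝ) + 1 / 2 + u.im / τ.im) * √(2 * τ.im)) : ℝ) : ℂ) *
      rExp τ n u :=
  tsum_congr fun n => by rw [rExp, mul_assoc]

/-- Adding `τ` to `u` raises `α` by one, so after `ν ↦ ν - 1` the values of `E` cancel. There
remains `sgn ν - sgn(ν - 1)`, which is `2` at `ν = 1/2` and `0` elsewhere. -/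
lemma R_add_exp_mul_R_add_tau {τ : ℂ} (hτ : 0 < τ.im) (u : ℂ) :
    R u τ + exp (-2 * π * I * u - π * I * τ) * R (u + τ) τ =
      2 * exp (-π * I * u - π * I * τ / 4) := by
  set t : ℤ → ℂ := fun n => ((Real.sign ((n : ℝ) + 1 / 2) -
    E (((n : ℝ) + 1 / 2 + (u + τ).im / τ.im) * √(2 * τ.im)) : ℝ) : ℂ) * rExp τ n (u + τ) with ht
  have h1 : R (u + τ) τ = ∑' n : ℤ, t (n - 1) := by
    rw [R_eq_tsum]; exact ((Equiv.subRight (1 : ℤ)).tsum_eq t).symm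
  have hs1 : Summable fun n : ℤ => t (n - 1) :=
    (Equiv.subRight (1 : ℤ)).summable_iff.mpr (summable_R hτ (u + τ))
  rw [h1, R_eq_tsum, ← tsum_mul_left, ← (summable_R hτ u).tsum_add (hs1.mul_left _),
    tsum_eq_single 0]
  · have hm := sign_add_half 0
    have hm1 := sign_add_half (-1)
    simp only [le_refl, if_true] at hm
    rw [if_neg (by norm_num)] at hm1
    have hα : ((0 - 1 : ℤ) : ℝ) + 1 / 2 + (u + τ).im / τ.im =
        ((0 : ℤ) : ℝ) + 1 / 2 + u.im / τ.im := by
      rw [add_im, add_div, div_self hτ.ne']; push_cast; ring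
    have he : exp (-2 * π * I * u - π * I * τ) * rExp τ (0 - 1) (u + τ) = -rExp τ 0 u := by
      rw [rExp, rExp, mul_left_comm, ← exp_add, zero_sub, zpow_neg, zpow_one, inv_neg_one,
        zpow_zero,
        one_mul, neg_one_mul]
      congr 2
      push_cast; ring
    simp only [ht]
    rw [mul_left_comm, he, hα, hm, zero_sub, hm1, rExp, zpow_zero, one_mul,
      show -π * I * ((0 : ℤ) + 1 / 2 : ℂ) ^ 2 * τ - 2 * π * I * ((0 : ℤ) + 1 / 2 : ℂ) * u =
        -π * I * u - π * I * τ / 4 by push_cast; ring]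
    push_cast
    ring
  · intro n hn
    have hα : ((n - 1 : ℤ) : ℝ) + 1 / 2 + (u + τ).im / τ.im =
        (n : ℝ) + 1 / 2 + u.im / τ.im := by
      rw [add_im, add_div, div_self hτ.ne']; push_cast; ring
    have he : exp (-2 * π * I * u - π * I * τ) * rExp τ (n - 1) (u + τ) = -rExp τ n u := by
      rw [rExp, rExp, mul_left_comm, ← exp_add, zpow_sub_one₀ (by norm_num), inv_neg_one,
        mul_neg_one, neg_mul]
      congr 3
      push_cast; ring
    have hsign : Real.sign (((n - 1 : ℤ) : ℝ) + 1 / 2) = Real.sign ((n : ℝ) + 1 / 2) := by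
      rw [sign_add_half, sign_add_half]
      have : 0 ≤ n - 1 ↔ 0 ≤ n := by omega
      simp only [this]
    simp only [ht]
    rw [mul_left_comm, he, hα, hsign]
    ring

/-! ### The derivative with respect to `ū` -/

/-- The real-differentiable function `f` has `∂f/∂z̄ = d` at `w`. -/
def HasDbarAt (f : ℂ → ℂ) (d w : ℂ) : Prop :=
  ∃ A : ℂ, HasFDerivAt (𝕜 := ℝ) f
    (A • ContinuousLinearMap.id ℝ ℂ + d • (conjCLE : ℂ →L[ℝ] ℂ)) w

lemma HasDbarAt.add {f g : ℂ → ℂ} {d e w : ℂ} (hf : HasDbarAt f d w) (hg : HasDbarAt g e w) :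
    HasDbarAt (fun z => f z + g z) (d + e) w := by
  obtain ⟨A, hA⟩ := hf
  obtain ⟨B, hB⟩ := hg
  refine ⟨A + B, (hA.fun_add hB).congr_fderiv ?_⟩
  ext
  simp
  ring

lemma HasDbarAt.mul_left {f h : ℂ → ℂ} {d w : ℂ} (hh : DifferentiableAt ℂ h w)
    (hf : HasDbarAt f d w) : HasDbarAt (fun z => h z * f z) (h w * d) w := by
  obtain ⟨A, hA⟩ := hf
  have h1 := hh.hasDerivAt.hasFDerivAt.restrictScalars ℝ
  refine ⟨h w * A + deriv h w * f w, (h1.mul hA).congr_fderiv ?_⟩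
  ext
  simp
  ring

lemma HasDbarAt.comp_mul_left {f : ℂ → ℂ} {a d w : ℂ} (hf : HasDbarAt f d (a * w)) :
    HasDbarAt (fun z => f (a * z)) (conj a * d) w := by
  obtain ⟨A, hA⟩ := hf
  have h1 : HasFDerivAt (𝕜 := ℝ) (fun z : ℂ => a * z) (a • ContinuousLinearMap.id ℝ ℂ) w :=
    (hasFDerivAt_id w).const_mul a
  refine ⟨A * a, (hA.comp w h1).congr_fderiv ?_⟩
  ext
  simp
  ring

lemma HasDbarAt.differentiableAt {f : ℂ → ℂ} {w : ℂ} (hf : HasDbarAt f 0 w) :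
    DifferentiableAt ℂ f w := by
  obtain ⟨A, hA⟩ := hf
  rw [differentiableAt_complex_iff_differentiableAt_real]
  refine ⟨hA.differentiableAt, ?_⟩
  rw [hA.fderiv]
  simp [mul_comm]

/-- The series is holomorphic in `u` and `α` separately, so only `∂α/∂ū = i/(2 Im τ)` contributes.
Differentiation in `α` turns `E` into a Gaussian, and completing the square gives the conjugate
terms of θ. -/
lemma hasDbarAt_R {τ : ℂ} (hτ : 0 < τ.im) (u : ℂ) :
    HasDbarAt (fun u => R u τ) (((√(2 * τ.im) / τ.im : ℝ) : ℂ) *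
      ((Real.exp (-2 * π * (u.im ^ 2 / τ.im)) : ℝ) : ℂ) * conj (theta u τ)) u := by
  set s := √(2 * τ.im) with hs
  set α : ℂ := ((u.im / τ.im : ℝ) : ℂ) with hα
  have hy : (τ.im : ℂ) ≠ 0 := by exact_mod_cast hτ.ne'
  have hs2 : (s : ℂ) ^ 2 = 2 * τ.im := by exact_mod_cast sq_sqrt_two_mul_im hτ
  have hP := (analyticAt_rSeries hτ (u, α)).differentiableAt.hasFDerivAt
  set L := fderiv ℂ (fun p : ℂ × ℂ => rSeries τ p.1 p.2) (u, α) with hL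
  -- the partial derivative with respect to `α`
  have hpart : HasDerivAt (fun a => rSeries τ u a) (L (0, 1)) α := by
    have h1 : HasDerivAt (fun a : ℂ => (u, a)) ((0, 1) : ℂ × ℂ) α :=
      (hasDerivAt_const α u).prodMk (hasDerivAt_id α)
    exact hP.comp_hasDerivAt α h1
  have hpart2 : L (0, 1) = -(2 * s * I) * ((Real.exp (-2 * π * (u.im ^ 2 / τ.im)) : ℝ) : ℂ) *
      conj (theta u τ) := by
    obtain ⟨b, hb, hb'⟩ := exists_rSeries_bound hτ u (‖α‖ + 1)
    have h1 := hasSum_deriv_of_summable_norm hb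
      (F := fun (n : ℤ) a => rExp τ n u * rCoeff s n a) (U := Metric.ball 0 (‖α‖ + 1)) (z := α)
      (fun n a _ => ((hasDerivAt_rCoeff s n a).differentiableAt.const_mul
        _).differentiableWithinAt) Metric.isOpen_ball
      (fun n a ha => hb' n a (by simpa using ha)) (by simp)
    have h2 : deriv (fun a => ∑' n, rExp τ n u * rCoeff s n a) α = L (0, 1) := hpart.deriv
    rw [h2] at h1
    rw [← h1.tsum_eq, theta_eq_I_mul_tsum, map_mul, conj_tsum, conj_I, ← mul_assoc,
      ← tsum_mul_left]
    refine tsum_congr fun n => ?_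
    rw [((hasDerivAt_rCoeff s n α).const_mul _).deriv, map_mul, map_zpow₀, map_neg, map_one,
      ← exp_conj, rExp, mul_pow _ (s : ℂ), hs2, ofReal_exp]
    have he : exp (-π * I * ((n : ℂ) + 1 / 2) ^ 2 * τ - 2 * π * I * ((n : ℂ) + 1 / 2) * u) *
        exp (-π * (((n : ℂ) + 1 / 2 + α) ^ 2 * (2 * τ.im))) =
        exp ((-2 * π * (u.im ^ 2 / τ.im) : ℝ) : ℂ) *
          exp (conj (π * I * ((n : ℂ) + 1 / 2) ^ 2 * τ + 2 * π * I * ((n : ℂ) + 1 / 2) * u)) := by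
      have hτc : conj τ = τ - 2 * I * τ.im := by
        apply Complex.ext <;> simp; ring
      have huc : conj u = u - 2 * I * u.im := by
        apply Complex.ext <;> simp; ring
      have hc : conj (π * I * ((n : ℂ) + 1 / 2) ^ 2 * τ + 2 * π * I * ((n : ℂ) + 1 / 2) * u) =
          -(π * I * ((n : ℂ) + 1 / 2) ^ 2 * (τ - 2 * I * τ.im) +
            2 * π * I * ((n : ℂ) + 1 / 2) * (u - 2 * I * u.im)) := by
        simp only [map_add, map_mul, map_pow, conj_I, conj_ofReal, hτc, huc, map_ofNat,
          map_intCast, map_div₀, map_one]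
        ring
      rw [← exp_add, ← exp_add, hc, hα]
      congr 1
      push_cast
      field_simp
      linear_combination -2 * (2 * (n : ℂ) + 1) * (4 * u.im + (2 * n + 1) * τ.im) * τ.im * I_sq
    linear_combination (-(2 * s) * (-1 : ℂ) ^ n) * he + (-2 * s * (-1 : ℂ) ^ n *
      exp ((-2 * π * (u.im ^ 2 / τ.im) : ℝ) : ℂ) *
          exp (conj (π * I * ((n : ℂ) + 1 / 2) ^ 2 * τ + 2 * π * I * ((n : ℂ) + 1 / 2) * u))) *
            I_sq
  have hP2 := (imDivMap_apply τ u ▸ hP.restrictScalars ℝ :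
    HasFDerivAt (𝕜 := ℝ) (fun p : ℂ × ℂ => rSeries τ p.1 p.2) (L.restrictScalars ℝ)
      (imDivMap τ u)).comp u (imDivMap τ).hasFDerivAt
  rw [← R_eq_comp] at hP2
  refine ⟨L (1, 0) - I / (2 * τ.im) * L (0, 1), hP2.congr_fderiv ?_⟩
  have hsplit : ∀ a b : ℂ, L (a, b) = a * L (1, 0) + b * L (0, 1) := by
    intro a b
    have : ((a, b) : ℂ × ℂ) = a • (1, 0) + b • (0, 1) := by simp
    rw [this, map_add, map_smul, map_smul, smul_eq_mul, smul_eq_mul]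
  have hcoef : ((s / τ.im : ℝ) : ℂ) * ((Real.exp (-2 * π * (u.im ^ 2 / τ.im)) : ℝ) : ℂ) *
      conj (theta u τ) = I / (2 * τ.im) * L (0, 1) := by
    rw [hpart2]
    push_cast
    field_simp
    linear_combination s * conj (theta u τ) * I_sq
  rw [hcoef]
  ext z
  simp only [ContinuousLinearMap.comp_apply, ContinuousLinearMap.coe_restrictScalars',
    imDivMap_apply]
  rw [hsplit]
  have hz : conj z = z - 2 * I * z.im := by
    apply Complex.ext <;> simp; ring
  simp only [add_apply, smul_apply, ContinuousLinearMap.id_apply, smul_eq_mul,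
    ContinuousLinearEquiv.coe_coe, conjCLE_apply, hz]
  push_cast
  field_simp
  linear_combination 2 * (z.im : ℂ) * L (0, 1) * I_sq

/-! ### The elliptic transformation laws of `μ̃` -/

lemma muTilde_add_one_left (u v τ : ℂ) : muTilde (u + 1) v τ = -muTilde u v τ := by
  rw [muTilde, muTilde, mu_add_one_left, add_sub_right_comm, R_add_one]
  ring

lemma muTilde_add_one_right (u v τ : ℂ) : muTilde u (v + 1) τ = -muTilde u v τ := by
  have h := R_add_one (u - (v + 1)) τ
  rw [show u - (v + 1) + 1 = u - v by ring] at h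
  rw [muTilde, muTilde, mu_add_one_right, h]
  ring

lemma muTilde_add_tau_add_tau (u v τ : ℂ) : muTilde (u + τ) (v + τ) τ = muTilde u v τ := by
  rw [muTilde, muTilde, mu_add_tau_add_tau, add_sub_add_right_eq_sub]

/-- The defect `-i e^{…}` of `mu` is cancelled by `(i/2) · 2e^{…}` from `R`. -/
lemma muTilde_add_tau_left {u v τ : ℂ} (hτ : 0 < τ.im) (hu : u ∉ lattice τ)
    (hv : v ∉ lattice τ) :
    muTilde (u + τ) v τ = -exp (π * I * τ + 2 * π * I * (u - v)) * muTilde u v τ := by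
  have h1 := mu_add_exp_mul_mu_add_tau hτ hu hv
  have h2 := R_add_exp_mul_R_add_tau hτ (u - v)
  have h3 : exp (π * I * τ + 2 * π * I * (u - v)) *
      exp (-2 * π * I * (u - v) - π * I * τ) = 1 := by
    rw [← exp_add, ← exp_zero]; ring_nf
  rw [muTilde, muTilde, add_sub_right_comm]
  linear_combination exp (π * I * τ + 2 * π * I * (u - v)) * h1 +
    exp (π * I * τ + 2 * π * I * (u - v)) * I / 2 * h2 -
      (mu (u + τ) v τ + I / 2 * R (u - v + τ) τ) * h3

lemma muTilde_add_int {u v τ : ℂ} (hτ : 0 < τ.im) (hu : u ∉ lattice τ)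
    (hv : v ∉ lattice τ) (k l m n : ℤ) :
    muTilde (u + k * τ + l) (v + m * τ + n) τ = (-1 : ℂ) ^ (k + l + m + n) *
      exp (π * I * ((k : ℂ) - m) ^ 2 * τ + 2 * π * I * ((k : ℂ) - m) * (u - v)) *
        muTilde u v τ := by
  have hodd : ∀ i : ℤ, (-1 : ℂ) ^ (i + 1) = -(-1 : ℂ) ^ i := fun i => by
    rw [zpow_add_one₀ (by norm_num), mul_neg_one]
  have hodd' : ∀ i : ℤ, (-1 : ℂ) ^ (i - 1) = -(-1 : ℂ) ^ i := fun i => by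
    rw [zpow_sub_one₀ (by norm_num), inv_neg_one, mul_neg_one]
  have h1 : ∀ (l : ℤ) (u v : ℂ), muTilde (u + l) v τ = (-1 : ℂ) ^ l * muTilde u v τ := by
    intro l u v
    induction l using Int.induction_on with
    | zero => simp
    | succ i ih =>
      rw [hodd, neg_mul, ← ih, ← muTilde_add_one_left]; push_cast; ring_nf
    | pred i ih =>
      have h := muTilde_add_one_left (u + ((-i - 1 : ℤ) : ℂ)) v τ
      rw [show u + ((-i - 1 : ℤ) : ℂ) + 1 = u + ((-i : ℤ) : ℂ) by push_cast; ring, ih] at h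
      rw [hodd', neg_mul, h, neg_neg]
  have h2 : ∀ (n : ℤ) (u v : ℂ), muTilde u (v + n) τ = (-1 : ℂ) ^ n * muTilde u v τ := by
    intro n u v
    induction n using Int.induction_on with
    | zero => simp
    | succ i ih =>
      rw [hodd, neg_mul, ← ih, ← muTilde_add_one_right]; push_cast; ring_nf
    | pred i ih =>
      have h := muTilde_add_one_right u (v + ((-i - 1 : ℤ) : ℂ)) τ
      rw [show v + ((-i - 1 : ℤ) : ℂ) + 1 = v + ((-i : ℤ) : ℂ) by push_cast; ring, ih] at h
      rw [hodd', neg_mul, h, neg_neg]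
  have h3 : ∀ (m : ℤ) (u v : ℂ), muTilde (u + m * τ) (v + m * τ) τ = muTilde u v τ := by
    intro m u v
    induction m using Int.induction_on with
    | zero => simp
    | succ i ih => rw [← ih, ← muTilde_add_tau_add_tau (u + (i : ℤ) * τ)]; push_cast; ring_nf
    | pred i ih =>
      rw [← ih, ← muTilde_add_tau_add_tau (u + ((-i - 1 : ℤ) : ℂ) * τ)]; push_cast; ring_nf
  have hmem : ∀ k : ℤ, u + k * τ ∉ lattice τ := fun k => by
    have := (add_int_mem_lattice (τ := τ) (z := u) k 0).not.mpr hu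
    simpa using this
  have h4 : ∀ k : ℤ, muTilde (u + k * τ) v τ = (-1 : ℂ) ^ k *
      exp (π * I * (k : ℂ) ^ 2 * τ + 2 * π * I * k * (u - v)) * muTilde u v τ := by
    intro k
    induction k using Int.induction_on with
    | zero => simp
    | succ i ih =>
      have h := muTilde_add_tau_left hτ (hmem i) hv
      rw [ih] at h
      rw [show u + ((i + 1 : ℤ) : ℂ) * τ = u + (i : ℤ) * τ + τ by push_cast; ring, h, hodd]
      have e : exp (π * I * (((i + 1 : ℤ) : ℤ) : ℂ) ^ 2 * τ +
          2 * π * I * ((i + 1 : ℤ) : ℂ) * (u - v)) =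
          exp (π * I * τ + 2 * π * I * (u + (i : ℤ) * τ - v)) *
            exp (π * I * ((i : ℤ) : ℂ) ^ 2 * τ + 2 * π * I * ((i : ℤ) : ℂ) * (u - v)) := by
        rw [← exp_add]; congr 1; push_cast; ring
      rw [e]; ring
    | pred i ih =>
      have h := muTilde_add_tau_left hτ (hmem (-i - 1)) hv
      rw [show u + ((-i - 1 : ℤ) : ℂ) * τ + τ = u + (-i : ℤ) * τ by push_cast; ring, ih] at h
      have e : exp (π * I * ((-i : ℤ) : ℂ) ^ 2 * τ + 2 * π * I * ((-i : ℤ) : ℂ) * (u - v)) =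
          exp (π * I * τ + 2 * π * I * (u + ((-i - 1 : ℤ) : ℂ) * τ - v)) *
            exp (π * I * ((-i - 1 : ℤ) : ℂ) ^ 2 * τ +
              2 * π * I * ((-i - 1 : ℤ) : ℂ) * (u - v)) := by
        rw [← exp_add]; congr 1; push_cast; ring
      rw [e] at h
      rw [hodd']
      apply mul_left_cancel₀ (neg_ne_zero.mpr (exp_ne_zero
        (π * I * τ + 2 * π * I * (u + ((-i - 1 : ℤ) : ℂ) * τ - v))))
      rw [← h]
      ring
  -- Simultaneous translation by `mτ` costs nothing, which reduces the shift `(k, m)` to `(k - m,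
  -- 0)`; the parity is unchanged.
  have h5 := h3 m (u + ((k - m : ℤ) : ℂ) * τ) v
  rw [h4] at h5
  rw [h1, h2, show u + (k : ℂ) * τ = u + ((k - m : ℤ) : ℂ) * τ + m * τ by push_cast; ring, h5]
  have e : (-1 : ℂ) ^ (k + l + m + n) = (-1 : ℂ) ^ l * ((-1 : ℂ) ^ n * (-1 : ℂ) ^ (k - m)) := by
    rw [show k + l + m + n = l + (n + (k - m)) + (m + m) by ring, zpow_add₀ (by norm_num),
      zpow_add₀ (by norm_num), zpow_add₀ (by norm_num) n, zpow_add₀ (by norm_num) m,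
      neg_one_zpow_mul_self, mul_one]
  rw [e]
  push_cast
  ring

lemma muTilde_symm {u v τ : ℂ} (hτ : 0 < τ.im) (hu : u ∉ lattice τ) (hv : v ∉ lattice τ) :
    muTilde v u τ = muTilde u v τ := by
  rw [muTilde, muTilde, mu_symm hτ hu hv, ← R_neg (u - v), neg_sub]

lemma muTilde_neg_neg {u τ : ℂ} (v : ℂ) (hu : u ∉ lattice τ) :
    muTilde (-u) (-v) τ = muTilde u v τ := by
  rw [muTilde, muTilde, mu_neg_neg v hu, ← R_neg (u - v), neg_sub, neg_sub_neg]

lemma muTilde_tau_add_one (u v τ : ℂ) :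
    muTilde u v (τ + 1) = exp (-π * I / 4) * muTilde u v τ := by
  rw [muTilde, muTilde, mu_tau_add_one, R_tau_add_one]
  ring

/-! ### The singularities of `μ̃` -/

lemma analyticAt_muTilde {u v τ : ℂ} (hτ : 0 < τ.im) (hu : u ∉ lattice τ) (hv : v ∉ lattice τ) :
    AnalyticAt ℝ (fun u => muTilde u v τ) u := by
  have h1 : AnalyticAt ℂ (fun u => mu u v τ) u := by
    refine analyticAt_of_eventually_differentiableAt ?_
    filter_upwards [eventually_nhds_not_mem_lattice hτ hu] with z hz
    exact differentiableAt_mu hτ (u := fun z => z) (v := fun _ => v) (by fun_prop) (by fun_prop)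
      hz hv
  have h2 : AnalyticAt ℝ (fun u => R (u - v) τ) u :=
    AnalyticAt.fun_comp (g := fun u => R u τ) (analyticAt_R hτ (u - v))
      (analyticAt_id.fun_sub analyticAt_const)
  exact (h1.restrictScalars (𝕜 := ℝ)).fun_add (analyticAt_const.fun_mul h2)

lemma exists_muTilde_eq_div_add {v τ : ℂ} (hτ : 0 < τ.im) (hv : v ∉ lattice τ) :
    ∃ g : ℂ → ℂ, AnalyticAt ℝ g 0 ∧ ∀ᶠ u in 𝓝[≠] 0,
      muTilde u v τ = -1 / (2 * π * I) * (1 / theta v τ) / u + g u := by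
  obtain ⟨g, hg, h⟩ := exists_mu_eq_div_add hτ hv
  have h2 : AnalyticAt ℝ (fun u => R (u - v) τ) 0 :=
    AnalyticAt.fun_comp (g := fun u => R u τ) (analyticAt_R hτ (0 - v))
      (analyticAt_id.fun_sub analyticAt_const)
  refine ⟨fun u => g u + I / 2 * R (u - v) τ,
    (hg.restrictScalars (𝕜 := ℝ)).fun_add (analyticAt_const.fun_mul h2), ?_⟩
  filter_upwards [h] with u hu
  rw [muTilde, hu, add_assoc]

lemma residue_ne_zero {v τ : ℂ} (hτ : 0 < τ.im) (hv : v ∉ lattice τ) :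
    -1 / (2 * π * I) * (1 / theta v τ) ≠ 0 :=
  mul_ne_zero (div_ne_zero (by norm_num) two_pi_I_ne_zero)
    (one_div_ne_zero (theta_ne_zero hτ hv))

lemma exists_muTilde_eq_div_sub_add {v τ p : ℂ} (hτ : 0 < τ.im) (hv : v ∉ lattice τ)
    (hp : p ∈ lattice τ) : ∃ r : ℂ, r ≠ 0 ∧ ∃ g : ℂ → ℂ, AnalyticAt ℝ g p ∧
      ∀ᶠ u in 𝓝[≠] p, muTilde u v τ = r / (u - p) + g u := by
  obtain ⟨g, hg, h⟩ := exists_muTilde_eq_div_add hτ hv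
  obtain ⟨k, l, rfl⟩ := hp
  set p : ℂ := k * τ + l
  set r₀ := -1 / (2 * π * I) * (1 / theta v τ)
  -- The factor by which `muTilde` changes from `w` to `w + p`. Multiplied by the polar part `r₀ /
  -- w`, it gives residue `F 0 * r₀` and an analytic remainder.
  set F : ℂ → ℂ := fun w => (-1 : ℂ) ^ (k + l) *
    exp (π * I * (k : ℂ) ^ 2 * τ + 2 * π * I * k * (w - v)) with hF
  have hFd : Differentiable ℂ F := by fun_prop
  have hF0 : F 0 ≠ 0 := mul_ne_zero (zpow_ne_zero _ (by norm_num)) (exp_ne_zero _)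
  refine ⟨F 0 * r₀, mul_ne_zero hF0 (residue_ne_zero hτ hv),
    fun u => r₀ * dslope F 0 (u - p) + F (u - p) * g (u - p), ?_, ?_⟩
  · have hsub : AnalyticAt ℝ (fun u : ℂ => u - p) p := analyticAt_id.fun_sub analyticAt_const
    have h1 : AnalyticAt ℝ (fun u => dslope F 0 (u - p)) p :=
      AnalyticAt.fun_comp (g := dslope F 0) (by
        rw [sub_self]
        exact (analyticAt_dslope_self (hFd.analyticAt 0)).restrictScalars) hsub
    have h2 : AnalyticAt ℝ (fun u => F (u - p)) p :=
      AnalyticAt.fun_comp (g := F) ((hFd.analyticAt _).restrictScalars) hsub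
    have h3 : AnalyticAt ℝ (fun u => g (u - p)) p :=
      AnalyticAt.fun_comp (g := g) (by rwa [sub_self]) hsub
    exact (analyticAt_const.fun_mul h1).fun_add (h2.fun_mul h3)
  · rw [show 𝓝[≠] p = 𝓝[≠] (0 + p) by rw [zero_add], nhdsNE_add_right, eventually_map]
    filter_upwards [h, self_mem_nhdsWithin, eventually_not_mem_lattice hτ 0] with w hw hw0 hwl
    have hw0 : w ≠ 0 := hw0
    have h4 := muTilde_add_int hτ hwl hv k l 0 0
    have h5 := sub_smul_dslope F 0 w
    rw [sub_zero, smul_eq_mul] at h5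
    have h6 : dslope F 0 w = (F w - F 0) / w := by rw [eq_div_iff hw0, ← h5]; ring
    simp only [Int.cast_zero, zero_mul, add_zero, sub_zero] at h4
    rw [← add_assoc, h4, hw, ← add_assoc, show w + k * τ + l - p = w by simp only [p]; ring, h6]
    simp only [hF]
    field_simp
    ring

lemma tendsto_mul_muTilde {v τ : ℂ} (hτ : 0 < τ.im) (hv : v ∉ lattice τ) :
    Tendsto (fun u => u * muTilde u v τ) (𝓝[≠] 0)
      (𝓝 (-1 / (2 * π * I) * (1 / theta v τ))) := by
  obtain ⟨g, hg, h⟩ := exists_muTilde_eq_div_add hτ hv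
  have h1 : Tendsto (fun u => -1 / (2 * π * I) * (1 / theta v τ) + u * g u) (𝓝[≠] 0)
      (𝓝 (-1 / (2 * π * I) * (1 / theta v τ) + 0 * g 0)) :=
    ((continuousAt_id.mul hg.continuousAt).tendsto.const_add _).mono_left nhdsWithin_le_nhds
  rw [zero_mul, add_zero] at h1
  refine h1.congr' ?_
  filter_upwards [h, self_mem_nhdsWithin] with u hu hu0
  have hu0 : u ≠ 0 := hu0
  rw [hu]
  field_simp

/-! ### The transformation `τ ↦ -1/τ` -/

lemma cpow_half_sq (x : ℂ) : (x ^ (1 / 2 : ℂ)) ^ 2 = x := by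
  rw [← cpow_nat_mul]; norm_num

lemma div_mem_lattice_neg_one_div {u τ : ℂ} (hτ : τ ≠ 0) :
    u / τ ∈ lattice (-1 / τ) ↔ u ∈ lattice τ := by
  constructor
  · rintro ⟨n, m, h⟩
    refine ⟨m, -n, ?_⟩
    field_simp at h
    push_cast
    linear_combination h
  · rintro ⟨n, m, h⟩
    refine ⟨-m, n, ?_⟩
    rw [h]
    push_cast
    field_simp
    ring

/-- This matches the Gaussians in `hasDbarAt_R` at `τ` and `-1/τ`: the discrepancy is
`|e^{πiw²/τ}|²`. -/
lemma gaussian_im_identity {τ : ℂ} (hτ : 0 < τ.im) (w : ℂ) :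
    (w ^ 2 / τ).im + (w / τ).im ^ 2 / (-1 / τ).im = w.im ^ 2 / τ.im := by
  have hN : τ.re * τ.re + τ.im * τ.im ≠ 0 := by nlinarith [mul_self_nonneg τ.re]
  have hy := hτ.ne'
  simp only [div_im, normSq_apply, sq, mul_re, mul_im, neg_im, neg_re, one_im, one_re]
  field_simp
  ring_nf
  field_simp
  ring

lemma sqrt_div_neg_one_div {τ : ℂ} (hτ : 0 < τ.im) :
    √(2 * (-1 / τ).im) / (-1 / τ).im = ‖τ‖ * (√(2 * τ.im) / τ.im) := by
  have hn : 0 < ‖τ‖ := norm_pos_iff.mpr (ne_zero_of_im_pos hτ)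
  have h1 : (-1 / τ).im = τ.im / ‖τ‖ ^ 2 := by
    rw [neg_div, neg_im, one_div, inv_im, ← normSq_eq_norm_sq]; ring
  rw [h1, ← mul_div_assoc, Real.sqrt_div (by positivity), Real.sqrt_sq hn.le]
  field_simp

/-- The nonholomorphic parts of `R` and of its transform under `τ ↦ -1/τ` cancel. -/
lemma differentiable_R_add_R {τ : ℂ} (hτ : 0 < τ.im) :
    Differentiable ℂ fun w => 1 / (-I * τ) ^ (1 / 2 : ℂ) * exp (π * I * w ^ 2 / τ) *
      R (w / τ) (-1 / τ) + R w τ := by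
  intro w
  have h0 := ne_zero_of_im_pos hτ
  set S := (-I * τ) ^ (1 / 2 : ℂ) with hS
  have hS2 : S ^ 2 = -I * τ := cpow_half_sq _
  have hS0 : S ≠ 0 := by
    intro h
    rw [h] at hS2
    simp [h0] at hS2
  have hR := hasDbarAt_R (im_neg_one_div_pos hτ) (τ⁻¹ * w)
  have h1 := (hR.comp_mul_left.mul_left (h := fun w => 1 / S * exp (π * I * w ^ 2 / τ))
    (by fun_prop)).add (hasDbarAt_R hτ w)
  -- Theta inversion supplies a second `conj S` and a conjugate exponential. As `|S|² = |τ|`, all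
  -- moduli cancel and the sign `-1` remains.
  have hval : 1 / S * exp (π * I * w ^ 2 / τ) * (conj τ⁻¹ *
      (((√(2 * (-1 / τ).im) / (-1 / τ).im : ℝ) : ℂ) *
        ((Real.exp (-2 * π * ((τ⁻¹ * w).im ^ 2 / (-1 / τ).im)) : ℝ) : ℂ) *
          conj (theta (τ⁻¹ * w) (-1 / τ)))) + ((√(2 * τ.im) / τ.im : ℝ) : ℂ) *
      ((Real.exp (-2 * π * (w.im ^ 2 / τ.im)) : ℝ) : ℂ) * conj (theta w τ) = 0 := by
    rw [inv_mul_eq_div, theta_neg_one_div w hτ, ← hS, sqrt_div_neg_one_div hτ]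
    have hcS : conj S = ‖τ‖ / S := by
      rw [eq_div_iff hS0, conj_mul', ← ofReal_pow, ← norm_pow, hS2]
      simp
    have hcτ : conj τ = ‖τ‖ ^ 2 / τ := by rw [eq_div_iff h0, conj_mul']
    have hexp : exp (π * I * w ^ 2 / τ) * conj (exp (π * I * w ^ 2 / τ)) *
        ((Real.exp (-2 * π * ((w / τ).im ^ 2 / (-1 / τ).im)) : ℝ) : ℂ) =
        ((Real.exp (-2 * π * (w.im ^ 2 / τ.im)) : ℝ) : ℂ) := by
      rw [mul_conj', ← ofReal_pow, ← ofReal_mul, norm_exp, ← Real.exp_nat_mul, ← Real.exp_add,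
        ← gaussian_im_identity hτ]
      have : (π * I * w ^ 2 / τ).re = -π * (w ^ 2 / τ).im := by
        rw [show π * I * w ^ 2 / τ = I * (π * (w ^ 2 / τ)) by ring, I_mul_re, im_ofReal_mul]
        ring
      rw [this]
      congr 2
      push_cast
      ring
    have hn : (‖τ‖ : ℂ) ≠ 0 := by simpa using h0
    rw [← hexp]
    simp only [map_mul, map_neg, conj_I, map_inv₀, hcS, hcτ, ofReal_mul]
    field_simp
    rw [hS2]
    field_simp
    ring_nf
  rw [hval] at h1
  have h2 := h1.differentiableAt
  simpa only [inv_mul_eq_div] using h2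

lemma muTilde_sub_tau_left {u v τ : ℂ} (hτ : 0 < τ.im) (hu : u ∉ lattice τ)
    (hv : v ∉ lattice τ) :
    muTilde (u - τ) v τ = -exp (π * I * τ - 2 * π * I * (u - v)) * muTilde u v τ := by
  have h := muTilde_add_int hτ hu hv (-1) 0 0 0
  simp only [Int.cast_neg, Int.cast_one, Int.cast_zero, zero_mul, add_zero, neg_mul, one_mul,
    ← sub_eq_add_neg, sub_zero, zpow_neg, zpow_one, inv_neg_one] at h
  rw [h]
  ring_nf

/-- The transformation law of `μ̃` under `τ ↦ -1/τ`. -/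
lemma muTilde_neg_one_div {u v τ : ℂ} (hτ : 0 < τ.im) (hu : u ∉ lattice τ)
    (hv : v ∉ lattice τ) :
    1 / (-I * τ) ^ (1 / 2 : ℂ) * exp (π * I * (u - v) ^ 2 / τ) *
      muTilde (u / τ) (v / τ) (-1 / τ) + muTilde u v τ = 0 := by
  have h0 := ne_zero_of_im_pos hτ
  have hτ' := im_neg_one_div_pos hτ
  have hθd := differentiable_theta hτ
  have hθv := theta_ne_zero hτ hv
  set S := (-I * τ) ^ (1 / 2 : ℂ) with hS
  have hS2 : S ^ 2 = -I * τ := cpow_half_sq _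
  have hS0 : S ≠ 0 := by
    intro h
    rw [h] at hS2
    simp [h0] at hS2
  set τ' := -1 / τ with hτ'def
  have hv' : v / τ ∉ lattice τ' := (div_mem_lattice_neg_one_div h0).not.mpr hv
  set P : ℂ → ℂ := fun u => 1 / S * exp (π * I * (u - v) ^ 2 / τ) with hP
  have hPd : Differentiable ℂ P := by fun_prop
  set F : ℂ → ℂ := fun u => P u * muTilde (u / τ) (v / τ) τ' + muTilde u v τ with hF
  -- `F` splits into `G`, holomorphic off the lattice, and `Q`, which is entire although its two
  -- summands are not holomorphic.
  set G : ℂ → ℂ := fun u => P u * mu (u / τ) (v / τ) τ' + mu u v τ with hG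
  set Q : ℂ → ℂ := fun u => I / 2 * (P u * R ((u - v) / τ) τ' + R (u - v) τ) with hQ
  have hQd : Differentiable ℂ Q :=
    ((differentiable_R_add_R hτ).comp (f := fun u => u - v) (by fun_prop)).const_mul _
  have hFG : ∀ u, F u = G u + Q u := fun u => by
    simp only [hF, hG, hQ, muTilde, sub_div]
    ring
  have hGd : ∀ u, u ∉ lattice τ → DifferentiableAt ℂ G u := fun u hu => by
    have hu' : u / τ ∉ lattice τ' := (div_mem_lattice_neg_one_div h0).not.mpr hu
    exact ((hPd u).fun_mul (differentiableAt_mu hτ' (u := fun u => u / τ) (v := fun _ => v / τ)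
      (by fun_prop) (by fun_prop) hu' hv')).fun_add
      (differentiableAt_mu hτ (u := fun u => u) (v := fun _ => v) (by fun_prop) (by fun_prop)
        hu hv)
  have hFa : ∀ u, u ∉ lattice τ → AnalyticAt ℂ F u := fun u hu => by
    refine analyticAt_of_eventually_differentiableAt ?_
    filter_upwards [eventually_nhds_not_mem_lattice hτ hu] with z hz
    rw [show F = fun u => G u + Q u from funext hFG]
    exact (hGd z hz).fun_add (hQd z)
  have hF1 : ∀ u, u ∉ lattice τ → F (u + 1) = -F u := by
    intro u hu
    have hu' : u / τ ∉ lattice τ' := (div_mem_lattice_neg_one_div h0).not.mpr hu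
    have h1 := muTilde_sub_tau_left hτ' hu' hv'
    have e : exp (π * I * (u + 1 - v) ^ 2 / τ) *
        exp (π * I * τ' - 2 * π * I * (u / τ - v / τ)) = exp (π * I * (u - v) ^ 2 / τ) := by
      rw [← exp_add, hτ'def]
      congr 1
      field_simp
      ring
    simp only [hF, hP, muTilde_add_one_left]
    rw [show (u + 1) / τ = u / τ - τ' by rw [hτ'def]; ring, h1]
    linear_combination -(1 / S * muTilde (u / τ) (v / τ) τ') * e
  have hFt : ∀ u, u ∉ lattice τ →
      F (u + τ) = -exp (π * I * τ + 2 * π * I * (u - v)) * F u := by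
    intro u hu
    have e : exp (π * I * (u + τ - v) ^ 2 / τ) =
        exp (π * I * τ + 2 * π * I * (u - v)) * exp (π * I * (u - v) ^ 2 / τ) := by
      rw [← exp_add]
      congr 1
      field_simp
      ring
    simp only [hF, hP, muTilde_add_tau_left hτ hu hv, e]
    rw [add_div, div_self h0, muTilde_add_one_left]
    ring
  -- The multipliers of `F` are inverse to those of `θ(u - v)`.
  set k : ℂ → ℂ := fun u => F u * theta (u - v) τ with hk
  have hθs : Differentiable ℂ fun u => theta (u - v) τ :=
    hθd.comp (f := fun u => u - v) (by fun_prop)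
  have hk1 : ∀ p, ∀ᶠ u in 𝓝[≠] p, k (u + 1) = k u := fun p => by
    filter_upwards [eventually_not_mem_lattice hτ p] with u hu
    simp only [hk]
    rw [hF1 u hu, add_sub_right_comm, theta_add_one, neg_mul_neg]
  have hkt : ∀ p, ∀ᶠ u in 𝓝[≠] p, k (u + τ) = k u := fun p => by
    filter_upwards [eventually_not_mem_lattice hτ p] with u hu
    simp only [hk]
    have e : exp (π * I * τ + 2 * π * I * (u - v)) *
        exp (-π * I * τ - 2 * π * I * (u - v)) = 1 := by
      rw [← exp_add, ← exp_zero]; ring_nf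
    rw [hFt u hu, add_sub_right_comm, theta_add_tau]
    linear_combination F u * theta (u - v) τ * e
  have hrem0 : RemovableAt F 0 := by
    obtain ⟨g, hg, hge⟩ := exists_mu_eq_div_add hτ hv
    obtain ⟨g', hg', hge'⟩ := exists_mu_eq_div_add hτ' hv'
    set r := -1 / (2 * π * I) * (1 / theta v τ) with hr
    set r' := -1 / (2 * π * I) * (1 / theta (v / τ) τ') with hr'
    -- The residues at `u = 0` cancel; the factor `τ` arises because the pole of the transformed
    -- term is `r' / (u / τ)`.
    have hcancel : P 0 * (r' * τ) + r = 0 := by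
      have hθ := theta_neg_one_div v hτ
      rw [← hS, ← hτ'def] at hθ
      simp only [hP, hr, hr', hθ, zero_sub, neg_sq]
      have h2 : (2 * π * I : ℂ) ≠ 0 := two_pi_I_ne_zero
      have h3 := exp_ne_zero (π * I * v ^ 2 / τ)
      have h4 : 1 / S * exp (π * I * v ^ 2 / τ) * (-1 / (2 * π * I) *
          (1 / (-I * S * exp (π * I * v ^ 2 / τ) * theta v τ)) * τ) =
          τ / (I * S ^ 2) / (2 * π * I) * (1 / theta v τ) := by
        field_simp
      rw [h4, hS2]
      have h5 : τ / (I * (-I * τ)) = 1 := by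
        rw [← mul_assoc, mul_neg, I_mul_I, neg_neg, one_mul, div_self h0]
      rw [h5]
      ring
    have hquot : RemovableAt (fun u => (P u * (r' * τ) + r) / u) 0 := by
      refine removableAt_div (D := fun u => u) (g := fun u => P u * (r' * τ) + r)
        (Differentiable.analyticAt (by fun_prop) 0) EventuallyEq.rfl hcancel analyticAt_id rfl ?_
      simp
    obtain ⟨q, hq, hqe⟩ := hquot
    have hdiv : Tendsto (fun u : ℂ => u / τ) (𝓝[≠] 0) (𝓝[≠] 0) := by
      refine tendsto_nhdsWithin_of_tendsto_nhds_of_eventually_within _ ?_ ?_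
      · have : Continuous fun u : ℂ => u / τ := by fun_prop
        exact (this.tendsto' 0 0 (by simp)).mono_left nhdsWithin_le_nhds
      · filter_upwards [self_mem_nhdsWithin] with u hu
        exact div_ne_zero hu h0
    refine ⟨fun u => q u + (P u * g' (u / τ) + g u) + Q u, ?_, ?_⟩
    · have h1 : AnalyticAt ℂ (fun u => g' (u / τ)) 0 :=
        AnalyticAt.fun_comp (g := g') (by rwa [zero_div])
          (Differentiable.analyticAt (by fun_prop) 0)
      exact (hq.fun_add (((hPd.analyticAt 0).fun_mul h1).fun_add hg)).fun_add (hQd.analyticAt 0)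
    · filter_upwards [hqe, hge, hdiv.eventually hge', self_mem_nhdsWithin] with u h1 h2 h3 hu
      have hu : u ≠ 0 := hu
      rw [hFG, ← h1]
      simp only [hG]
      rw [h2, h3]
      field_simp
      ring
  have hkrem : ∀ p, RemovableAt k p := by
    intro p
    by_cases hp : p ∈ lattice τ
    · obtain ⟨n, m, rfl⟩ := hp
      have := (lattice_translation_invariant (τ := τ) (Q := RemovableAt k)
        (fun p => removableAt_add_iff one_ne_zero (by simpa using hk1 p))
        (fun p => removableAt_add_iff one_ne_zero (by simpa using hkt p)) n m 0).mp
        (hrem0.mul (.of_analyticAt (hθs.analyticAt 0)))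
      simpa using this
    · exact RemovableAt.mul (.of_analyticAt (hFa p hp)) (.of_analyticAt (hθs.analyticAt p))
  obtain ⟨C, hC⟩ := eventuallyEq_const_of_periodic hτ hkrem hk1 hkt
  have hC0 : k v = C := eq_of_continuousAt_of_eventuallyEq (g := fun _ => C)
    ((hFa v hv).continuousAt.mul (hθs v).continuousAt) continuousAt_const (hC v)
  -- `F` is analytic at `u = v`, as `v` is not a lattice point, and `θ(u - v)` vanishes there.
  have hC1 : C = 0 := by rw [← hC0, hk]; simp [theta_zero]
  refine eq_of_continuousAt_of_eventuallyEq (f := F) (g := fun _ => 0) (hFa u hu).continuousAt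
    continuousAt_const ?_
  have hev := eventually_not_mem_lattice hτ (u - v)
  rw [sub_eq_add_neg, nhdsNE_add_right, eventually_map] at hev
  filter_upwards [hC u, hev] with z hz hzl
  rw [hC1] at hz
  exact (mul_eq_zero.mp hz).resolve_right (theta_ne_zero hτ (by rwa [sub_eq_add_neg]))

/-! ### The action of the modular group -/

open scoped MatrixGroups

/-- The Möbius transformation of an integral matrix. -/
def mobius (γ : SL(2, ℤ)) (τ : ℂ) : ℂ :=
  ((γ 0 0 : ℤ) * τ + (γ 0 1 : ℤ)) / ((γ 1 0 : ℤ) * τ + (γ 1 1 : ℤ))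

/-- The automorphy factor `cτ + d`. -/
def autFactor (γ : SL(2, ℤ)) (τ : ℂ) : ℂ := (γ 1 0 : ℤ) * τ + (γ 1 1 : ℤ)

lemma det_eq_one (γ : SL(2, ℤ)) :
    ((γ 0 0 : ℤ) : ℂ) * (γ 1 1 : ℤ) - (γ 0 1 : ℤ) * (γ 1 0 : ℤ) = 1 := by
  have h := γ.det_coe
  rw [Matrix.det_fin_two] at h
  exact_mod_cast h

lemma coe_smul_eq_mobius (γ : SL(2, ℤ)) (z : UpperHalfPlane) : ((γ • z : UpperHalfPlane) : ℂ) =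
    mobius γ z := by
  rw [UpperHalfPlane.coe_specialLinearGroup_apply, mobius]
  simp

lemma im_mobius_pos (γ : SL(2, ℤ)) {τ : ℂ} (hτ : 0 < τ.im) : 0 < (mobius γ τ).im := by
  have h := (γ • (⟨τ, hτ⟩ : UpperHalfPlane)).im_pos
  rwa [← UpperHalfPlane.coe_im, coe_smul_eq_mobius] at h

lemma autFactor_ne_zero (γ : SL(2, ℤ)) {τ : ℂ} (hτ : 0 < τ.im) : autFactor γ τ ≠ 0 := by
  intro h
  have him := congrArg im h
  simp [autFactor, hτ.ne'] at him
  have hre := congrArg re h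
  simp [autFactor, him] at hre
  have hd := det_eq_one γ
  simp [him, hre] at hd

lemma mobius_eq_div (γ : SL(2, ℤ)) (τ : ℂ) :
    mobius γ τ = ((γ 0 0 : ℤ) * τ + (γ 0 1 : ℤ)) / autFactor γ τ := rfl

lemma autFactor_mul (γ δ : SL(2, ℤ)) {τ : ℂ} (hτ : 0 < τ.im) :
    autFactor (γ * δ) τ = autFactor γ (mobius δ τ) * autFactor δ τ := by
  have h := autFactor_ne_zero δ hτ
  rw [autFactor, autFactor, mobius_eq_div, Matrix.SpecialLinearGroup.coe_mul, Matrix.mul_apply,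
    Matrix.mul_apply, Fin.sum_univ_two, Fin.sum_univ_two, add_mul, mul_div_assoc',
    div_mul_cancel₀ _ h, autFactor]
  push_cast
  ring

lemma mobius_mul (γ δ : SL(2, ℤ)) {τ : ℂ} (hτ : 0 < τ.im) :
    mobius (γ * δ) τ = mobius γ (mobius δ τ) := by
  have := congrArg (fun z : UpperHalfPlane => (z : ℂ)) (mul_smul γ δ (⟨τ, hτ⟩ : UpperHalfPlane))
  simpa only [coe_smul_eq_mobius] using this

lemma not_mem_lattice_div_autFactor (γ : SL(2, ℤ)) {τ u : ℂ} (hτ : 0 < τ.im)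
    (hu : u ∉ lattice τ) : u / autFactor γ τ ∉ lattice (mobius γ τ) := by
  rintro ⟨n, m, h⟩
  have h0 := autFactor_ne_zero γ hτ
  rw [mobius_eq_div] at h
  field_simp at h
  refine hu ⟨n * γ 0 0 + m * γ 1 0, n * γ 0 1 + m * γ 1 1, ?_⟩
  rw [h, autFactor]
  push_cast
  ring

/-- The modular transformation law of weight two of `η³ μ̃` for the matrix `γ`. -/
def IsModularFor (γ : SL(2, ℤ)) : Prop :=
  ∀ τ u v : ℂ, 0 < τ.im → u ∉ lattice τ → v ∉ lattice τ →
    ModularForm.eta (mobius γ τ) ^ 3 *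
        muTilde (u / autFactor γ τ) (v / autFactor γ τ) (mobius γ τ) =
      autFactor γ τ ^ 2 * exp (-π * I * (γ 1 0 : ℤ) * (u - v) ^ 2 / autFactor γ τ) *
        (ModularForm.eta τ ^ 3 * muTilde u v τ)

/-- The square of `autFactor` is a true cocycle, so no roots have to be compared. The Gaussian
exponents add up because `c_{γδ} j_δ = c_γ + c_δ j_{γδ}`, a consequence of `det δ = 1`. -/
lemma IsModularFor.mul {γ δ : SL(2, ℤ)} (hγ : IsModularFor γ) (hδ : IsModularFor δ) :
    IsModularFor (γ * δ) := by
  intro τ u v hτ hu hv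
  have h1 := hγ (mobius δ τ) (u / autFactor δ τ) (v / autFactor δ τ) (im_mobius_pos δ hτ)
    (not_mem_lattice_div_autFactor δ hτ hu) (not_mem_lattice_div_autFactor δ hτ hv)
  have h2 := hδ τ u v hτ hu hv
  have hj := autFactor_ne_zero δ hτ
  have hk := autFactor_ne_zero γ (im_mobius_pos δ hτ)
  rw [h2, div_div, div_div, mul_comm (autFactor δ τ), ← autFactor_mul γ δ hτ,
    ← mobius_mul γ δ hτ] at h1
  rw [h1]
  have e : exp (-π * I * (γ 1 0 : ℤ) * (u / autFactor δ τ - v / autFactor δ τ) ^ 2 /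
      autFactor γ (mobius δ τ)) * exp (-π * I * (δ 1 0 : ℤ) * (u - v) ^ 2 / autFactor δ τ) =
      exp (-π * I * ((γ * δ) 1 0 : ℤ) * (u - v) ^ 2 / autFactor (γ * δ) τ) := by
    rw [← exp_add, autFactor_mul γ δ hτ]
    congr 1
    have hc : (((γ * δ) 1 0 : ℤ) : ℂ) * autFactor δ τ =
        (γ 1 0 : ℤ) + (δ 1 0 : ℤ) * (autFactor γ (mobius δ τ) * autFactor δ τ) := by
      rw [← autFactor_mul γ δ hτ, autFactor, autFactor, Matrix.SpecialLinearGroup.coe_mul,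
        Matrix.mul_apply, Matrix.mul_apply, Fin.sum_univ_two, Fin.sum_univ_two]
      push_cast
      linear_combination ((γ 1 0 : ℤ) : ℂ) * det_eq_one δ
    have hc' : (((γ * δ) 1 0 : ℤ) : ℂ) = ((γ 1 0 : ℤ) + (δ 1 0 : ℤ) *
        (autFactor γ (mobius δ τ) * autFactor δ τ)) / autFactor δ τ := by
      rw [eq_div_iff hj, hc]
    rw [hc']
    field_simp
    ring
  rw [← e, autFactor_mul γ δ hτ]
  ring

lemma autFactor_one (τ : ℂ) : autFactor 1 τ = 1 := by simp [autFactor]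

lemma mobius_one (τ : ℂ) : mobius 1 τ = τ := by simp [mobius]

lemma IsModularFor.inv {γ : SL(2, ℤ)} (hγ : IsModularFor γ) : IsModularFor γ⁻¹ := by
  intro τ u v hτ hu hv
  have h1 := hγ (mobius γ⁻¹ τ) (u / autFactor γ⁻¹ τ) (v / autFactor γ⁻¹ τ)
    (im_mobius_pos _ hτ) (not_mem_lattice_div_autFactor _ hτ hu)
    (not_mem_lattice_div_autFactor _ hτ hv)
  have hj := autFactor_ne_zero γ⁻¹ hτ
  have hmul := autFactor_mul γ γ⁻¹ hτ
  have hmob := mobius_mul γ γ⁻¹ hτ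
  rw [mul_inv_cancel, autFactor_one] at hmul
  rw [mul_inv_cancel, mobius_one] at hmob
  rw [← hmob, div_div, div_div, mul_comm (autFactor γ⁻¹ τ), ← hmul, div_one, div_one] at h1
  have hk : autFactor γ (mobius γ⁻¹ τ) = 1 / autFactor γ⁻¹ τ := by
    rw [eq_div_iff hj, ← hmul]
  have hc : ((γ⁻¹ 1 0 : ℤ) : ℂ) = -((γ 1 0 : ℤ) : ℂ) := by
    rw [Matrix.SpecialLinearGroup.SL2_inv_expl]
    simp
  have e : exp (-π * I * (γ⁻¹ 1 0 : ℤ) * (u - v) ^ 2 / autFactor γ⁻¹ τ) *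
      exp (-π * I * (γ 1 0 : ℤ) * (u / autFactor γ⁻¹ τ - v / autFactor γ⁻¹ τ) ^ 2 /
        autFactor γ (mobius γ⁻¹ τ)) = 1 := by
    rw [← exp_add, ← exp_zero, hc, hk]
    congr 1
    field_simp
    ring
  rw [hk] at e h1
  rw [h1]
  have hjj : autFactor γ⁻¹ τ ^ 2 * (1 / autFactor γ⁻¹ τ) ^ 2 = 1 := by
    rw [← mul_pow, mul_one_div, div_self hj, one_pow]
  generalize ModularForm.eta (mobius γ⁻¹ τ) ^ 3 * muTilde (u / autFactor γ⁻¹ τ)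
    (v / autFactor γ⁻¹ τ) (mobius γ⁻¹ τ) = X
  generalize autFactor γ⁻¹ τ ^ 2 = A at hjj ⊢
  generalize (1 / autFactor γ⁻¹ τ) ^ 2 = B at hjj ⊢
  generalize exp (-π * I * (γ⁻¹ 1 0 : ℤ) * (u - v) ^ 2 / autFactor γ⁻¹ τ) = p at e ⊢
  generalize exp _ = q at e ⊢
  linear_combination (-X) * e - X * p * q * hjj

lemma eta_add_one (τ : ℂ) : ModularForm.eta (τ + 1) = exp (π * I / 12) * ModularForm.eta τ := by
  have h1 : ∀ n : ℕ, ModularForm.eta_q n (τ + 1) = ModularForm.eta_q n τ := fun n => by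
    rw [ModularForm.eta_q_eq_pow, ModularForm.eta_q_eq_pow]
    congr 1
    exact exp_eq_exp_of_sub 1 (by push_cast; ring)
  have h2 : Function.Periodic.qParam 24 (τ + 1) =
      exp (π * I / 12) * Function.Periodic.qParam 24 τ := by
    rw [Function.Periodic.qParam, Function.Periodic.qParam, ← exp_add]
    congr 1
    push_cast
    ring
  simp only [ModularForm.eta, h1, h2, mul_assoc]

lemma isModularFor_T : IsModularFor ModularGroup.T := by
  intro τ u v hτ hu hv
  have hm : mobius ModularGroup.T τ = τ + 1 := by simp [mobius, ModularGroup.T]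
  have ha : autFactor ModularGroup.T τ = 1 := by simp [autFactor, ModularGroup.T]
  have hc : ModularGroup.T 1 0 = 0 := by simp [ModularGroup.T]
  rw [hm, ha, hc, div_one, div_one, eta_add_one, muTilde_tau_add_one]
  have e : exp (π * I / 12) ^ 3 * exp (-π * I / 4) = 1 := by
    rw [← exp_nat_mul, ← exp_add, ← exp_zero]
    congr 1
    push_cast
    ring
  simp only [Int.cast_zero, mul_zero, zero_mul, zero_div, exp_zero, one_pow, one_mul]
  linear_combination ModularForm.eta τ ^ 3 * muTilde u v τ * e

lemma eta_neg_one_div {τ : ℂ} (hτ : 0 < τ.im) :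
    ModularForm.eta (-1 / τ) = (-I * τ) ^ (1 / 2 : ℂ) * ModularForm.eta τ := by
  have h0 := ne_zero_of_im_pos hτ
  have h := ModularForm.eta_comp_eq_csqrt_I_inv hτ
  simp only [Function.comp_apply, Pi.smul_apply, Pi.mul_apply, smul_eq_mul] at h
  rw [h, ← mul_assoc]
  congr 1
  -- As `arg τ` lies in `[0, π]`, adding `arg (-I) = -π/2` does not cross the branch cut, so the
  -- separate roots of `I` and `τ` combine into one.
  have hlog : log (-I * τ) = log (-I) + log τ := by
    rw [log_mul_eq_add_log_iff (neg_ne_zero.mpr I_ne_zero) h0, arg_neg_I]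
    have h1 := arg_nonneg_iff.mpr hτ.le
    have h2 := arg_le_pi τ
    constructor <;> linarith [Real.pi_pos]
  rw [sqrt_eq_exp I_ne_zero, sqrt_eq_exp h0, ← exp_neg, ← exp_add,
    cpow_def_of_ne_zero (mul_ne_zero (neg_ne_zero.mpr I_ne_zero) h0), hlog, log_neg_I, log_I]
  congr 1
  ring

lemma isModularFor_S : IsModularFor ModularGroup.S := by
  intro τ u v hτ hu hv
  have hm : mobius ModularGroup.S τ = -1 / τ := by simp [mobius, ModularGroup.S]
  have ha : autFactor ModularGroup.S τ = τ := by simp [autFactor, ModularGroup.S]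
  have hc : ModularGroup.S 1 0 = 1 := by simp [ModularGroup.S]
  have h0 := ne_zero_of_im_pos hτ
  rw [hm, ha, hc, eta_neg_one_div hτ]
  have h := muTilde_neg_one_div hτ hu hv
  have hS2 := cpow_half_sq (-I * τ)
  generalize (-I * τ) ^ (1 / 2 : ℂ) = S at h hS2 ⊢
  have hS0 : S ≠ 0 := by
    intro h
    rw [h] at hS2
    simp [h0] at hS2
  have e : exp (-π * I * (1 : ℤ) * (u - v) ^ 2 / τ) * exp (π * I * (u - v) ^ 2 / τ) = 1 := by
    rw [← exp_add, ← exp_zero]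
    congr 1
    push_cast
    ring
  have hμ : muTilde (u / τ) (v / τ) (-1 / τ) =
      -S * exp (-π * I * (1 : ℤ) * (u - v) ^ 2 / τ) * muTilde u v τ := by
    have h2 : muTilde u v τ = -(1 / S * exp (π * I * (u - v) ^ 2 / τ) *
      muTilde (u / τ) (v / τ) (-1 / τ)) := by linear_combination h
    rw [h2]
    have h3 : S * (1 / S) = 1 := by rw [mul_one_div, div_self hS0]
    linear_combination (-(muTilde (u / τ) (v / τ) (-1 / τ))) * e - exp (-π * I * (1 : ℤ) *
      (u - v) ^ 2 / τ) * exp (π * I * (u - v) ^ 2 / τ) * muTilde (u / τ) (v / τ) (-1 / τ) * h3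
  -- `η³` contributes `S³` and `muTilde` contributes `-S`; together they give the weight-two factor
  -- `τ²`.
  have hS4 : S ^ 4 = -τ ^ 2 := by
    rw [show S ^ 4 = (S ^ 2) ^ 2 by ring, hS2]
    linear_combination τ ^ 2 * I_sq
  rw [hμ]
  linear_combination (-(exp (-π * I * (1 : ℤ) * (u - v) ^ 2 / τ) * ModularForm.eta τ ^ 3 *
    muTilde u v τ)) * hS4

lemma isModularFor (γ : SL(2, ℤ)) : IsModularFor γ := by
  have hγ : γ ∈ Subgroup.closure {ModularGroup.S, ModularGroup.T} := by
    rw [SpecialLinearGroup.SL2Z_generators]; trivial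
  induction hγ using Subgroup.closure_induction with
  | mem x hx =>
    rcases hx with rfl | rfl
    · exact isModularFor_S
    · exact isModularFor_T
  | one =>
    have := isModularFor_T.mul isModularFor_T.inv
    rwa [mul_inv_cancel] at this
  | mul x y _ _ hx hy => exact hx.mul hy
  | inv x _ hx => exact hx.inv

/-! ### The multiplier of the eta function -/

/-- `η²⁴` is the discriminant, which is invariant in weight `12` under both generators. -/
lemma eta_mobius_pow (γ : SL(2, ℤ)) {τ : ℂ} (hτ : 0 < τ.im) :
    ModularForm.eta (mobius γ τ) ^ 24 = autFactor γ τ ^ 12 * ModularForm.eta τ ^ 24 := by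
  have h := congrFun (SlashInvariantForm.slash_action_generators_SL2Z
    ModularForm.discriminant_S_invariant ModularForm.discriminant_T_invariant γ)
    (⟨τ, hτ⟩ : UpperHalfPlane)
  rw [ModularForm.SL_slash_apply, ModularForm.discriminant, ModularForm.discriminant,
    coe_smul_eq_mobius] at h
  have hd : UpperHalfPlane.denom γ (⟨τ, hτ⟩ : UpperHalfPlane) = autFactor γ τ := by
    simp [UpperHalfPlane.denom, autFactor]
  rw [hd, zpow_neg, ← div_eq_mul_inv,
    div_eq_iff (zpow_ne_zero _ (autFactor_ne_zero γ hτ))] at h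
  rw [h, mul_comm]
  rfl

lemma etaMultiplier_eq (γ : SL(2, ℤ)) (τ : ℂ) :
    etaMultiplier (γ 0 0) (γ 0 1) (γ 1 0) (γ 1 1) τ = ModularForm.eta (mobius γ τ) /
      (autFactor γ τ ^ (1 / 2 : ℂ) * ModularForm.eta τ) := rfl

lemma etaMultiplier_pow (γ : SL(2, ℤ)) {τ : ℂ} (hτ : 0 < τ.im) :
    etaMultiplier (γ 0 0) (γ 0 1) (γ 1 0) (γ 1 1) τ ^ 24 = 1 := by
  have hη : ModularForm.eta τ ≠ 0 := ModularForm.eta_ne_zero hτ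
  have h1 : (autFactor γ τ ^ (1 / 2 : ℂ)) ^ 24 = autFactor γ τ ^ 12 := by
    rw [show (24 : ℕ) = 2 * 12 by norm_num, pow_mul, cpow_half_sq]
  rw [etaMultiplier_eq, div_pow, mul_pow, h1, eta_mobius_pow γ hτ,
    div_self (mul_ne_zero (pow_ne_zero _ (autFactor_ne_zero γ hτ)) (pow_ne_zero _ hη))]

lemma continuousOn_etaMultiplier (γ : SL(2, ℤ)) :
    ContinuousOn (etaMultiplier (γ 0 0) (γ 0 1) (γ 1 0) (γ 1 1))
      UpperHalfPlane.upperHalfPlaneSet := by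
  intro τ hτ
  have hτ : 0 < τ.im := hτ
  have hη : ∀ z : ℂ, 0 < z.im → ContinuousAt ModularForm.eta z := fun z hz =>
    (ModularForm.differentiableAt_eta_of_mem_upperHalfPlaneSet hz).continuousAt
  have hj : Continuous (autFactor γ) := by unfold autFactor; fun_prop
  have hm : ContinuousAt (mobius γ) τ := by
    refine ContinuousAt.div (by fun_prop) hj.continuousAt (autFactor_ne_zero γ hτ)
  -- Either `c = 0` and the root is constant, or `cτ + d` is not real and so avoids the branch cut.
  have hs : ContinuousAt (fun τ => autFactor γ τ ^ (1 / 2 : ℂ)) τ := by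
    by_cases hc : γ 1 0 = 0
    · simp only [autFactor, hc, Int.cast_zero, zero_mul, zero_add]
      exact continuousAt_const
    · refine hj.continuousAt.cpow continuousAt_const (Or.inr ?_)
      simp [autFactor, hc, hτ.ne']
  have hne : autFactor γ τ ^ (1 / 2 : ℂ) * ModularForm.eta τ ≠ 0 := by
    refine mul_ne_zero (fun h => ?_) (ModularForm.eta_ne_zero hτ)
    exact autFactor_ne_zero γ hτ (by rw [← cpow_half_sq (autFactor γ τ), h]; simp)
  exact ((ContinuousAt.comp (hη _ (im_mobius_pos γ hτ)) hm).div
    (hs.mul (hη τ hτ)) hne).continuousWithinAt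

/-- A continuous map from a connected set into the finite set of 24th roots of unity is constant. -/
lemma etaMultiplier_const (γ : SL(2, ℤ)) {τ τ' : ℂ} (hτ : 0 < τ.im) (hτ' : 0 < τ'.im) :
    etaMultiplier (γ 0 0) (γ 0 1) (γ 1 0) (γ 1 1) τ =
      etaMultiplier (γ 0 0) (γ 0 1) (γ 1 0) (γ 1 1) τ' := by
  have hfin : {x : ℂ | x ^ 24 = 1}.Finite := by
    refine (Polynomial.nthRoots 24 (1 : ℂ)).toFinset.finite_toSet.subset fun x hx => ?_
    simpa [Polynomial.mem_nthRoots] using hx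
  exact (convex_halfSpace_im_gt 0).isPreconnected.constant_of_mapsTo hfin.isDiscrete
    (continuousOn_etaMultiplier γ) (fun z hz => etaMultiplier_pow γ hz) hτ hτ'

/-- Division by `η(γτ)³` suffices: with `J = (cτ + d)^{1/2}`, the factor `v(γ)⁻³` contains `J³`, and
`J³ · J = J⁴ = (cτ + d)²`. -/
lemma muTilde_modular (γ : SL(2, ℤ)) {τ u v : ℂ} (hτ : 0 < τ.im) (hu : u ∉ lattice τ)
    (hv : v ∉ lattice τ) :
    muTilde (u / autFactor γ τ) (v / autFactor γ τ) (mobius γ τ) =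
      etaMultiplier (γ 0 0) (γ 0 1) (γ 1 0) (γ 1 1) τ ^ (-3 : ℤ) *
        autFactor γ τ ^ (1 / 2 : ℂ) *
        exp (-π * I * (γ 1 0 : ℤ) * (u - v) ^ 2 / autFactor γ τ) * muTilde u v τ := by
  have h := isModularFor γ τ u v hτ hu hv
  have hη : ModularForm.eta τ ≠ 0 := ModularForm.eta_ne_zero hτ
  have hη' : ModularForm.eta (mobius γ τ) ≠ 0 := ModularForm.eta_ne_zero (im_mobius_pos γ hτ)
  have hJ2 := cpow_half_sq (autFactor γ τ)
  have hj := autFactor_ne_zero γ hτ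
  rw [etaMultiplier_eq]
  generalize exp (-π * I * (γ 1 0 : ℤ) * (u - v) ^ 2 / autFactor γ τ) = e at h ⊢
  generalize muTilde (u / autFactor γ τ) (v / autFactor γ τ) (mobius γ τ) = m at h ⊢
  generalize autFactor γ τ ^ (1 / 2 : ℂ) = J at hJ2 ⊢
  have h4 : autFactor γ τ ^ 2 = J ^ 4 := by rw [← hJ2]; ring
  rw [h4] at h
  rw [zpow_neg, show (3 : ℤ) = (3 : ℕ) by norm_num, zpow_natCast, ← inv_pow, inv_div, div_pow]
  field_simp
  linear_combination h

end MockTheta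

end

/-! ### Assembly of the five statements -/

theorem mainTheorem1 :
    -- (1) elliptic transformation law
    (∀ τ u v : ℂ, 0 < τ.im → u ∉ MockTheta.lattice τ → v ∉ MockTheta.lattice τ →
      ∀ k l m n : ℤ,
        MockTheta.muTilde (u + k * τ + l) (v + m * τ + n) τ =
          (-1 : ℂ) ^ (k + l + m + n) *
            exp (π * I * ((k : ℂ) - m) ^ 2 * τ + 2 * π * I * ((k : ℂ) - m) * (u - v)) *
            MockTheta.muTilde u v τ) ∧
    -- (2) modular transformation law, whose multiplier depends only on the matrix
    (∀ a b c d : ℤ, a * d - b * c = 1 →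
      (∀ τ τ' : ℂ, 0 < τ.im → 0 < τ'.im →
        MockTheta.etaMultiplier a b c d τ = MockTheta.etaMultiplier a b c d τ') ∧
      (∀ τ u v : ℂ, 0 < τ.im → u ∉ MockTheta.lattice τ → v ∉ MockTheta.lattice τ →
        MockTheta.muTilde (u / (c * τ + d)) (v / (c * τ + d)) ((a * τ + b) / (c * τ + d)) =
          MockTheta.etaMultiplier a b c d τ ^ (-3 : ℤ) * (c * τ + d) ^ (1 / 2 : ℂ) *
            exp (-π * I * c * (u - v) ^ 2 / (c * τ + d)) * MockTheta.muTilde u v τ)) ∧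
    -- (3) symmetry and evenness
    (∀ τ u v : ℂ, 0 < τ.im → u ∉ MockTheta.lattice τ → v ∉ MockTheta.lattice τ →
      MockTheta.muTilde (-u) (-v) τ = MockTheta.muTilde v u τ ∧
      MockTheta.muTilde v u τ = MockTheta.muTilde u v τ) ∧
    -- (4) simultaneous translation of both variables
    (∀ τ u v z : ℂ, 0 < τ.im → u ∉ MockTheta.lattice τ → v ∉ MockTheta.lattice τ →
      u + z ∉ MockTheta.lattice τ → v + z ∉ MockTheta.lattice τ →
      MockTheta.muTilde (u + z) (v + z) τ - MockTheta.muTilde u v τ =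
        1 / (2 * π * I) *
          (deriv (fun w => MockTheta.theta w τ) 0 * MockTheta.theta (u + v + z) τ *
              MockTheta.theta z τ) /
            (MockTheta.theta u τ * MockTheta.theta v τ * MockTheta.theta (u + z) τ *
              MockTheta.theta (v + z) τ)) ∧
    -- (5) singularities in `u`: real-analytic off the lattice, of simple-pole type at every
    -- lattice point, with the given limit at the origin
    (∀ τ v : ℂ, 0 < τ.im → v ∉ MockTheta.lattice τ →
      AnalyticOnNhd ℝ (fun u => MockTheta.muTilde u v τ) (MockTheta.lattice τ)ᶜ ∧
      (∀ p ∈ MockTheta.lattice τ, ∃ r : ℂ, r ≠ 0 ∧ ∃ g : ℂ → ℂ, AnalyticAt ℝ g p ∧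
        ∀ᶠ u in 𝓝[≠] p, MockTheta.muTilde u v τ = r / (u - p) + g u) ∧
      Tendsto (fun u => u * MockTheta.muTilde u v τ) (𝓝[≠] 0)
        (𝓝 (-1 / (2 * π * I) * (1 / MockTheta.theta v τ)))) := by
  refine ⟨fun τ u v hτ hu hv => MockTheta.muTilde_add_int hτ hu hv, fun a b c d h => ?_,
    fun τ u v hτ hu hv => ⟨(MockTheta.muTilde_neg_neg v hu).trans
      (MockTheta.muTilde_symm hτ hu hv).symm, MockTheta.muTilde_symm hτ hu hv⟩,
    fun τ u v z hτ hu hv huz hvz => ?_, fun τ v hτ hv => ⟨fun u hu =>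
      MockTheta.analyticAt_muTilde hτ hu hv, fun p hp =>
      MockTheta.exists_muTilde_eq_div_sub_add hτ hv hp, MockTheta.tendsto_mul_muTilde hτ hv⟩⟩
  · let γ : Matrix.SpecialLinearGroup (Fin 2) ℤ := ⟨!![a, b; c, d], by
      rw [Matrix.det_fin_two_of, h]⟩
    exact ⟨fun τ τ' hτ hτ' => MockTheta.etaMultiplier_const γ hτ hτ',
      fun τ u v hτ hu hv => MockTheta.muTilde_modular γ hτ hu hv⟩
  -- `R` depends only on the difference of the two arguments, so it drops out of (4).
  · rw [MockTheta.muTilde, MockTheta.muTilde, add_sub_add_right_eq_sub,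
      add_sub_add_right_eq_sub]
    exact MockTheta.mu_add_sub_mu hτ hu hv huz hvz
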